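/- Let $d\ge 1$ and let $\mathcal H=\ell^2(\mathbb Z^d)$ or $\mathcal H=\mathrm L^2(\mathbb R^d)$; $\mathcal H_c$ denotes the functions in $\mathcal H$ with compact support, and $\chi_a$ ($a\in\mathbb Z^d$) the multiplication by the characteristic function of the unit cube centered at $a$ (of the point $a$ on the lattice). Let $(\Omega,\mathbb P)$ be a probability space with an ergodic measure preserving action $(\tau_a)_{a\in\mathbb Z^d}$ and let $U$ be a unitary projective representation of $\mathbb Z^d$ on $\mathcal H$ with $U(a)\chi_bU(a)^*=\chi_{b+a}$. Let $H=(H_\omega)$ be an ergodic magnetic Schrödinger operator, i.e. a measurable family of self-adjoint operators with $U(a)H_\omega U(a)^*=H_{\tau_a\omega}$ almost surely, of the form * (lattice) $H_\omega=-\Delta(\vartheta_\omega)+V_\omega$ (closure from $\mathcal H_c$), $(-\Delta(\vartheta)\varphi)(x)=\sum_{|y-x|=1}\mathrm e^{-\mathrm i\vartheta(x,y)}\varphi(y)$, with random real $\vartheta_\omega(x,y)=-\vartheta_\omega(y,x)$ and $V_\omega$ real and almost surely bounded from below; or * (continuum) $H_\omega=(-\mathrm i\nabla-\mathbf A_\omega)^2+V_\omega$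 (closure from $C_c^\infty(\mathbb R^d)$), with random $\mathbf A_\omega\in \mathrm L^4_{loc}$, $\nabla\cdot\mathbf A_\omega\in \mathrm L^2_{loc}$, $V_\omega\in \mathrm L^2_{loc}$ such that almost surely $H_\omega$ is essentially self-adjoint on $C_c^\infty(\mathbb R^d)$ and $H_\omega+\gamma\ge 1$ for some $\gamma\ge0$ independent of $\omega$. Let $\mathcal K_2$ be the Hilbert space of measurable covariant ($U(a)A_\omega U(a)^*=A_{\tau_a\omega}$) locally bounded ($\|A_\omega\chi_a\|,\|\chi_aA_\omega\|<\infty$ for all $a$) random operators $A_\omega:\mathcal H_c\to\mathcal H$, identified if almost surely equal, with $\mathbb E\,\mathrm{tr}(\chi_0|A_\omega|^2\chi_0)<\infty$ and inner product $\langle\langle A,B\rangle\rangle=\mathbb E\,\mathrm{tr}(\chi_0A_\omega^*B_\omega\chi_0)$. For $A\in\mathcal K_2$ put $A^\ddagger_\omega=A_\omega^*|_{\mathcal H_c}$ and, for a bounded measurable covariant $B$, $(B\odot_LA)_\omega=B_\omega A_\omega$ and $(A\odot_RB)_\omega=(A_\omega^\ddagger)^*B_\omega$. Let $\mathcal H_L,\mathcal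 H_R,\mathcal L$ be the commuting self-adjoint operators on $\mathcal K_2$ with $$\mathrm e^{-\mathrm it\mathcal H_L}A=\mathrm e^{-\mathrm itH}\odot_LA,\qquad \mathrm e^{-\mathrm it\mathcal H_R}A=A\odot_R\mathrm e^{-\mathrm itH},\qquad \mathrm e^{-\mathrm it\mathcal L}A=\mathrm e^{-\mathrm itH}\odot_LA\odot_R\mathrm e^{\mathrm itH}.$$ Let $E_F\in\mathbb R$, $P_{E_F}=\chi_{]-\infty,E_F]}(H)$, let $X_1$ be the multiplication by the first coordinate, and assume that $Y_{E_F}:=\mathrm i[X_1,P_{E_F}]\in\mathcal K_2$ (in particular $P_{E_F}\mathcal H_c$ is almost surely contained in the domain of $X_1$). Put $\mathcal P_{E_F}=\chi_{]-\infty,E_F]}(\mathcal H_L)-\chi_{]-\infty,E_F]}(\mathcal H_R)$. Define the correlation measure on $\mathbb R^2$, the conductivity measure on $\mathbb R$ and the average in phase conductivity by $$\Psi_{E_F}(C)=\langle\langle Y_{E_F},\chi_C(\mathcal H_L,\mathcal H_R)Y_{E_F}\rangle\rangle,\quad \Sigma_{E_F}(B)=\pi\langle\langle Y_{E_F},\chi_B(\mathcal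 L)(-\mathcal L\mathcal P_{E_F})Y_{E_F}\rangle\rangle,\quad \overline\sigma^{\mathrm{in}}_{E_F}(\nu)=\tfrac1\nu\Sigma_{E_F}([0,\nu])\ (\nu>0),$$ where $\chi_B(\mathcal L)(-\mathcal L)$ is the Borel function $\lambda\mapsto-\lambda\chi_B(\lambda)$ of $\mathcal L$. Given $\nu>0$, let $$I_-=]E_F-\nu,E_F],\quad I_+=]E_F,E_F+\nu],\quad J_-=]E_F-\tfrac\nu2,E_F-\tfrac\nu4],\quad J_+=]E_F+\tfrac\nu4,E_F+\tfrac\nu2].$$ Then $$\tfrac\pi2\,\Psi_{E_F}(J_+\times J_-)\;\le\;\overline\sigma^{\mathrm{in}}_{E_F}(\nu)\;\le\;\pi\,\Psi_{E_F}(I_+\times I_-).$$ -/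

import Mathlib

open MeasureTheory Topology
open scoped InnerProductSpace ENNReal

namespace ACConductivity

noncomputable section

/-! ### Projection-valued measures and the Borel functional calculus -/

/-- A projection-valued measure on `S` with values in the orthogonal projections of `K`
(the values on non-measurable sets are irrelevant). -/
structure PVM (S : Type*) [MeasurableSpace S] (K : Type*) [NormedAddCommGroup K]
    [InnerProductSpace ℂ K] where
  proj : Set S → K →L[ℂ] K
  symm : ∀ B, MeasurableSet B → ∀ x y, ⟪proj B x, y⟫_ℂ = ⟪x, proj B y⟫_ℂ
  univ : proj Set.univ = 1
  inter : ∀ B C, MeasurableSet B → MeasurableSet C → proj (B ∩ C) = proj B * proj C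
  iUnion : ∀ B : ℕ → Set S, (∀ n, MeasurableSet (B n)) →
    Pairwise (Function.onFun Disjoint B) →
    ∀ x y, HasSum (fun n => ⟪x, proj (B n) y⟫_ℂ) ⟪x, proj (⋃ n, B n) y⟫_ℂ

namespace PVM

variable {S : Type*} [MeasurableSpace S] {K : Type*} [NormedAddCommGroup K]
  [InnerProductSpace ℂ K]

lemma re_inner_eq (E : PVM S K) {B : Set S} (hB : MeasurableSet B) (x : K) :
    (⟪x, E.proj B x⟫_ℂ).re = ‖E.proj B x‖ ^ 2 := by
  have h : E.proj B x = E.proj B (E.proj B x) := by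
    conv_lhs => rw [← Set.inter_self B, E.inter B B hB hB]
    rfl
  rw [h, ← E.symm B hB, ← h]
  exact inner_self_eq_norm_sq (𝕜 := ℂ) (E.proj B x)

lemma inner_empty (E : PVM S K) (x : K) : ⟪x, E.proj ∅ x⟫_ℂ = 0 := by
  have h := E.iUnion (fun _ => ∅) (fun _ => MeasurableSet.empty)
    (fun i j _ => by simp [Function.onFun]) x x
  have h' := h.summable.tendsto_atTop_zero
  exact tendsto_nhds_unique tendsto_const_nhds h'

/-- The spectral measure `B ↦ ⟨x, E(B) x⟩` of the vector `x`. -/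
def measure (E : PVM S K) (x : K) : Measure S :=
  Measure.ofMeasurable (fun B _ => ENNReal.ofReal (⟪x, E.proj B x⟫_ℂ).re)
    (by simp [inner_empty])
    (by
      intro f hf hd
      have h := Complex.hasSum_re (E.iUnion f hf hd x x)
      rw [← h.tsum_eq, ENNReal.ofReal_tsum_of_nonneg _ h.summable]
      intro n
      rw [E.re_inner_eq (hf n)]
      positivity)

open scoped Classical in
/-- The projection-valued unit mass at `s` (for `S = ℝ`, the spectral measure of `s • 1`). -/
def dirac (s : S) : PVM S K where
  proj B := if s ∈ B then 1 else 0
  symm B _ x y := by split_ifs <;> simp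
  univ := by simp
  inter B C _ _ := by
    by_cases hB : s ∈ B <;> by_cases hC : s ∈ C <;> simp [hB, hC]
  iUnion B _ hd x y := by
    by_cases h : ∃ n, s ∈ B n
    · obtain ⟨n, hn⟩ := h
      have hU : s ∈ ⋃ n, B n := Set.mem_iUnion.2 ⟨n, hn⟩
      have := hasSum_ite_eq n (⟪x, y⟫_ℂ)
      convert this using 1
      · funext m
        by_cases hm : m = n
        · subst hm; simp [hn]
        · have : s ∉ B m := fun h' => Set.disjoint_left.1 (hd hm) h' hn
          simp [this, hm]
      · rw [if_pos hU]; rfl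
    · have hU : s ∉ ⋃ n, B n := by simpa using h
      have h' : ∀ n, s ∉ B n := by simpa using h
      simp [hU, h', hasSum_zero]

open scoped Classical in
/-- `∫ f dE` for a bounded Borel function `f`: the bounded operator `T` that is determined by
`⟨x, T x⟩ = ∫ f d⟨x, E x⟩` for all `x`. -/
def boundedFn (E : PVM S K) (f : S → ℂ) : K →L[ℂ] K :=
  if h : ∃ T : K →L[ℂ] K, ∀ x, ⟪x, T x⟫_ℂ = ∫ s, f s ∂E.measure x then h.choose else 0

open scoped Classical in
/-- `(∫ f dE) x` for a Borel function `f` and a vector `x` in the domain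
`{x | ∫ |f|² d⟨x, E x⟩ < ∞}`: the limit of the truncated operators applied to `x`. -/
def apply (E : PVM S K) (f : S → ℂ) (x : K) : K :=
  if h : ∃ y, Filter.Tendsto
    (fun n : ℕ => E.boundedFn (fun s => if ‖f s‖ ≤ n then f s else 0) x) Filter.atTop (𝓝 y)
  then h.choose else 0

end PVM

/-- `E` is the spectral measure of the self-adjoint operator `T`, that is `T = ∫ l dE(l)`,
with equality of the domains. -/
def IsSpectralMeasure {K : Type*} [NormedAddCommGroup K] [InnerProductSpace ℂ K]
    (T : K →ₗ.[ℂ] K) (E : PVM ℝ K) : Prop :=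
  (∀ x, x ∈ T.domain ↔ ∫⁻ l, ENNReal.ofReal (l ^ 2) ∂E.measure x < ∞) ∧
    ∀ x : T.domain, ⟪(x : K), T x⟫_ℂ = ∫ l, (l : ℂ) ∂E.measure (x : K)

open scoped Classical in
/-- The spectral measure of a self-adjoint operator `T`; by the spectral theorem it exists.
(An operator that is not self-adjoint gets the unit mass at `0`.) -/
def spectralMeasure {K : Type*} [NormedAddCommGroup K] [InnerProductSpace ℂ K]
    (T : K →ₗ.[ℂ] K) : PVM ℝ K :=
  if h : ∃ E, IsSpectralMeasure T E then h.choose else PVM.dirac 0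

/-! ### Position spaces and one-particle Hilbert spaces -/

/-- The data common to the position spaces `ℝ^d` and `ℤ^d`. Only the two instances below are
used. -/
class PosSpace (d : outParam ℕ) (X : Type) [TopologicalSpace X] [MeasurableSpace X] where
  vol : Measure X
  sigmaFinite_vol : SigmaFinite vol
  /-- the unit cube centred at a lattice point -/
  cell : (Fin d → ℤ) → Set X
  measurableSet_cell : ∀ a, MeasurableSet (cell a)
  iUnion_cell : ⋃ a, cell a = Set.univ
  cell_subset : ∀ a, ∃ K : Set X, IsCompact K ∧ cell a ⊆ K
  coord : Fin d → X → ℝ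
  continuous_coord : ∀ j, Continuous (coord j)

attribute [instance] PosSpace.sigmaFinite_vol

/-- The lattice `ℤ^d` with counting measure; the cells are the points. -/
instance latticePosSpace (d : ℕ) : PosSpace d (Fin d → ℤ) where
  vol := Measure.count
  sigmaFinite_vol := inferInstance
  cell a := {a}
  measurableSet_cell a := measurableSet_singleton a
  iUnion_cell := Set.iUnion_of_singleton _
  cell_subset a := ⟨{a}, isCompact_singleton, le_rfl⟩
  coord j x := x j
  continuous_coord _ := continuous_of_discreteTopology

/-- The continuum `ℝ^d` with Lebesgue measure. -/
instance continuumPosSpace (d : ℕ) : PosSpace d (EuclideanSpace ℝ (Fin d)) where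
  vol := volume
  sigmaFinite_vol := inferInstance
  cell a := {x | ∀ j, (a j : ℝ) - 1 / 2 ≤ x j ∧ x j < a j + 1 / 2}
  measurableSet_cell a := by
    have : {x : EuclideanSpace ℝ (Fin d) | ∀ j, (a j : ℝ) - 1 / 2 ≤ x j ∧ x j < a j + 1 / 2}
        = ⋂ j, 
          {x : EuclideanSpace ℝ (Fin d) | (a j : ℝ) - 1 / 2 ≤ x j} ∩
          {x : EuclideanSpace ℝ (Fin d) | x j < (a j : ℝ) + 1 / 2} := by
      ext x; simp only [Set.mem_ofPred_eq, Set.mem_iInter, Set.mem_inter_iff]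
    rw [this]
    refine MeasurableSet.iInter fun j => ?_
    exact (measurableSet_le (by fun_prop) (by fun_prop)).inter
      (measurableSet_lt (by fun_prop) (by fun_prop))
  iUnion_cell := by
    refine Set.eq_univ_of_forall fun x => Set.mem_iUnion.2 ⟨fun j => ⌊x j + 1 / 2⌋, fun j => ?_⟩
    have h1 := Int.floor_le (x j + 1 / 2)
    have h2 := Int.lt_floor_add_one (x j + 1 / 2)
    constructor <;> linarith
  cell_subset a := by
    have hb : Bornology.IsBounded
        {x : EuclideanSpace ℝ (Fin d) | ∀ j, (a j : ℝ) - 1 / 2 ≤ x j ∧ x j < a j + 1 / 2} := by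
      refine (isBounded_iff_forall_norm_le).2 ⟨∑ j, (|(a j : ℝ)| + 1), fun x hx => ?_⟩
      have h1 : ‖x‖ ≤ ∑ j, ‖x j‖ := by
        rw [EuclideanSpace.norm_eq]
        refine (Real.sqrt_le_left (Finset.sum_nonneg fun j _ => norm_nonneg _)).2 ?_
        exact Finset.sum_sq_le_sq_sum_of_nonneg fun j _ => norm_nonneg _
      refine h1.trans (Finset.sum_le_sum fun j _ => ?_)
      have := hx j
      rw [Real.norm_eq_abs, abs_le]
      constructor <;> cases abs_cases (a j : ℝ) <;> linarith
    exact ⟨_, hb.isCompact_closure, subset_closure⟩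
  coord j x := x j
  continuous_coord j := by fun_prop

section Hilbert

variable {d : ℕ} (X : Type) [TopologicalSpace X] [MeasurableSpace X] [PosSpace d X]

/-- The one-particle Hilbert space: `ℓ²(ℤ^d)` or `L²(ℝ^d)`. -/
abbrev Hilb : Type := Lp ℂ 2 (PosSpace.vol (X := X))

/-- The subspace of functions with compact support. -/
def Hc : Submodule ℂ (Hilb X) where
  carrier := {f | ∃ K : Set X, IsCompact K ∧ ∀ᵐ x ∂(PosSpace.vol (X := X)), x ∉ K → f x = 0}
  zero_mem' := ⟨∅, isCompact_empty, by
    filter_upwards [Lp.coeFn_zero ℂ 2 (PosSpace.vol (X := X))] with x hx _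
    simpa using hx⟩
  add_mem' := by
    rintro f g ⟨K, hK, hf⟩ ⟨L, hL, hg⟩
    refine ⟨K ∪ L, hK.union hL, ?_⟩
    filter_upwards [hf, hg, Lp.coeFn_add f g] with x h1 h2 h3 hx
    rw [Set.mem_union, not_or] at hx
    rw [h3, Pi.add_apply, h1 hx.1, h2 hx.2, add_zero]
  smul_mem' := by
    rintro c f ⟨K, hK, hf⟩
    refine ⟨K, hK, ?_⟩
    filter_upwards [hf, Lp.coeFn_smul c f] with x h1 h3 hx
    rw [h3, Pi.smul_apply, h1 hx, smul_zero]

variable {X}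

/-- Multiplication by the characteristic function of the cell at `a`, as a map into `Hc`. -/
def cut (a : Fin d → ℤ) : Hilb X →ₗ[ℂ] Hc X where
  toFun f := ⟨((Lp.memLp f).indicator (PosSpace.measurableSet_cell (X := X) a)).toLp, by
    obtain ⟨K, hK, hs⟩ := PosSpace.cell_subset (X := X) a
    refine ⟨K, hK, ?_⟩
    filter_upwards [((Lp.memLp f).indicator
      (PosSpace.measurableSet_cell (X := X) a)).coeFn_toLp] with x hx hxK
    rw [hx, Set.indicator_of_notMem fun h => hxK (hs h)]⟩
  map_add' f g := by
    refine Subtype.ext (Lp.ext ?_)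
    have hm := PosSpace.measurableSet_cell (X := X) a
    refine (((Lp.memLp (f + g)).indicator hm).coeFn_toLp).trans ?_
    filter_upwards [Lp.coeFn_add f g, ((Lp.memLp f).indicator hm).coeFn_toLp,
      ((Lp.memLp g).indicator hm).coeFn_toLp,
      Lp.coeFn_add ((Lp.memLp f).indicator hm).toLp ((Lp.memLp g).indicator hm).toLp]
      with x h1 h2 h3 h4
    refine Eq.trans ?_ h4.symm
    rw [Pi.add_apply, h2, h3]
    by_cases hx : x ∈ PosSpace.cell a
    · simp only [Set.indicator_of_mem hx]; exact h1
    · simp [hx]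
  map_smul' c f := by
    refine Subtype.ext (Lp.ext ?_)
    have hm := PosSpace.measurableSet_cell (X := X) a
    refine (((Lp.memLp (c • f)).indicator hm).coeFn_toLp).trans ?_
    filter_upwards [Lp.coeFn_smul c f, ((Lp.memLp f).indicator hm).coeFn_toLp,
      Lp.coeFn_smul c ((Lp.memLp f).indicator hm).toLp] with x h1 h2 h4
    refine Eq.trans ?_ h4.symm
    rw [Pi.smul_apply, h2]
    by_cases hx : x ∈ PosSpace.cell a
    · simp only [Set.indicator_of_mem hx]; exact h1
    · simp [hx]

variable (X) in
/-- An orthonormal basis of the one-particle Hilbert space (traces do not depend on it). -/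
def basisSet : Set (Hilb X) := (exists_hilbertBasis ℂ (Hilb X)).choose

variable (X) in
def basis : HilbertBasis (basisSet X) ℂ (Hilb X) :=
  (exists_hilbertBasis ℂ (Hilb X)).choose_spec.choose

/-- Multiplication by the real function `q`, on its maximal domain. -/
def mulGraph (q : X → ℝ) : Submodule ℂ (Hilb X × Hilb X) where
  carrier := {p | p.2 =ᵐ[PosSpace.vol] fun x => (q x : ℂ) * p.1 x}
  zero_mem' := by
    filter_upwards [Lp.coeFn_zero ℂ 2 (PosSpace.vol (X := X))] with x hx
    simp only [Prod.fst_zero, Prod.snd_zero, hx, Pi.zero_apply, mul_zero]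
  add_mem' := by
    rintro ⟨f, g⟩ ⟨f', g'⟩ h h'
    change _ =ᵐ[_] _ at h h' ⊢
    filter_upwards [h, h', Lp.coeFn_add f f', Lp.coeFn_add g g'] with x h1 h2 h3 h4
    simp only [Prod.fst_add, Prod.snd_add, h3, h4, Pi.add_apply, h1, h2, mul_add]
  smul_mem' := by
    rintro c ⟨f, g⟩ h
    change _ =ᵐ[_] _ at h ⊢
    filter_upwards [h, Lp.coeFn_smul c f, Lp.coeFn_smul c g] with x h1 h3 h4
    simp only [Prod.smul_fst, Prod.smul_snd, h3, h4, Pi.smul_apply, h1, smul_eq_mul]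
    ring

def mulOp (q : X → ℝ) : Hilb X →ₗ.[ℂ] Hilb X := (mulGraph q).toLinearPMap

lemma Hc_le_mulOp_domain [BorelSpace X] {q : X → ℝ} (hq : Continuous q) :
    Hc X ≤ (mulOp q).domain := by
  rintro f ⟨K, hK, hf⟩
  obtain ⟨C, hC⟩ := hK.exists_bound_of_continuousOn hq.continuousOn
  have hm : MemLp (fun x => (q x : ℂ) * f x) 2 (PosSpace.vol (X := X)) := by
    refine (Lp.memLp f).of_le_mul (c := C) ?_ ?_
    · exact (Complex.measurable_ofReal.comp hq.measurable).aestronglyMeasurable.mul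
        (Lp.aestronglyMeasurable f)
    · filter_upwards [hf] with x hx
      by_cases h : x ∈ K
      · rw [norm_mul, Complex.norm_real]
        exact mul_le_mul_of_nonneg_right (hC x h) (norm_nonneg _)
      · simp [hx h]
  exact ⟨(f, hm.toLp), hm.coeFn_toLp, rfl⟩

/-- The operator `X₁` of multiplication by the first coordinate. -/
def positionOp [NeZero d] : Hilb X →ₗ.[ℂ] Hilb X := mulOp (PosSpace.coord (X := X) 0)

variable (X) in
/-- A unitary projective representation of `ℤ^d` on the one-particle Hilbert space with
`U(a) χ_b U(a)* = χ_{b+a}` for all `a`, `b`. -/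
structure TranslationRep where
  U : (Fin d → ℤ) → Hilb X ≃ₗᵢ[ℂ] Hilb X
  projective : ∀ a b, ∃ c : ℂ, ‖c‖ = 1 ∧ ∀ f, U (a + b) f = c • U a (U b f)
  map_cell : ∀ a b f, U a (cut b f : Hc X) = (cut (b + a) (U a f) : Hc X)

end Hilbert

/-! ### Measurable covariant operators -/

section Random

variable {d : ℕ} {X : Type} [TopologicalSpace X] [MeasurableSpace X] [PosSpace d X]
  {Ω : Type*} [MeasurableSpace Ω]

variable (Ω X) in
/-- Random operators from the compactly supported functions to the Hilbert space. -/
abbrev RandOp : Type _ := Ω → (Hc X →ₗ[ℂ] Hilb X)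

def IsMeasurable (P : Measure Ω) (A : RandOp X Ω) : Prop :=
  ∀ φ ψ : Hc X, AEMeasurable (fun ω => ⟪(φ : Hilb X), A ω ψ⟫_ℂ) P

/-- `U(a) A_ω U(a)* = A_{τ_a ω}` for all `a`, almost surely; `U(a)*` is applied to `ψ = U(a) φ`. -/
def IsCovariant [AddAction (Fin d → ℤ) Ω] (P : Measure Ω) (U : TranslationRep X)
    (A : RandOp X Ω) : Prop :=
  ∀ᵐ ω ∂P, ∀ (a : Fin d → ℤ) (φ ψ : Hc X), (ψ : Hilb X) = U.U a φ →
    A (a +ᵥ ω) ψ = U.U a (A ω φ)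

/-- `‖A_ω χ_a‖ < ∞` and `‖χ_a A_ω‖ < ∞` for all `a`, almost surely. -/
def IsLocallyBounded (P : Measure Ω) (A : RandOp X Ω) : Prop :=
  ∀ᵐ ω ∂P, ∀ a : Fin d → ℤ,
    (∃ C : ℝ, ∀ f : Hilb X, ‖A ω (cut a f)‖ ≤ C * ‖f‖) ∧
    (∃ C : ℝ, ∀ φ : Hc X, ‖cut a (A ω φ)‖ ≤ C * ‖φ‖)

/-- `𝔼 tr (χ₀ |A_ω|² χ₀)`. -/
def hsNormSq (P : Measure Ω) (A : RandOp X Ω) : ℝ≥0∞ :=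
  ∫⁻ ω, ∑' i, ‖A ω (cut 0 (basis X i))‖ₑ ^ 2 ∂P

/-- `𝔼 tr (χ₀ A_ω* B_ω χ₀)`. -/
def hsInner (P : Measure Ω) (A B : RandOp X Ω) : ℂ :=
  ∫ ω, ∑' i, ⟪A ω (cut 0 (basis X i)), B ω (cut 0 (basis X i))⟫_ℂ ∂P

lemma enorm_inner_le {E : Type*} [SeminormedAddCommGroup E] [InnerProductSpace ℂ E] (f g : E) :
    ‖⟪f, g⟫_ℂ‖ₑ ≤ ‖f‖ₑ ^ 2 + ‖g‖ₑ ^ 2 := by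
  rw [← ofReal_norm, ← ofReal_norm, ← ofReal_norm, ← ENNReal.ofReal_pow (norm_nonneg _),
    ← ENNReal.ofReal_pow (norm_nonneg _), ← ENNReal.ofReal_add (by positivity) (by positivity)]
  refine ENNReal.ofReal_le_ofReal ?_
  nlinarith [norm_inner_le_norm (𝕜 := ℂ) f g, sq_nonneg (‖f‖ - ‖g‖), norm_nonneg f, norm_nonneg g,
    sq_nonneg (‖f‖), sq_nonneg (‖g‖)]

lemma enorm_add_sq_le {E : Type*} [SeminormedAddCommGroup E] (f g : E) :
    ‖f + g‖ₑ ^ 2 ≤ 2 * ‖f‖ₑ ^ 2 + 2 * ‖g‖ₑ ^ 2 := by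
  rw [← ofReal_norm, ← ofReal_norm, ← ofReal_norm, ← ENNReal.ofReal_pow (norm_nonneg _),
    ← ENNReal.ofReal_pow (norm_nonneg _), ← ENNReal.ofReal_pow (norm_nonneg _),
    show (2 : ℝ≥0∞) = ENNReal.ofReal 2 by simp, ← ENNReal.ofReal_mul (by norm_num),
    ← ENNReal.ofReal_mul (by norm_num), ← ENNReal.ofReal_add (by positivity) (by positivity)]
  refine ENNReal.ofReal_le_ofReal ?_
  nlinarith [norm_add_le f g, norm_nonneg (f + g), sq_nonneg (‖f‖ - ‖g‖)]

variable (X) in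
lemma dense_Hc : Dense (Hc X : Set (Hilb X)) := by
  rw [Submodule.dense_iff_topologicalClosure_eq_top, Submodule.topologicalClosure_eq_top_iff,
    Submodule.eq_bot_iff]
  intro f hf
  refine Lp.ext ?_
  have key : ∀ a : Fin d → ℤ, ∀ᵐ x ∂(PosSpace.vol (X := X)), x ∈ PosSpace.cell a → f x = 0 := by
    intro a
    have hm := PosSpace.measurableSet_cell (X := X) a
    have h0 : ⟪((cut a f : Hc X) : Hilb X), f⟫_ℂ = 0 := hf _ (cut a f).2
    have hc : ((cut a f : Hc X) : Hilb X) =ᵐ[PosSpace.vol] (PosSpace.cell a).indicator f :=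
      ((Lp.memLp f).indicator hm).coeFn_toLp
    have h1 : ⟪((cut a f : Hc X) : Hilb X), f⟫_ℂ =
        ⟪((cut a f : Hc X) : Hilb X), (cut a f : Hc X)⟫_ℂ := by
      rw [L2.inner_def, L2.inner_def]
      refine integral_congr_ae ?_
      filter_upwards [hc] with x hx
      rw [hx]
      by_cases h : x ∈ PosSpace.cell a <;> simp [h]
    rw [h1, inner_self_eq_zero] at h0
    rw [h0] at hc
    filter_upwards [hc, Lp.coeFn_zero ℂ 2 (PosSpace.vol (X := X))] with x hx h0x hxa
    rw [h0x, Set.indicator_of_mem hxa] at hx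
    exact hx.symm
  filter_upwards [ae_all_iff.2 key, Lp.coeFn_zero ℂ 2 (PosSpace.vol (X := X))] with x hx h0x
  obtain ⟨a, ha⟩ := Set.mem_iUnion.1 ((PosSpace.iUnion_cell (X := X)).symm ▸ Set.mem_univ x)
  rw [h0x, hx a ha]; rfl

section Lemmas

variable [BorelSpace X] [SecondCountableTopology X]

variable (X) in
lemma countable_basisSet : Countable (basisSet X) := by
  have : Fact ((2 : ℝ≥0∞) ≠ ∞) := ⟨by simp⟩
  have ho := (basis X).orthonormal
  have hd : Pairwise (Function.onFun Disjoint fun i => Metric.ball (basis X i) (1 / 2)) := by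
    intro i j hij
    refine Metric.ball_disjoint_ball ?_
    have h : ‖basis X i - basis X j‖ ^ 2 = 2 := by
      rw [@norm_sub_sq ℂ, ho.1 i, ho.1 j, ho.2 hij]; norm_num
    rw [dist_eq_norm]
    nlinarith [norm_nonneg (basis X i - basis X j)]
  exact hd.countable_of_isOpen_disjoint (fun _ => Metric.isOpen_ball)
    (fun i => ⟨basis X i, Metric.mem_ball_self (by norm_num)⟩)

lemma IsMeasurable.aestronglyMeasurable {P : Measure Ω} {A : RandOp X Ω} (hA : IsMeasurable P A)
    (ψ : Hc X) : AEStronglyMeasurable (fun ω => A ω ψ) P := by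
  have := countable_basisSet X
  have h1 : ∀ v : Hilb X, AEMeasurable (fun ω => ⟪v, A ω ψ⟫_ℂ) P := by
    intro v
    obtain ⟨u, hu, hlim⟩ := mem_closure_iff_seq_limit.1 (dense_Hc X v)
    refine aemeasurable_of_tendsto_metrizable_ae Filter.atTop
      (f := fun n ω => ⟪u n, A ω ψ⟫_ℂ) (fun n => hA ⟨u n, hu n⟩ ψ) ?_
    exact Filter.Eventually.of_forall fun ω => hlim.inner tendsto_const_nhds
  refine aestronglyMeasurable_of_tendsto_ae Filter.atTop
    (f := fun (s : Finset (basisSet X)) ω => ∑ i ∈ s, ⟪basis X i, A ω ψ⟫_ℂ • basis X i)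
    (fun s => ?_) ?_
  · exact Finset.aestronglyMeasurable_fun_sum s fun i _ =>
      (h1 (basis X i)).aestronglyMeasurable.smul_const _
  · refine Filter.Eventually.of_forall fun ω => ?_
    have := (basis X).hasSum_repr (A ω ψ)
    simp only [HilbertBasis.repr_apply_apply] at this
    exact this

lemma ae_summable {P : Measure Ω} {A : RandOp X Ω} (hA : IsMeasurable P A)
    (hA2 : hsNormSq P A < ∞) :
    ∀ᵐ ω ∂P, ∑' i, ‖A ω (cut 0 (basis X i))‖ₑ ^ 2 < ∞ := by
  have := countable_basisSet X
  refine ae_lt_top' ?_ hA2.ne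
  exact AEMeasurable.tsum fun i => ((hA.aestronglyMeasurable _).enorm.pow_const 2)

lemma ae_summable_inner {P : Measure Ω} {A B : RandOp X Ω} (hA : IsMeasurable P A)
    (hB : IsMeasurable P B) (hA2 : hsNormSq P A < ∞) (hB2 : hsNormSq P B < ∞) :
    ∀ᵐ ω ∂P, Summable fun i =>
      ⟪A ω (cut 0 (basis X i)), B ω (cut 0 (basis X i))⟫_ℂ := by
  filter_upwards [ae_summable hA hA2, ae_summable hB hB2] with ω h1 h2
  refine Summable.of_enorm (ne_of_lt ?_)
  refine (ENNReal.tsum_le_tsum fun i => enorm_inner_le _ _).trans_lt ?_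
  rw [ENNReal.tsum_add]
  exact ENNReal.add_lt_top.2 ⟨h1, h2⟩

lemma integrable_inner {P : Measure Ω} {A B : RandOp X Ω} (hA : IsMeasurable P A)
    (hB : IsMeasurable P B) (hA2 : hsNormSq P A < ∞) (hB2 : hsNormSq P B < ∞) :
    Integrable (fun ω => ∑' i, ⟪A ω (cut 0 (basis X i)), B ω (cut 0 (basis X i))⟫_ℂ) P := by
  have := countable_basisSet X
  refine ⟨(AEMeasurable.tsum fun i => ((hA.aestronglyMeasurable _).inner
    (hB.aestronglyMeasurable _)).aemeasurable).aestronglyMeasurable, ?_⟩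
  have hle : ∀ ω, ‖∑' i, ⟪A ω (cut 0 (basis X i)), B ω (cut 0 (basis X i))⟫_ℂ‖ₑ ≤
      (∑' i, ‖A ω (cut 0 (basis X i))‖ₑ ^ 2) + ∑' i, ‖B ω (cut 0 (basis X i))‖ₑ ^ 2 := by
    intro ω
    refine enorm_tsum_le_tsum_enorm.trans ?_
    rw [← ENNReal.tsum_add]
    exact ENNReal.tsum_le_tsum fun i => enorm_inner_le _ _
  refine (lintegral_mono hle).trans_lt ?_
  rw [lintegral_add_left' (AEMeasurable.tsum fun i =>
    ((hA.aestronglyMeasurable _).enorm.pow_const 2))]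
  exact ENNReal.add_lt_top.2 ⟨hA2, hB2⟩

end Lemmas

variable [BorelSpace X] [SecondCountableTopology X] [AddAction (Fin d → ℤ) Ω]

/-- The space `𝒦₂` of measurable covariant locally bounded operators with
`𝔼 tr (χ₀ |A_ω|² χ₀) < ∞`. -/
def K2 (P : Measure Ω) (U : TranslationRep X) : Submodule ℂ (RandOp X Ω) where
  carrier := {A | IsMeasurable P A ∧ IsCovariant P U A ∧ IsLocallyBounded P A ∧
    hsNormSq P A < ∞}
  zero_mem' := by
    refine ⟨fun φ ψ => ?_, Filter.Eventually.of_forall fun ω a φ ψ _ => ?_,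
      Filter.Eventually.of_forall fun ω a => ⟨⟨0, fun f => ?_⟩, ⟨0, fun f => ?_⟩⟩, ?_⟩
    · simp
    · simp
    · simp
    · simp
    · simp [hsNormSq]
  add_mem' := by
    rintro A B ⟨hA, cA, lA, nA⟩ ⟨hB, cB, lB, nB⟩
    refine ⟨fun φ ψ => ?_, ?_, ?_, ?_⟩
    · simp only [Pi.add_apply, LinearMap.add_apply, inner_add_right]
      exact (hA φ ψ).add (hB φ ψ)
    · filter_upwards [cA, cB] with ω h1 h2 a φ ψ h
      simp [h1 a φ ψ h, h2 a φ ψ h]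
    · filter_upwards [lA, lB] with ω h1 h2 a
      obtain ⟨⟨C, hC⟩, ⟨D, hD⟩⟩ := h1 a
      obtain ⟨⟨C', hC'⟩, ⟨D', hD'⟩⟩ := h2 a
      refine ⟨⟨C + C', fun f => ?_⟩, ⟨D + D', fun f => ?_⟩⟩
      · rw [Pi.add_apply, LinearMap.add_apply, add_mul]
        exact (norm_add_le _ _).trans (add_le_add (hC f) (hC' f))
      · rw [Pi.add_apply, LinearMap.add_apply, map_add, add_mul]
        exact (norm_add_le _ _).trans (add_le_add (hD f) (hD' f))
    · have := countable_basisSet X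
      have hle : ∀ ω, ∑' i, ‖(A + B) ω (cut 0 (basis X i))‖ₑ ^ 2 ≤
          2 * (∑' i, ‖A ω (cut 0 (basis X i))‖ₑ ^ 2) +
            2 * ∑' i, ‖B ω (cut 0 (basis X i))‖ₑ ^ 2 := by
        intro ω
        rw [← ENNReal.tsum_mul_left, ← ENNReal.tsum_mul_left, ← ENNReal.tsum_add]
        refine ENNReal.tsum_le_tsum fun i => ?_
        rw [Pi.add_apply, LinearMap.add_apply]
        exact enorm_add_sq_le _ _
      refine (lintegral_mono hle).trans_lt ?_
      have hm : ∀ {A : RandOp X Ω}, IsMeasurable P A →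
          AEMeasurable (fun ω => ∑' i, ‖A ω (cut 0 (basis X i))‖ₑ ^ 2) P := fun hA =>
        AEMeasurable.tsum fun i => ((hA.aestronglyMeasurable _).enorm.pow_const 2)
      rw [lintegral_add_left' ((hm hA).const_mul 2), lintegral_const_mul' _ _ (by simp),
        lintegral_const_mul' _ _ (by simp)]
      exact ENNReal.add_lt_top.2 ⟨ENNReal.mul_lt_top (by simp) nA,
        ENNReal.mul_lt_top (by simp) nB⟩
  smul_mem' := by
    rintro c A ⟨hA, cA, lA, nA⟩
    refine ⟨fun φ ψ => ?_, ?_, ?_, ?_⟩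
    · simp only [Pi.smul_apply, LinearMap.smul_apply, inner_smul_right]
      exact (hA φ ψ).const_mul c
    · filter_upwards [cA] with ω h1 a φ ψ h
      simp [h1 a φ ψ h]
    · filter_upwards [lA] with ω h1 a
      obtain ⟨⟨C, hC⟩, ⟨D, hD⟩⟩ := h1 a
      refine ⟨⟨‖c‖ * C, fun f => ?_⟩, ⟨‖c‖ * D, fun f => ?_⟩⟩
      · rw [Pi.smul_apply, LinearMap.smul_apply, norm_smul, mul_assoc]
        exact mul_le_mul_of_nonneg_left (hC f) (norm_nonneg c)
      · rw [Pi.smul_apply, LinearMap.smul_apply, map_smul, norm_smul, mul_assoc]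
        exact mul_le_mul_of_nonneg_left (hD f) (norm_nonneg c)
    · have : hsNormSq P (c • A) = ‖c‖ₑ ^ 2 * hsNormSq P A := by
        simp only [hsNormSq, Pi.smul_apply, LinearMap.smul_apply, enorm_smul, mul_pow,
          ENNReal.tsum_mul_left]
        rw [lintegral_const_mul' _ _ (by simp)]
      rw [this]
      exact ENNReal.mul_lt_top (by simp) nA

/-- The positive semidefinite form `⟨⟨A, B⟩⟩ = 𝔼 tr (χ₀ A_ω* B_ω χ₀)` on `𝒦₂`. -/
@[reducible]
def K2.core (P : Measure Ω) (U : TranslationRep X) : PreInnerProductSpace.Core ℂ (K2 P U) where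
  inner A B := hsInner P A.1 B.1
  conj_inner_symm A B := by
    simp only [hsInner, ← integral_conj, Complex.conj_tsum, inner_conj_symm]
  re_inner_nonneg A := by
    have h : hsInner P A.1 A.1 =
        ((∫ ω, ∑' i, ‖A.1 ω (cut 0 (basis X i))‖ ^ 2 ∂P : ℝ) : ℂ) := by
      simp only [hsInner, inner_self_eq_norm_sq_to_K]
      rw [← integral_complex_ofReal]
      push_cast
      rfl
    change 0 ≤ RCLike.re (hsInner P A.1 A.1)
    rw [h]
    exact integral_nonneg fun ω => tsum_nonneg fun i => by positivity
  add_left A B C := by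
    obtain ⟨hA, -, -, nA⟩ := A.2
    obtain ⟨hB, -, -, nB⟩ := B.2
    obtain ⟨hC, -, -, nC⟩ := C.2
    change hsInner P (A.1 + B.1) C.1 = hsInner P A.1 C.1 + hsInner P B.1 C.1
    simp only [hsInner]
    rw [← integral_add (integrable_inner hA hC nA nC) (integrable_inner hB hC nB nC)]
    refine integral_congr_ae ?_
    filter_upwards [ae_summable_inner hA hC nA nC, ae_summable_inner hB hC nB nC] with ω h1 h2
    rw [← h1.tsum_add h2]
    simp only [Pi.add_apply, LinearMap.add_apply, inner_add_left]
  smul_left A B c := by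
    change hsInner P (c • A.1) B.1 = _ * hsInner P A.1 B.1
    simp only [hsInner, Pi.smul_apply, LinearMap.smul_apply, inner_smul_left, tsum_mul_left,
      integral_const_mul]

instance (P : Measure Ω) (U : TranslationRep X) : SeminormedAddCommGroup (K2 P U) :=
  @InnerProductSpace.Core.toSeminormedAddCommGroup ℂ _ _ _ _ (K2.core P U)

instance (P : Measure Ω) (U : TranslationRep X) : InnerProductSpace ℂ (K2 P U) :=
  InnerProductSpace.ofCore (K2.core P U)

/-- The Hilbert space `𝒦₂`, with operators that agree almost surely identified. (The space is
already complete after this identification, which the completion carries out.) -/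
abbrev HK2 (P : Measure Ω) (U : TranslationRep X) : Type _ := UniformSpace.Completion (K2 P U)

/-! ### Multiplication of random operators -/

/-- `A_ω` as a densely defined operator with domain `Hc`. -/
def toPMap (T : Hc X →ₗ[ℂ] Hilb X) : Hilb X →ₗ.[ℂ] Hilb X := ⟨Hc X, T⟩

open scoped Classical in
/-- `A‡ = A*` restricted to `Hc`, defined if `Hc` lies in the domain of the adjoint `A*`. -/
def dag (T : Hc X →ₗ[ℂ] Hilb X) : Hc X →ₗ[ℂ] Hilb X :=
  if h : Hc X ≤ (toPMap T).adjoint.domain then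
    (toPMap T).adjoint.toFun ∘ₗ Submodule.inclusion h
  else 0

/-- `B ⊙_L A = B_ω A_ω`. -/
def leftMul (B : Ω → Hilb X →L[ℂ] Hilb X) (A : RandOp X Ω) : RandOp X Ω :=
  fun ω => (B ω).toLinearMap ∘ₗ A ω

open scoped Classical in
/-- `A ⊙_R B = (A_ω‡)* B_ω`. -/
def rightMul (A : RandOp X Ω) (B : Ω → Hilb X →L[ℂ] Hilb X) : RandOp X Ω := fun ω =>
  if h : ∀ φ : Hc X, ((B ω).toLinearMap ∘ₗ (Hc X).subtype) φ ∈
      (toPMap (dag (A ω))).adjoint.domain then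
    (toPMap (dag (A ω))).adjoint.toFun ∘ₗ
      ((B ω).toLinearMap ∘ₗ (Hc X).subtype).codRestrict _ h
  else 0

/-! ### Ergodic operators, the operators `ℋ_L`, `ℋ_R`, `ℒ` on `𝒦₂` -/

/-- A measurable covariant family of operators: its spectral projections are weakly measurable
and `U(a) H_ω U(a)* = H_{τ_a ω}` (as an equality of unbounded operators, stated for the graphs). -/
structure IsErgodicFamily (P : Measure Ω) (U : TranslationRep X)
    (H : Ω → Hilb X →ₗ.[ℂ] Hilb X) : Prop where
  measurable : ∀ B, MeasurableSet B → ∀ f g : Hilb X,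
    AEMeasurable (fun ω => ⟪f, (spectralMeasure (H ω)).proj B g⟫_ℂ) P
  covariant : ∀ᵐ ω ∂P, ∀ (a : Fin d → ℤ) (f g : Hilb X),
    (f, g) ∈ (H ω).graph ↔ (U.U a f, U.U a g) ∈ (H (a +ᵥ ω)).graph

/-- `e^{-itH_ω}`. -/
def evolution (H : Ω → Hilb X →ₗ.[ℂ] Hilb X) (t : ℝ) (ω : Ω) : Hilb X →L[ℂ] Hilb X :=
  (spectralMeasure (H ω)).boundedFn fun l => Complex.exp (-(Complex.I * t * l))

/-- `𝒰_L(t) A = e^{-itH} ⊙_L A`. -/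
def evolveL (H : Ω → Hilb X →ₗ.[ℂ] Hilb X) (t : ℝ) (A : RandOp X Ω) : RandOp X Ω :=
  leftMul (evolution H t) A

/-- `𝒰_R(t) A = A ⊙_R e^{-itH}`. -/
def evolveR (H : Ω → Hilb X →ₗ.[ℂ] Hilb X) (t : ℝ) (A : RandOp X Ω) : RandOp X Ω :=
  rightMul A (evolution H t)

/-- `𝒰(t) A = e^{-itH} ⊙_L A ⊙_R e^{itH}`. -/
def evolve (H : Ω → Hilb X →ₗ.[ℂ] Hilb X) (t : ℝ) (A : RandOp X Ω) : RandOp X Ω :=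
  leftMul (evolution H t) (rightMul A (evolution H (-t)))

/-- The commuting self-adjoint operators `ℋ_L`, `ℋ_R` and `ℒ` on `𝒦₂` are the generators of the
unitary groups `𝒰_L(t) = e^{-itℋ_L}`, `𝒰_R(t) = e^{-itℋ_R}`, `𝒰(t) = e^{-itℒ}`. Here `F` is the
joint spectral measure of `(ℋ_L, ℋ_R)`, so that `g(ℋ_L, ℋ_R) = ∫ g dF`, and `G` is the spectral
measure of `ℒ`. -/
structure IsLiouvilleResolution (P : Measure Ω) (U : TranslationRep X)
    (H : Ω → Hilb X →ₗ.[ℂ] Hilb X) (F : PVM (ℝ × ℝ) (HK2 P U)) (G : PVM ℝ (HK2 P U)) : Prop where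
  joint : ∀ (A : K2 P U) (s t : ℝ),
    hsInner P A.1 (evolveL H s (evolveR H t A.1)) =
      ∫ p : ℝ × ℝ, Complex.exp (-(Complex.I * (s * p.1 + t * p.2))) ∂F.measure (A : HK2 P U)
  liouvillian : ∀ (A : K2 P U) (t : ℝ),
    hsInner P A.1 (evolve H t A.1) =
      ∫ l : ℝ, Complex.exp (-(Complex.I * t * l)) ∂G.measure (A : HK2 P U)

open scoped Classical in
/-- The spectral measures of `(ℋ_L, ℋ_R)` and of `ℒ`, which exist by the spectral theorem and
are unique. (The unit masses at the origin only serve to make the definition total.) -/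
def liouvilleResolution (P : Measure Ω) (U : TranslationRep X)
    (H : Ω → Hilb X →ₗ.[ℂ] Hilb X) : PVM (ℝ × ℝ) (HK2 P U) × PVM ℝ (HK2 P U) :=
  if h : ∃ R : PVM (ℝ × ℝ) (HK2 P U) × PVM ℝ (HK2 P U), IsLiouvilleResolution P U H R.1 R.2
  then h.choose else (PVM.dirac (0, 0), PVM.dirac 0)

/-- The joint spectral measure `C ↦ χ_C(ℋ_L, ℋ_R)`. -/
def jointSpectral (P : Measure Ω) (U : TranslationRep X) (H : Ω → Hilb X →ₗ.[ℂ] Hilb X) :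
    PVM (ℝ × ℝ) (HK2 P U) := (liouvilleResolution P U H).1

/-- The spectral measure `B ↦ χ_B(ℒ)` of the Liouvillian. -/
def liouvillianSpectral (P : Measure Ω) (U : TranslationRep X)
    (H : Ω → Hilb X →ₗ.[ℂ] Hilb X) : PVM ℝ (HK2 P U) := (liouvilleResolution P U H).2

/-- `Υ_A(C) = ⟨⟨A, χ_C(ℋ_L, ℋ_R) A⟩⟩`. -/
def correlationMeasure (P : Measure Ω) (U : TranslationRep X) (H : Ω → Hilb X →ₗ.[ℂ] Hilb X)
    (A : HK2 P U) : Measure (ℝ × ℝ) := (jointSpectral P U H).measure A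

/-- `𝒫_E = χ_{]-∞,E]}(ℋ_L) - χ_{]-∞,E]}(ℋ_R)`. -/
def fermiSuper (P : Measure Ω) (U : TranslationRep X) (H : Ω → Hilb X →ₗ.[ℂ] Hilb X) (E : ℝ) :
    HK2 P U →L[ℂ] HK2 P U :=
  (jointSpectral P U H).proj (Set.Iic E ×ˢ Set.univ) -
    (jointSpectral P U H).proj (Set.univ ×ˢ Set.Iic E)

/-! ### The conductivity measure -/

/-- The Fermi projection `P_E = χ_{]-∞,E]}(H)`. -/
def fermiProj (H : Ω → Hilb X →ₗ.[ℂ] Hilb X) (E : ℝ) (ω : Ω) : Hilb X →L[ℂ] Hilb X :=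
  (spectralMeasure (H ω)).proj (Set.Iic E)

variable [NeZero d]

open scoped Classical in
/-- `Y_E = i [X₁, P_E]` on `Hc`, defined for those `ω` for which `P_E` maps `Hc` into the domain
of `X₁`. -/
def fermiCommutator (H : Ω → Hilb X →ₗ.[ℂ] Hilb X) (E : ℝ) : RandOp X Ω := fun ω =>
  if h : ∀ φ : Hc X, ((fermiProj H E ω).toLinearMap ∘ₗ (Hc X).subtype) φ ∈
      (positionOp (X := X)).domain then
    Complex.I • ((positionOp (X := X)).toFun ∘ₗ
        ((fermiProj H E ω).toLinearMap ∘ₗ (Hc X).subtype).codRestrict _ h -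
      (fermiProj H E ω).toLinearMap ∘ₗ (positionOp (X := X)).toFun ∘ₗ
        Submodule.inclusion (Hc_le_mulOp_domain (PosSpace.continuous_coord 0)))
  else 0

/-- The assumption `Y_E = i [X₁, P_E] ∈ 𝒦₂`. -/
structure FermiAssumption (P : Measure Ω) (U : TranslationRep X)
    (H : Ω → Hilb X →ₗ.[ℂ] Hilb X) (E : ℝ) : Prop where
  defined : ∀ᵐ ω ∂P, ∀ φ : Hc X, fermiProj H E ω φ ∈ (positionOp (X := X)).domain
  mem : fermiCommutator H E ∈ K2 P U

variable {P : Measure Ω} {U : TranslationRep X} {H : Ω → Hilb X →ₗ.[ℂ] Hilb X} {E : ℝ}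

/-- `Y_E` as an element of the Hilbert space `𝒦₂`. -/
def FermiAssumption.Y (h : FermiAssumption P U H E) : HK2 P U :=
  ((⟨fermiCommutator H E, h.mem⟩ : K2 P U) : HK2 P U)

/-- The measure `Ψ_E = Υ_{Y_E}`. -/
def FermiAssumption.Psi (h : FermiAssumption P U H E) : Measure (ℝ × ℝ) :=
  correlationMeasure P U H h.Y

open scoped Classical in
/-- The conductivity measure `Σ_E(B) = π ⟨⟨Y_E, χ_B(ℒ) (-ℒ 𝒫_E) Y_E⟩⟩`; here `χ_B(ℒ) (-ℒ)` is
the Borel function `l ↦ -l χ_B(l)` of `ℒ`. -/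
def FermiAssumption.conductivityMeasure (h : FermiAssumption P U H E) (B : Set ℝ) : ℝ :=
  Real.pi * (⟪h.Y, (liouvillianSpectral P U H).apply (fun l => if l ∈ B then (-l : ℂ) else 0)
    (fermiSuper P U H E h.Y)⟫_ℂ).re

/-- The average in phase conductivity `(1/ν) Σ_E([0, ν])`. -/
def FermiAssumption.avgConductivity (h : FermiAssumption P U H E) (ν : ℝ) : ℝ :=
  1 / ν * h.conductivityMeasure (Set.Icc 0 ν)

end Random

/-! ### Magnetic Schrödinger operators on the lattice -/

section Lattice

variable {d : ℕ}

/-- `(-Δ(θ) f)(x) = ∑_{|y - x| = 1} e^{-iθ(x,y)} f(y)`; the neighbours of `x` are `x ± e_j`. -/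
def hopping (θ : (Fin d → ℤ) → (Fin d → ℤ) → ℝ) (f : (Fin d → ℤ) → ℂ) (x : Fin d → ℤ) : ℂ :=
  ∑ j : Fin d,
    (Complex.exp (-(Complex.I * θ x (x + Pi.single j 1))) * f (x + Pi.single j 1) +
      Complex.exp (-(Complex.I * θ x (x - Pi.single j 1))) * f (x - Pi.single j 1))

/-- The graph of `-Δ(θ) + V` on the functions with compact support. -/
def latticeGraph (θ : (Fin d → ℤ) → (Fin d → ℤ) → ℝ) (V : (Fin d → ℤ) → ℝ) :
    Submodule ℂ (Hilb (Fin d → ℤ) × Hilb (Fin d → ℤ)) where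
  carrier := {p | p.1 ∈ Hc (Fin d → ℤ) ∧ ∀ x, p.2 x = hopping θ p.1 x + V x * p.1 x}
  zero_mem' := by
    have h0 : ∀ x, (0 : Hilb (Fin d → ℤ)) x = 0 := Measure.ae_count_iff.1 (Lp.coeFn_zero _ _ _)
    exact ⟨zero_mem _, fun x => by
      simp only [hopping, Prod.fst_zero, Prod.snd_zero, h0, mul_zero, add_zero,
        Finset.sum_const_zero]⟩
  add_mem' := by
    rintro ⟨f, g⟩ ⟨f', g'⟩ ⟨hf, h⟩ ⟨hf', h'⟩
    have h1 : ∀ (u v : Hilb (Fin d → ℤ)) x, (u + v) x = u x + v x := fun u v =>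
      Measure.ae_count_iff.1 (Lp.coeFn_add u v)
    refine ⟨add_mem hf hf', fun x => ?_⟩
    simp only [Prod.fst_add, Prod.snd_add, h1, hopping, h x, h' x, mul_add, Finset.sum_add_distrib]
    ring
  smul_mem' := by
    rintro c ⟨f, g⟩ ⟨hf, h⟩
    have h1 : ∀ (u : Hilb (Fin d → ℤ)) x, (c • u) x = c * u x := fun u =>
      Measure.ae_count_iff.1 (Lp.coeFn_smul c u)
    refine ⟨Submodule.smul_mem _ _ hf, fun x => ?_⟩
    simp only [Prod.smul_fst, Prod.smul_snd, h1, hopping, h x, mul_add, Finset.mul_sum,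
      Finset.sum_add_distrib, mul_left_comm c]

/-- The random potentials of a magnetic Schrödinger operator on `ℓ²(ℤ^d)`. -/
structure LatticeModel (d : ℕ) {Ω : Type*} [MeasurableSpace Ω] (P : Measure Ω) where
  θ : Ω → (Fin d → ℤ) → (Fin d → ℤ) → ℝ
  V : Ω → (Fin d → ℤ) → ℝ
  antisymm : ∀ ω x y, θ ω x y = -θ ω y x
  measurable_θ : ∀ x y, Measurable fun ω => θ ω x y
  measurable_V : ∀ x, Measurable fun ω => V ω x
  bddBelow : ∀ᵐ ω ∂P, BddBelow (Set.range (V ω))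

/-- `H_ω = -Δ(θ_ω) + V_ω`, the closure of the operator defined on the functions with compact
support. -/
def LatticeModel.H {Ω : Type*} [MeasurableSpace Ω] {P : Measure Ω} (M : LatticeModel d P) (ω : Ω) :
    Hilb (Fin d → ℤ) →ₗ.[ℂ] Hilb (Fin d → ℤ) :=
  (latticeGraph (M.θ ω) (M.V ω)).toLinearPMap.closure

end Lattice

/-! ### Magnetic Schrödinger operators on the continuum -/

section Continuum

variable {d : ℕ}

/-- The partial derivative `∂_j φ`. -/
def partialDeriv {F : Type*} [NormedAddCommGroup F] [NormedSpace ℝ F] (j : Fin d)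
    (φ : EuclideanSpace ℝ (Fin d) → F) (x : EuclideanSpace ℝ (Fin d)) : F :=
  fderiv ℝ φ x (EuclideanSpace.single j 1)

/-- `D` is the weak divergence of the vector field `A`. -/
def IsWeakDiv (A : EuclideanSpace ℝ (Fin d) → EuclideanSpace ℝ (Fin d))
    (D : EuclideanSpace ℝ (Fin d) → ℝ) : Prop :=
  ∀ φ : EuclideanSpace ℝ (Fin d) → ℝ, ContDiff ℝ (⊤ : ℕ∞) φ → HasCompactSupport φ →
    ∫ x, D x * φ x = -∫ x, ∑ j, A x j * partialDeriv j φ x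

/-- `(-i∇ - A)² φ + V φ = -Δφ + 2i A·∇φ + i (div A) φ + |A|² φ + V φ`, where `D = div A`. -/
def schrodinger (A : EuclideanSpace ℝ (Fin d) → EuclideanSpace ℝ (Fin d))
    (D V : EuclideanSpace ℝ (Fin d) → ℝ) (φ : EuclideanSpace ℝ (Fin d) → ℂ)
    (x : EuclideanSpace ℝ (Fin d)) : ℂ :=
  -(∑ j, partialDeriv j (partialDeriv j φ) x) +
    2 * Complex.I * (∑ j, (A x j : ℂ) * partialDeriv j φ x) +
    (Complex.I * D x + (‖A x‖ ^ 2 : ℝ) + V x) * φ x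

lemma partialDeriv_add {φ ψ : EuclideanSpace ℝ (Fin d) → ℂ} (hφ : Differentiable ℝ φ)
    (hψ : Differentiable ℝ ψ) (j : Fin d) :
    partialDeriv j (φ + ψ) = partialDeriv j φ + partialDeriv j ψ := by
  funext x
  simp [partialDeriv, fderiv_add (hφ x) (hψ x)]

lemma partialDeriv_smul {φ : EuclideanSpace ℝ (Fin d) → ℂ} (hφ : Differentiable ℝ φ)
    (c : ℂ) (j : Fin d) :
    partialDeriv j (c • φ) = c • partialDeriv j φ := by
  funext x
  simp [partialDeriv, fderiv_const_smul (hφ x) c]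

lemma differentiable_partialDeriv {φ : EuclideanSpace ℝ (Fin d) → ℂ}
    (hφ : ContDiff ℝ (⊤ : ℕ∞) φ) (j : Fin d) : Differentiable ℝ (partialDeriv j φ) := by
  have h : ContDiff ℝ 1 (fderiv ℝ φ) := hφ.fderiv_right (by norm_cast)
  exact (h.differentiable (by simp)).clm_apply (differentiable_const _)

/-- The graph of `(-i∇ - A)² + V` on the smooth functions with compact support. -/
def continuumGraph (A : EuclideanSpace ℝ (Fin d) → EuclideanSpace ℝ (Fin d))
    (D V : EuclideanSpace ℝ (Fin d) → ℝ) :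
    Submodule ℂ (Hilb (EuclideanSpace ℝ (Fin d)) × Hilb (EuclideanSpace ℝ (Fin d))) where
  carrier := {p | ∃ φ : EuclideanSpace ℝ (Fin d) → ℂ, ContDiff ℝ (⊤ : ℕ∞) φ ∧
    HasCompactSupport φ ∧ p.1 =ᵐ[volume] φ ∧ p.2 =ᵐ[volume] schrodinger A D V φ}
  zero_mem' := by
    refine ⟨0, contDiff_const, HasCompactSupport.zero, Lp.coeFn_zero _ _ _, ?_⟩
    refine (Lp.coeFn_zero _ _ _).trans (Filter.Eventually.of_forall fun x => ?_)
    have h0 : ∀ j : Fin d, partialDeriv j (0 : EuclideanSpace ℝ (Fin d) → ℂ) = 0 := by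
      intro j; funext x; simp [partialDeriv]
    simp [schrodinger, h0]
  add_mem' := by
    rintro ⟨f, g⟩ ⟨f', g'⟩ ⟨φ, hφ, cφ, h1, h2⟩ ⟨ψ, hψ, cψ, h3, h4⟩
    refine ⟨φ + ψ, hφ.add hψ, cφ.add cψ, (Lp.coeFn_add f f').trans (h1.add h3),
      (Lp.coeFn_add g g').trans ((h2.add h4).trans (Filter.Eventually.of_forall fun x => ?_))⟩
    have d1 := hφ.differentiable (by simp)
    have d2 := hψ.differentiable (by simp)
    simp only [schrodinger, partialDeriv_add d1 d2, Pi.add_apply, mul_add, Finset.sum_add_distrib,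
      partialDeriv_add (differentiable_partialDeriv hφ _) (differentiable_partialDeriv hψ _)]
    ring
  smul_mem' := by
    rintro c ⟨f, g⟩ ⟨φ, hφ, cφ, h1, h2⟩
    refine ⟨c • φ, hφ.const_smul c, cφ.smul_left (f := fun _ => c),
      (Lp.coeFn_smul c f).trans (h1.const_smul c),
      (Lp.coeFn_smul c g).trans ((h2.const_smul c).trans
        (Filter.Eventually.of_forall fun x => ?_))⟩
    have d1 := hφ.differentiable (by simp)
    simp only [schrodinger, partialDeriv_smul d1, Pi.smul_apply, smul_eq_mul, mul_left_comm _ c,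
      partialDeriv_smul (differentiable_partialDeriv hφ _), ← Finset.mul_sum]
    ring

/-- The random potentials of a magnetic Schrödinger operator on `L²(ℝ^d)`: the operator is defined
on the smooth functions with compact support (`A ∈ L⁴_loc`, `div A ∈ L²_loc`, `V ∈ L²_loc`),
and almost surely it is essentially self-adjoint there and bounded from below, uniformly in
`ω`. -/
structure ContinuumModel (d : ℕ) {Ω : Type*} [MeasurableSpace Ω] (P : Measure Ω) where
  A : Ω → EuclideanSpace ℝ (Fin d) → EuclideanSpace ℝ (Fin d)
  divA : Ω → EuclideanSpace ℝ (Fin d) → ℝ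
  V : Ω → EuclideanSpace ℝ (Fin d) → ℝ
  measurable_A : Measurable (Function.uncurry A)
  measurable_divA : Measurable (Function.uncurry divA)
  measurable_V : Measurable (Function.uncurry V)
  locInt_A : ∀ᵐ ω ∂P, LocallyIntegrable (fun x => ‖A ω x‖ ^ 4)
  locInt_divA : ∀ᵐ ω ∂P, LocallyIntegrable (fun x => divA ω x ^ 2)
  locInt_V : ∀ᵐ ω ∂P, LocallyIntegrable (fun x => V ω x ^ 2)
  isWeakDiv : ∀ᵐ ω ∂P, IsWeakDiv (A ω) (divA ω)
  essSelfAdjoint : ∀ᵐ ω ∂P,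
    IsSelfAdjoint (continuumGraph (A ω) (divA ω) (V ω)).toLinearPMap.closure
  boundedBelow : ∃ γ : ℝ, 0 ≤ γ ∧ ∀ᵐ ω ∂P,
    ∀ f : (continuumGraph (A ω) (divA ω) (V ω)).toLinearPMap.closure.domain,
      ‖(f : Hilb (EuclideanSpace ℝ (Fin d)))‖ ^ 2 ≤
        (⟪(f : Hilb (EuclideanSpace ℝ (Fin d))),
          (continuumGraph (A ω) (divA ω) (V ω)).toLinearPMap.closure f⟫_ℂ).re +
        γ * ‖(f : Hilb (EuclideanSpace ℝ (Fin d)))‖ ^ 2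

/-- `H_ω = (-i∇ - A_ω)² + V_ω`, the closure of the operator defined on the smooth functions with
compact support. -/
def ContinuumModel.H {Ω : Type*} [MeasurableSpace Ω] {P : Measure Ω} (M : ContinuumModel d P)
    (ω : Ω) :
    Hilb (EuclideanSpace ℝ (Fin d)) →ₗ.[ℂ] Hilb (EuclideanSpace ℝ (Fin d)) :=
  (continuumGraph (M.A ω) (M.divA ω) (M.V ω)).toLinearPMap.closure

end Continuum

end

end ACConductivity

/-! The inequality itself is a pointwise estimate under the joint spectral measure `F` of `ℋ_L` and
`ℋ_R`. Comparing characteristic functions shows that the spectral measure of `ℒ` is the image of `F`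
under `(l, r) ↦ l - r` (`IsLiouvilleResolution.proj_eq`). The conductivity of `[0, ν]` is therefore
`π` times the `Ψ`-integral of `-(l - r) (1_{l ≤ E} - 1_{r ≤ E})` over `0 ≤ l - r ≤ ν`. There the
bracket vanishes unless `r ≤ E < l`, where it equals `-1`, so the integrand is `transitionDensity`.
This density is at most `ν` and lives on `I₊ × I₋`, and it is at least `ν / 2` on `J₊ × J₋`.
Integration and division by `ν` give both bounds (`FermiAssumption.bounds`).

The bulk of the work is to show that `F` exists, since `liouvilleResolution` is a choice with a
placeholder value. Left multiplication by `f(H_ω)` is a functional calculus on `𝒦₂`, once it is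
known to preserve `𝒦₂`; this needs the covariance of `f(H_ω)`, hence uniqueness of the spectral
measure of an operator (`IsSpectralMeasure.proj_unique`), and the automatic boundedness of `χ_a A`
for a stationary family with finite norm, which is a mass transport argument (`tsum_lintegral_row`,
`mem_K2_of_rightBounded`). The same mass transport makes `A ↦ A‡` an antiunitary involution, and
conjugation by it turns left into right multiplication.

Both calculi extend to the completion as projection-valued measures (`K2.preL`, `K2.preR`). They
commute on operators that are almost surely bounded, where this is associativity of composition, and
such operators are dense (`K2.dense_bounded`): truncated diagonals of the block matrix `χ_a A χ_b`
are bounded and covariant, and finite sums of them approximate `A`. Finally, commuting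
projection-valued measures have a joint one (`PVM.exists_joint`): the scalar bimeasures `‖E(B) F(C)
x‖²` extend to measures by disintegration, and the projections are then recovered by a Dynkin class
argument. -/

namespace ACConductivity

noncomputable section

/-! ### Bounded Borel functional calculus of a projection-valued measure. -/

namespace PVM

section Calculus

variable {S : Type*} [MeasurableSpace S] {K : Type*} [NormedAddCommGroup K]
  [InnerProductSpace ℂ K]

lemma measure_apply (E : PVM S K) (x : K) {B : Set S} (hB : MeasurableSet B) :
    E.measure x B = ENNReal.ofReal (‖E.proj B x‖ ^ 2) := by
  rw [measure, Measure.ofMeasurable_apply _ hB, E.re_inner_eq hB]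

instance (E : PVM S K) (x : K) : IsFiniteMeasure (E.measure x) :=
  ⟨by rw [E.measure_apply x MeasurableSet.univ]; exact ENNReal.ofReal_lt_top⟩

lemma measure_real (E : PVM S K) (x : K) {B : Set S} (hB : MeasurableSet B) :
    (E.measure x).real B = ‖E.proj B x‖ ^ 2 := by
  rw [Measure.real, E.measure_apply x hB, ENNReal.toReal_ofReal (by positivity)]

lemma measure_real_univ (E : PVM S K) (x : K) : (E.measure x).real Set.univ = ‖x‖ ^ 2 := by
  rw [E.measure_real x MeasurableSet.univ, E.univ]; rfl

lemma proj_proj (E : PVM S K) {B : Set S} (hB : MeasurableSet B) (x : K) :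
    E.proj B (E.proj B x) = E.proj B x := by
  conv_rhs => rw [← Set.inter_self B, E.inter B B hB hB]
  rfl

lemma inner_proj_self (E : PVM S K) (x : K) {B : Set S} (hB : MeasurableSet B) :
    ⟪x, E.proj B x⟫_ℂ = ((E.measure x).real B : ℂ) := by
  rw [← E.proj_proj hB, ← E.symm B hB, E.measure_real x hB, inner_self_eq_norm_sq_to_K]
  norm_cast

lemma norm_proj_le (E : PVM S K) {B : Set S} (hB : MeasurableSet B) (x : K) :
    ‖E.proj B x‖ ≤ ‖x‖ := by
  have h : ‖E.proj B x‖ ^ 2 ≤ ‖x‖ ^ 2 := by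
    rw [← E.measure_real x hB, ← E.measure_real_univ x]
    exact measureReal_mono (Set.subset_univ _)
  exact (sq_le_sq₀ (norm_nonneg _) (norm_nonneg _)).1 h

/-- Bounded measurable complex functions. -/
structure BddMeas (f : S → ℂ) : Prop where
  meas : Measurable f
  bdd : ∃ C, ∀ s, ‖f s‖ ≤ C

lemma BddMeas.integrable {f : S → ℂ} (hf : BddMeas f) (μ : Measure S) [IsFiniteMeasure μ] :
    Integrable f μ := by
  obtain ⟨C, hC⟩ := hf.bdd
  exact Integrable.of_bound hf.meas.aestronglyMeasurable C (Filter.Eventually.of_forall hC)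

lemma BddMeas.add {f g : S → ℂ} (hf : BddMeas f) (hg : BddMeas g) :
    BddMeas (fun s => f s + g s) := by
  obtain ⟨C, hC⟩ := hf.bdd
  obtain ⟨D, hD⟩ := hg.bdd
  exact ⟨hf.meas.add hg.meas, C + D, fun s => norm_add_le_of_le (hC s) (hD s)⟩

lemma BddMeas.mul {f g : S → ℂ} (hf : BddMeas f) (hg : BddMeas g) :
    BddMeas (fun s => f s * g s) := by
  obtain ⟨C, hC⟩ := hf.bdd
  obtain ⟨D, hD⟩ := hg.bdd
  exact ⟨hf.meas.mul hg.meas, C * D, fun s => norm_mul_le_of_le (hC s) (hD s)⟩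

lemma BddMeas.const_mul {f : S → ℂ} (c : ℂ) (hf : BddMeas f) : BddMeas (fun s => c * f s) := by
  obtain ⟨C, hC⟩ := hf.bdd
  refine ⟨hf.meas.const_mul c, ‖c‖ * C, fun s => ?_⟩
  rw [norm_mul]
  gcongr
  exact hC s

lemma BddMeas.neg {f : S → ℂ} (hf : BddMeas f) : BddMeas (fun s => -f s) := by
  simpa using hf.const_mul (-1)

lemma BddMeas.sub {f g : S → ℂ} (hf : BddMeas f) (hg : BddMeas g) :
    BddMeas (fun s => f s - g s) := by
  simpa [sub_eq_add_neg] using hf.add hg.neg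

lemma BddMeas.conj {f : S → ℂ} (hf : BddMeas f) : BddMeas (fun s => starRingEnd ℂ (f s)) := by
  obtain ⟨C, hC⟩ := hf.bdd
  exact ⟨Complex.continuous_conj.measurable.comp hf.meas, C, fun s => by simpa using hC s⟩

lemma BddMeas.indicator {B : Set S} (hB : MeasurableSet B) :
    BddMeas (B.indicator (1 : S → ℂ)) := by
  refine ⟨measurable_one.indicator hB, 1, fun s => ?_⟩
  by_cases h : s ∈ B <;> simp [h]

lemma BddMeas.simple (g : SimpleFunc S ℂ) : BddMeas g := by
  refine ⟨g.measurable, ?_⟩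
  obtain ⟨C, hC⟩ := g.exists_forall_norm_le
  exact ⟨C, hC⟩

lemma BddMeas.comp {S' : Type*} [MeasurableSpace S'] {f : S → ℂ} (hf : BddMeas f) {q : S' → S}
    (hq : Measurable q) : BddMeas (fun s => f (q s)) := by
  obtain ⟨C, hC⟩ := hf.bdd
  exact ⟨hf.meas.comp hq, C, fun s => hC _⟩

/-- `T = ∫ f dE` in the sense of quadratic forms. -/
def IsIntegral (E : PVM S K) (f : S → ℂ) (T : K →L[ℂ] K) : Prop :=
  ∀ x, ⟪x, T x⟫_ℂ = ∫ s, f s ∂E.measure x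

/-- Polarization over `ℂ`: the quadratic form determines the operator. This is why `IsIntegral` can
be phrased with diagonal inner products only. -/
lemma ext_of_inner_self {T T' : K →L[ℂ] K} (h : ∀ x, ⟪x, T x⟫_ℂ = ⟪x, T' x⟫_ℂ) : T = T' := by
  have := (ext_inner_map (T : K →ₗ[ℂ] K) (T' : K →ₗ[ℂ] K)).1 fun x => by
    change ⟪T x, x⟫_ℂ = ⟪T' x, x⟫_ℂ
    rw [← inner_conj_symm, ← inner_conj_symm (T' x) x]
    exact congrArg _ (h x)
  ext x
  exact LinearMap.congr_fun this x

lemma IsIntegral.unique {E : PVM S K} {f : S → ℂ} {T T' : K →L[ℂ] K} (h : E.IsIntegral f T)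
    (h' : E.IsIntegral f T') : T = T' :=
  ext_of_inner_self fun x => (h x).trans (h' x).symm

/-- `boundedFn` is a choice; uniqueness lets every later computation exhibit some operator with the
right quadratic form instead of unfolding the choice. -/
lemma IsIntegral.boundedFn_eq {E : PVM S K} {f : S → ℂ} {T : K →L[ℂ] K} (h : E.IsIntegral f T) :
    E.boundedFn f = T := by
  have hex : ∃ T : K →L[ℂ] K, ∀ x, ⟪x, T x⟫_ℂ = ∫ s, f s ∂E.measure x := ⟨T, h⟩
  rw [boundedFn, dif_pos hex]
  exact IsIntegral.unique hex.choose_spec h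

lemma IsIntegral.add {E : PVM S K} {f g : S → ℂ} {T T' : K →L[ℂ] K} (hf : BddMeas f)
    (hg : BddMeas g) (h : E.IsIntegral f T) (h' : E.IsIntegral g T') :
    E.IsIntegral (fun s => f s + g s) (T + T') := fun x => by
  rw [add_apply, inner_add_right, h x, h' x,
    integral_add (hf.integrable _) (hg.integrable _)]

lemma IsIntegral.const_mul {E : PVM S K} {f : S → ℂ} {T : K →L[ℂ] K} (c : ℂ)
    (h : E.IsIntegral f T) : E.IsIntegral (fun s => c * f s) (c • T) := fun x => by
  rw [smul_apply, inner_smul_right, h x, integral_const_mul]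

lemma isIntegral_indicator (E : PVM S K) {B : Set S} (hB : MeasurableSet B) :
    E.IsIntegral (B.indicator 1) (E.proj B) := fun x => by
  rw [E.inner_proj_self x hB, ← integral_indicator_one hB, ← integral_complex_ofReal]
  congr 1 with s
  by_cases h : s ∈ B <;> simp [h]

lemma simple_piecewise_eq (c : ℂ) {B : Set S} (hB : MeasurableSet B) :
    ⇑(SimpleFunc.piecewise B hB (SimpleFunc.const S c) (SimpleFunc.const S 0)) =
      fun s => c * B.indicator (1 : S → ℂ) s := by
  funext s
  by_cases h : s ∈ B <;> simp [h]

/-- Simple functions have integrals, and these are multiplicative. -/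
lemma exists_isIntegral_simple (E : PVM S K) (g : SimpleFunc S ℂ) :
    ∃ T, E.IsIntegral g T := by
  induction g using SimpleFunc.induction with
  | const c hs =>
    rw [simple_piecewise_eq]
    exact ⟨_, (E.isIntegral_indicator hs).const_mul c⟩
  | add _ h1 h2 =>
    obtain ⟨T, hT⟩ := h1
    obtain ⟨T', hT'⟩ := h2
    exact ⟨_, hT.add (.simple _) (.simple _) hT'⟩

lemma isIntegral_simple (E : PVM S K) (g : SimpleFunc S ℂ) : E.IsIntegral g (E.boundedFn g) := by
  obtain ⟨T, hT⟩ := E.exists_isIntegral_simple g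
  rwa [hT.boundedFn_eq]

/-- Bilinearity reduces the claim to indicators, where it is the multiplicativity `E(B ∩ C) = E(B)
E(C)`. -/
lemma isIntegral_simple_mul (E : PVM S K) (f g : SimpleFunc S ℂ) :
    E.IsIntegral (fun s => f s * g s) (E.boundedFn f * E.boundedFn g) := by
  induction f using SimpleFunc.induction with
  | const c hs =>
    rw [simple_piecewise_eq, ((E.isIntegral_indicator hs).const_mul c).boundedFn_eq]
    induction g using SimpleFunc.induction with
    | const c' hs' =>
      rw [simple_piecewise_eq, ((E.isIntegral_indicator hs').const_mul c').boundedFn_eq,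
        smul_mul_smul_comm, ← E.inter _ _ hs hs']
      convert (E.isIntegral_indicator (hs.inter hs')).const_mul (c * c') using 2 with s
      rw [Set.inter_indicator_one]
      simp only [Pi.mul_apply]
      ring
    | @add f g _ h1 h2 =>
      have := ((E.isIntegral_simple f).add (.simple _) (.simple _)
        (E.isIntegral_simple g)).boundedFn_eq
      rw [SimpleFunc.coe_add]
      erw [this]
      rw [mul_add]
      convert h1.add (((BddMeas.indicator hs).const_mul c).mul (.simple _))
        (((BddMeas.indicator hs).const_mul c).mul (.simple _)) h2 using 2 with s
      simp only [Pi.add_apply]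
      ring
  | @add f f' _ h1 h2 =>
    have := ((E.isIntegral_simple f).add (.simple _) (.simple _)
      (E.isIntegral_simple f')).boundedFn_eq
    rw [SimpleFunc.coe_add]
    erw [this]
    rw [add_mul]
    convert h1.add ((BddMeas.simple _).mul (.simple _))
      ((BddMeas.simple _).mul (.simple _)) h2 using 2 with s
    simp only [Pi.add_apply]
    ring

lemma boundedFn_simple_sub (E : PVM S K) (f g : SimpleFunc S ℂ) :
    E.boundedFn f - E.boundedFn g = E.boundedFn (f - g : SimpleFunc S ℂ) := by
  refine IsIntegral.unique (E := E) (f := (f - g : SimpleFunc S ℂ)) ?_ (E.isIntegral_simple _)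
  have := (E.isIntegral_simple f).add (.simple _) ((BddMeas.simple _).const_mul _)
    ((E.isIntegral_simple g).const_mul (-1))
  convert this using 1
  · funext s; simp [sub_eq_add_neg]
  · simp [sub_eq_add_neg]

/-- The range of a bounded function is totally bounded in `ℂ`, so rounding to finitely many points
of a dense sequence is uniformly accurate. Uniform, not merely pointwise, approximation is what
yields convergence in operator norm later. -/
lemma BddMeas.exists_simple {f : S → ℂ} (hf : BddMeas f) {ε : ℝ} (hε : 0 < ε) :
    ∃ g : SimpleFunc S ℂ, ∀ s, ‖f s - g s‖ ≤ ε := by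
  obtain ⟨C, hC⟩ := hf.bdd
  obtain ⟨t, ht⟩ := (isCompact_closedBall (0 : ℂ) C).elim_finite_subcover
    (fun n : ℕ => Metric.ball (TopologicalSpace.denseSeq ℂ n) ε) (fun _ => Metric.isOpen_ball)
    fun z _ => by
      obtain ⟨n, hn⟩ := DenseRange.exists_dist_lt (TopologicalSpace.denseRange_denseSeq ℂ) z hε
      exact Set.mem_iUnion.2 ⟨n, hn⟩
  -- `nearestPt` compares the points up to a given index; `t.sup id` is the largest index used by
  -- the finite cover.
  refine ⟨(SimpleFunc.nearestPt (TopologicalSpace.denseSeq ℂ) (t.sup id)).comp f hf.meas,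
    fun s => ?_⟩
  obtain ⟨k, hk, hks⟩ := Set.mem_iUnion₂.1 (ht (mem_closedBall_zero_iff.2 (hC s)))
  have h1 := SimpleFunc.edist_nearestPt_le (TopologicalSpace.denseSeq ℂ) (f s)
    (Finset.le_sup (f := id) hk)
  rw [edist_dist, edist_dist, ENNReal.ofReal_le_ofReal_iff dist_nonneg] at h1
  rw [← dist_eq_norm, dist_comm]
  exact h1.trans ((dist_comm _ _).trans_lt hks).le

lemma IsIntegral.of_tendsto {E : PVM S K} {f : ℕ → S → ℂ} {g : S → ℂ} {T : ℕ → K →L[ℂ] K}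
    {T' : K →L[ℂ] K} (h : ∀ n, E.IsIntegral (f n) (T n)) (hf : ∀ n, Measurable (f n)) {C : ℝ}
    (hC : ∀ n s, ‖f n s‖ ≤ C) (hg : ∀ s, Filter.Tendsto (fun n => f n s) Filter.atTop (𝓝 (g s)))
    (hT : ∀ x, Filter.Tendsto (fun n => ⟪x, T n x⟫_ℂ) Filter.atTop (𝓝 ⟪x, T' x⟫_ℂ)) :
    E.IsIntegral g T' := fun x => by
  refine tendsto_nhds_unique (hT x) ?_
  simp only [h _ x]
  exact tendsto_integral_of_dominated_convergence (fun _ => C)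
    (fun n => (hf n).aestronglyMeasurable) (integrable_const C)
    (fun n => Filter.Eventually.of_forall (hC n)) (Filter.Eventually.of_forall hg)

lemma boundedFn_indicator (E : PVM S K) {B : Set S} (hB : MeasurableSet B) :
    E.boundedFn (B.indicator 1) = E.proj B :=
  (E.isIntegral_indicator hB).boundedFn_eq

/-- For a bounded function the truncations in `apply` are eventually the function itself, so the
limit is reached after finitely many steps. -/
lemma apply_eq_boundedFn (E : PVM S K) {f : S → ℂ} (hf : BddMeas f) (x : K) :
    E.apply f x = E.boundedFn f x := by
  obtain ⟨C, hC⟩ := hf.bdd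
  have h : Filter.Tendsto (fun n : ℕ => E.boundedFn (fun s => if ‖f s‖ ≤ n then f s else 0) x)
      Filter.atTop (𝓝 (E.boundedFn f x)) := by
    refine tendsto_const_nhds.congr' ?_
    filter_upwards [Filter.eventually_ge_atTop ⌈C⌉₊] with n hn
    have : (fun s => if ‖f s‖ ≤ n then f s else 0) = f := by
      funext s
      rw [if_pos ((hC s).trans ((Nat.le_ceil C).trans (by exact_mod_cast hn)))]
    rw [this]
  have hex : ∃ y, Filter.Tendsto
      (fun n : ℕ => E.boundedFn (fun s => if ‖f s‖ ≤ n then f s else 0) x)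
      Filter.atTop (𝓝 y) := ⟨_, h⟩
  rw [apply, dif_pos hex]
  exact tendsto_nhds_unique hex.choose_spec h

variable [CompleteSpace K]

lemma IsIntegral.adjoint {E : PVM S K} {f : S → ℂ} {T : K →L[ℂ] K} (h : E.IsIntegral f T) :
    E.IsIntegral (fun s => starRingEnd ℂ (f s)) (ContinuousLinearMap.adjoint T) := fun x => by
  rw [ContinuousLinearMap.adjoint_inner_right, ← inner_conj_symm, h x, integral_conj]

/-- By multiplicativity `‖g(E) x‖² = ⟪x, (ḡg)(E) x⟫ = ∫ |g|² dE_x`, and `E_x` has total mass `‖x‖²`.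
-/
lemma norm_boundedFn_simple_le (E : PVM S K) (g : SimpleFunc S ℂ) {C : ℝ} (hC0 : 0 ≤ C)
    (hC : ∀ s, ‖g s‖ ≤ C) : ‖E.boundedFn g‖ ≤ C := by
  refine ContinuousLinearMap.opNorm_le_bound _ hC0 fun x => ?_
  have h1 : ContinuousLinearMap.adjoint (E.boundedFn g) =
      E.boundedFn (g.map (starRingEnd ℂ)) :=
    (E.isIntegral_simple g).adjoint.boundedFn_eq.symm
  have h2 := E.isIntegral_simple_mul (g.map (starRingEnd ℂ)) g x
  rw [← h1, mul_apply_eq_comp, ContinuousLinearMap.adjoint_inner_right,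
    inner_self_eq_norm_sq_to_K] at h2
  have h3 : ‖E.boundedFn g x‖ ^ 2 ≤ C ^ 2 * ‖x‖ ^ 2 := by
    have : ‖((‖E.boundedFn g x‖ : ℂ)) ^ 2‖ ≤ C ^ 2 * (E.measure x).real Set.univ := by
      erw [h2]
      refine norm_integral_le_of_norm_le_const (Filter.Eventually.of_forall fun s => ?_)
      simp only [SimpleFunc.coe_map, Function.comp_apply, norm_mul, RCLike.norm_conj]
      nlinarith [hC s, norm_nonneg (g s)]
    rw [E.measure_real_univ] at this
    simpa using this
  rw [← mul_pow] at h3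
  exact (sq_le_sq₀ (norm_nonneg _) (by positivity)).1 h3

lemma exists_simple_seq {f : S → ℂ} (hf : BddMeas f) :
    ∃ (g : ℕ → SimpleFunc S ℂ) (C : ℝ), (∀ n s, ‖f s - g n s‖ ≤ 1 / ((n : ℝ) + 1)) ∧
      (∀ n s, ‖g n s‖ ≤ C) ∧
      ∀ s, Filter.Tendsto (fun n => g n s) Filter.atTop (𝓝 (f s)) := by
  choose g hg using fun n : ℕ => hf.exists_simple (ε := 1 / ((n : ℝ) + 1)) (by positivity)
  obtain ⟨C, hC⟩ := hf.bdd
  refine ⟨g, C + 1, hg, fun n s => ?_, fun s => ?_⟩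
  · have h1 : ‖g n s‖ ≤ ‖f s‖ + ‖f s - g n s‖ := by
      simpa using norm_sub_le (f s) (f s - g n s)
    have h2 : 1 / ((n : ℝ) + 1) ≤ 1 := by
      rw [div_le_one (by positivity)]
      linarith [n.cast_nonneg (α := ℝ)]
    linarith [hg n s, hC s]
  · rw [tendsto_iff_norm_sub_tendsto_zero]
    refine squeeze_zero (fun _ => norm_nonneg _) (fun n => ?_)
      tendsto_one_div_add_atTop_nhds_zero_nat
    rw [norm_sub_rev]
    exact hg n s

/-- Uniformly close simple functions have close integrals in operator norm, so the integrals form a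
Cauchy sequence. The approximating sequence is an argument because its operator convergence is
reused for products. -/
lemma exists_isIntegral (E : PVM S K) {f : S → ℂ} {g : ℕ → SimpleFunc S ℂ}
    {C : ℝ} (hg : ∀ n s, ‖f s - g n s‖ ≤ 1 / ((n : ℝ) + 1)) (hC : ∀ n s, ‖g n s‖ ≤ C)
    (hlim : ∀ s, Filter.Tendsto (fun n => g n s) Filter.atTop (𝓝 (f s))) :
    E.IsIntegral f (E.boundedFn f) ∧
      Filter.Tendsto (fun n => E.boundedFn (g n)) Filter.atTop (𝓝 (E.boundedFn f)) := by
  have hcau : CauchySeq fun n => E.boundedFn (g n) := by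
    refine cauchySeq_of_le_tendsto_0 (fun n : ℕ => 2 * (1 / ((n : ℝ) + 1))) (fun n m N hn hm => ?_)
      (by simpa using tendsto_one_div_add_atTop_nhds_zero_nat.const_mul (2 : ℝ))
    rw [dist_eq_norm, boundedFn_simple_sub]
    refine E.norm_boundedFn_simple_le _ (by positivity) fun s => ?_
    have h1 : ‖(g n - g m : SimpleFunc S ℂ) s‖ ≤ ‖f s - g m s‖ + ‖f s - g n s‖ := by
      have := norm_sub_le (f s - g m s) (f s - g n s)
      simpa using this
    have h2 : ∀ k, N ≤ k → 1 / ((k : ℝ) + 1) ≤ 1 / ((N : ℝ) + 1) := fun k hk => by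
      gcongr
    linarith [hg n s, hg m s, h2 n hn, h2 m hm]
  obtain ⟨T, hT⟩ := cauchySeq_tendsto_of_complete hcau
  have h : E.IsIntegral f T := IsIntegral.of_tendsto (fun n => E.isIntegral_simple (g n))
    (fun n => (g n).measurable) hC hlim fun x => by
      exact Filter.Tendsto.inner tendsto_const_nhds
        (((ContinuousLinearMap.apply ℂ K x).continuous.tendsto T).comp hT)
  rw [h.boundedFn_eq]
  exact ⟨h, hT⟩

lemma isIntegral_boundedFn (E : PVM S K) {f : S → ℂ} (hf : BddMeas f) :
    E.IsIntegral f (E.boundedFn f) := by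
  obtain ⟨g, C, hg, hC, hlim⟩ := exists_simple_seq hf
  exact (E.exists_isIntegral hg hC hlim).1

lemma boundedFn_add (E : PVM S K) {f g : S → ℂ} (hf : BddMeas f) (hg : BddMeas g) :
    E.boundedFn (fun s => f s + g s) = E.boundedFn f + E.boundedFn g :=
  ((E.isIntegral_boundedFn hf).add hf hg (E.isIntegral_boundedFn hg)).boundedFn_eq

lemma boundedFn_const_mul (E : PVM S K) {f : S → ℂ} (c : ℂ) (hf : BddMeas f) :
    E.boundedFn (fun s => c * f s) = c • E.boundedFn f :=
  ((E.isIntegral_boundedFn hf).const_mul c).boundedFn_eq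

lemma boundedFn_sub (E : PVM S K) {f g : S → ℂ} (hf : BddMeas f) (hg : BddMeas g) :
    E.boundedFn (fun s => f s - g s) = E.boundedFn f - E.boundedFn g := by
  have h := E.boundedFn_add hf (hg.const_mul (-1))
  rw [E.boundedFn_const_mul _ hg] at h
  simpa [sub_eq_add_neg] using h

lemma adjoint_boundedFn (E : PVM S K) {f : S → ℂ} (hf : BddMeas f) :
    ContinuousLinearMap.adjoint (E.boundedFn f) = E.boundedFn fun s => starRingEnd ℂ (f s) :=
  (E.isIntegral_boundedFn hf).adjoint.boundedFn_eq.symm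

lemma boundedFn_mul (E : PVM S K) {f g : S → ℂ} (hf : BddMeas f) (hg : BddMeas g) :
    E.boundedFn (fun s => f s * g s) = E.boundedFn f * E.boundedFn g := by
  obtain ⟨f', C, h1, h2, h3⟩ := exists_simple_seq hf
  obtain ⟨g', C', h1', h2', h3'⟩ := exists_simple_seq hg
  have h := (E.exists_isIntegral h1 h2 h3).2
  have h' := (E.exists_isIntegral h1' h2' h3').2
  refine IsIntegral.boundedFn_eq (IsIntegral.of_tendsto (C := C * C')
    (fun n => E.isIntegral_simple_mul (f' n) (g' n))
    (fun n => (f' n).measurable.mul (g' n).measurable)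
    (fun n s => norm_mul_le_of_le (h2 n s) (h2' n s)) (fun s => (h3 s).mul (h3' s)) fun x => ?_)
  exact Filter.Tendsto.inner tendsto_const_nhds
    (((ContinuousLinearMap.apply ℂ K x).continuous.tendsto _).comp (h.mul h'))

lemma norm_boundedFn_sq (E : PVM S K) {f : S → ℂ} (hf : BddMeas f) (x : K) :
    ‖E.boundedFn f x‖ ^ 2 = ∫ s, ‖f s‖ ^ 2 ∂E.measure x := by
  have h : E.boundedFn (fun s => starRingEnd ℂ (f s) * f s) =
      ContinuousLinearMap.adjoint (E.boundedFn f) * E.boundedFn f := by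
    rw [E.adjoint_boundedFn hf, E.boundedFn_mul hf.conj hf]
  have h1 := E.isIntegral_boundedFn (hf.conj.mul hf) x
  rw [h, mul_apply_eq_comp, ContinuousLinearMap.adjoint_inner_right,
    inner_self_eq_norm_sq_to_K] at h1
  have h2 : (∫ s, starRingEnd ℂ (f s) * f s ∂E.measure x) =
      ((∫ s, ‖f s‖ ^ 2 ∂E.measure x : ℝ) : ℂ) := by
    rw [← integral_complex_ofReal]
    congr 1 with s
    rw [← Complex.normSq_eq_conj_mul_self, Complex.normSq_eq_norm_sq]
  rw [h2] at h1
  apply Complex.ofReal_injective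
  push_cast
  exact h1

lemma norm_boundedFn_apply_le (E : PVM S K) {f : S → ℂ} (hf : BddMeas f) {C : ℝ} (hC0 : 0 ≤ C)
    (hC : ∀ s, ‖f s‖ ≤ C) (x : K) : ‖E.boundedFn f x‖ ≤ C * ‖x‖ := by
  refine (sq_le_sq₀ (norm_nonneg _) (by positivity)).1 ?_
  rw [E.norm_boundedFn_sq hf, mul_pow, ← E.measure_real_univ x, mul_comm]
  have h : ∀ s, ‖‖f s‖ ^ 2‖ ≤ C ^ 2 := fun s => by
    rw [norm_pow, norm_norm]
    exact pow_le_pow_left₀ (norm_nonneg _) (hC s) 2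
  have := norm_integral_le_of_norm_le_const (μ := E.measure x) (Filter.Eventually.of_forall h)
  rw [mul_comm]
  exact (le_abs_self _).trans this

end Calculus
end PVM

/-! ### Image of a projection-valued measure under a measurable map. -/

namespace PVM

section Pushforward

variable {K : Type*} [NormedAddCommGroup K] [InnerProductSpace ℂ K]

lemma ext_of_dense_inner_self {T T' : K →L[ℂ] K} {D : Set K} (hD : Dense D)
    (h : ∀ x ∈ D, ⟪x, T x⟫_ℂ = ⟪x, T' x⟫_ℂ) : T = T' := by
  refine ext_of_inner_self fun x => ?_
  have := Continuous.ext_on hD (f := fun x => ⟪x, T x⟫_ℂ) (g := fun x => ⟪x, T' x⟫_ℂ)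
    (by fun_prop) (by fun_prop) h
  exact congrFun this x

/-- Testing on a dense set suffices. This matters because the defining identities of the Liouville
resolution are only given for the vectors of `𝒦₂` before completion. -/
lemma proj_eq_of_dense_measure_eq {S S' : Type*} [MeasurableSpace S] [MeasurableSpace S']
    (F : PVM S K) (G : PVM S' K) {q : S → S'} (hq : Measurable q) {D : Set K} (hD : Dense D)
    (h : ∀ x ∈ D, (F.measure x).map q = G.measure x) {B : Set S'} (hB : MeasurableSet B) :
    G.proj B = F.proj (q ⁻¹' B) := by
  refine ext_of_dense_inner_self hD fun x hx => ?_
  rw [G.inner_proj_self x hB, F.inner_proj_self x (hq hB), ← h x hx,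
    map_measureReal_apply hq hB]

variable [CompleteSpace K]

lemma boundedFn_eq_of_proj_eq {S S' : Type*} [MeasurableSpace S] [MeasurableSpace S']
    {F : PVM S K} {G : PVM S' K} {q : S → S'} (hq : Measurable q)
    (h : ∀ B, MeasurableSet B → G.proj B = F.proj (q ⁻¹' B)) {f : S' → ℂ} (hf : BddMeas f) :
    G.boundedFn f = F.boundedFn fun s => f (q s) := by
  have hm : ∀ x, G.measure x = (F.measure x).map q := fun x => by
    refine Measure.ext fun B hB => ?_
    rw [G.measure_apply x hB, Measure.map_apply hq hB, F.measure_apply x (hq hB), h B hB]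
  refine IsIntegral.boundedFn_eq fun x => ?_
  rw [F.isIntegral_boundedFn (hf.comp hq) x, hm, integral_map hq.aemeasurable
    hf.meas.aestronglyMeasurable]

/-- The quadratic form of `f(ℒ) (χ_S(ℋ) - χ_T(ℋ))` for `ℒ = q(ℋ)`. -/
lemma inner_boundedFn_comp_proj_sub {S S' : Type*} [MeasurableSpace S] [MeasurableSpace S']
    {F : PVM S K} {G : PVM S' K} {q : S → S'} (hq : Measurable q)
    (h : ∀ B, MeasurableSet B → G.proj B = F.proj (q ⁻¹' B)) {f : S' → ℂ} (hf : BddMeas f)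
    {B C : Set S} (hB : MeasurableSet B) (hC : MeasurableSet C) (x : K) :
    ⟪x, G.boundedFn f ((F.proj B - F.proj C) x)⟫_ℂ =
      ∫ s, f (q s) * (B.indicator 1 s - C.indicator 1 s) ∂F.measure x := by
  have hBC := (BddMeas.indicator hB).sub (BddMeas.indicator hC)
  rw [boundedFn_eq_of_proj_eq hq h hf, ← boundedFn_indicator F hB, ← boundedFn_indicator F hC,
    ← F.boundedFn_sub (.indicator hB) (.indicator hC), ← mul_apply_eq_comp,
    ← F.boundedFn_mul (hf.comp hq) hBC]
  exact F.isIntegral_boundedFn ((hf.comp hq).mul hBC) x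

end Pushforward
end PVM

/-- The integrals are the characteristic functions evaluated at `-t`, and these determine a finite
measure. -/
lemma measure_eq_of_integral_exp_eq {μ ν : Measure ℝ} [IsFiniteMeasure μ] [IsFiniteMeasure ν]
    (h : ∀ t : ℝ, ∫ l : ℝ, Complex.exp (-(Complex.I * t * l)) ∂μ =
      ∫ l : ℝ, Complex.exp (-(Complex.I * t * l)) ∂ν) : μ = ν := by
  refine Measure.ext_of_charFun (funext fun t => ?_)
  rw [charFun_apply_real, charFun_apply_real]
  convert h (-t) using 4 <;> (push_cast; ring)

/-! ### Pointwise bounds for the transition density. -/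

section Bounds

open PVM

lemma bddMeas_cutoff (ν : ℝ) [DecidablePred (· ∈ Set.Icc 0 ν)] :
    BddMeas fun l : ℝ => if l ∈ Set.Icc 0 ν then (-l : ℂ) else 0 := by
  refine ⟨Measurable.ite measurableSet_Icc (by fun_prop) measurable_const, |ν|, fun l => ?_⟩
  split_ifs with h
  · rw [norm_neg, Complex.norm_real, Real.norm_eq_abs, abs_of_nonneg h.1]
    exact h.2.trans (le_abs_self ν)
  · simp

/-- The density of the conductivity measure on `[0, ν]` with respect to the correlation
measure. -/
def transitionDensity (E ν : ℝ) (p : ℝ × ℝ) : ℝ :=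
  if p.1 - p.2 ∈ Set.Icc 0 ν ∧ E < p.1 ∧ p.2 ≤ E then p.1 - p.2 else 0

/-- On `l - r ≥ 0` the case `l ≤ E < r` cannot occur, and for `r ≤ E < l` the difference of
indicators is `-1`, which cancels the sign in `-ℒ`. -/
lemma cutoff_mul_fermi (E ν : ℝ) [DecidablePred (· ∈ Set.Icc 0 ν)] (p : ℝ × ℝ) :
    (if p.1 - p.2 ∈ Set.Icc 0 ν then (-(p.1 - p.2 : ℝ) : ℂ) else 0) *
      ((Set.Iic E ×ˢ Set.univ).indicator 1 p - (Set.univ ×ˢ Set.Iic E).indicator 1 p) =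
      transitionDensity E ν p := by
  simp only [Set.indicator_apply, Set.mem_prod, Set.mem_Iic, Set.mem_univ, and_true, true_and,
    Pi.one_apply, transitionDensity]
  by_cases h : p.1 - p.2 ∈ Set.Icc 0 ν
  · by_cases h1 : p.1 ≤ E <;> by_cases h2 : p.2 ≤ E
    · simp [h1, h2, not_lt.2 h1]
    · have := h.1
      exact absurd (by linarith) h2
    · have h1' := lt_of_not_ge h1
      simp only [h, h1, h2, h1', if_true, if_false, and_self]
      ring
    · simp [h1, h2]
  · simp [h]

lemma transitionDensity_nonneg (E ν : ℝ) (p : ℝ × ℝ) : 0 ≤ transitionDensity E ν p := by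
  unfold transitionDensity
  split_ifs with h
  · exact h.1.1
  · rfl

lemma transitionDensity_le (E ν : ℝ) (p : ℝ × ℝ) : transitionDensity E ν p ≤
    (Set.Ioc E (E + ν) ×ˢ Set.Ioc (E - ν) E).indicator (fun _ => ν) p := by
  unfold transitionDensity
  split_ifs with h
  · obtain ⟨⟨h1, h2⟩, h3, h4⟩ := h
    rw [Set.indicator_of_mem]
    · exact h2
    · exact ⟨⟨h3, by linarith⟩, by linarith, h4⟩
  · refine Set.indicator_apply_nonneg fun hp => ?_
    -- A point of the rectangle forces `E < E + ν`, so the positivity of `ν` need not be assumed.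
    have := hp.1.1.trans_le hp.1.2
    linarith

/-- The two intervals keep a gap of `ν / 4` from `E` on each side, so the difference exceeds `ν /
2`; they lie within `ν / 2` of `E`, so it stays below `ν`. -/
lemma le_transitionDensity (E ν : ℝ) (p : ℝ × ℝ) :
    (Set.Ioc (E + ν / 4) (E + ν / 2) ×ˢ Set.Ioc (E - ν / 2) (E - ν / 4)).indicator
      (fun _ => ν / 2) p ≤ transitionDensity E ν p := by
  refine Set.indicator_apply_le' (fun hp => ?_) fun _ => transitionDensity_nonneg E ν p
  obtain ⟨⟨h1, h2⟩, h3, h4⟩ := hp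
  rw [transitionDensity, if_pos ⟨⟨by linarith, by linarith⟩, by linarith, by linarith⟩]
  linarith

lemma measurable_transitionDensity (E ν : ℝ) : Measurable (transitionDensity E ν) := by
  refine Measurable.ite ?_ (by fun_prop) measurable_const
  have h1 : MeasurableSet {p : ℝ × ℝ | p.1 - p.2 ∈ Set.Icc 0 ν} :=
    (measurable_fst.sub measurable_snd) measurableSet_Icc
  exact h1.inter ((measurableSet_lt measurable_const measurable_fst).inter
    (measurableSet_le measurable_snd measurable_const))

lemma integrable_transitionDensity (E ν : ℝ) (μ : Measure (ℝ × ℝ)) [IsFiniteMeasure μ] :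
    Integrable (transitionDensity E ν) μ := by
  refine Integrable.of_bound (measurable_transitionDensity E ν).aestronglyMeasurable |ν|
    (Filter.Eventually.of_forall fun p => ?_)
  rw [Real.norm_eq_abs, abs_of_nonneg (transitionDensity_nonneg E ν p)]
  refine (transitionDensity_le E ν p).trans (Set.indicator_apply_le' (fun _ => le_abs_self ν)
    fun _ => abs_nonneg ν)

lemma integral_transitionDensity_bounds (E ν : ℝ) (μ : Measure (ℝ × ℝ))
    [IsFiniteMeasure μ] :
    ν / 2 * μ.real (Set.Ioc (E + ν / 4) (E + ν / 2) ×ˢ Set.Ioc (E - ν / 2) (E - ν / 4)) ≤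
        ∫ p, transitionDensity E ν p ∂μ ∧
      ∫ p, transitionDensity E ν p ∂μ ≤
        ν * μ.real (Set.Ioc E (E + ν) ×ˢ Set.Ioc (E - ν) E) := by
  have hi := integrable_transitionDensity E ν μ
  have hm : ∀ a b c d : ℝ, MeasurableSet (Set.Ioc a b ×ˢ Set.Ioc c d) := fun a b c d =>
    measurableSet_Ioc.prod measurableSet_Ioc
  constructor
  · have := integral_mono ((integrable_const (ν / 2)).indicator (hm _ _ _ _)) hi
      (le_transitionDensity E ν)
    rwa [integral_indicator_const _ (hm _ _ _ _), smul_eq_mul, mul_comm] at this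
  · have := integral_mono hi ((integrable_const ν).indicator (hm _ _ _ _))
      (transitionDensity_le E ν)
    rwa [integral_indicator_const _ (hm _ _ _ _), smul_eq_mul, mul_comm] at this

end Bounds

/-! ### The Liouvillian as a difference, and the two inequalities. -/

section Conductivity

open PVM

variable {d : ℕ} {X : Type} [TopologicalSpace X] [MeasurableSpace X] [PosSpace d X]
  {Ω : Type*} [MeasurableSpace Ω] [BorelSpace X] [SecondCountableTopology X]
  [AddAction (Fin d → ℤ) Ω]
  {P : Measure Ω} {U : TranslationRep X} {H : Ω → Hilb X →ₗ.[ℂ] Hilb X}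

/-- The spectral measure of `ℒ = ℋ_L - ℋ_R` is the image of the joint spectral measure. -/
lemma IsLiouvilleResolution.proj_eq {F : PVM (ℝ × ℝ) (HK2 P U)} {G : PVM ℝ (HK2 P U)}
    (h : IsLiouvilleResolution P U H F G) {B : Set ℝ} (hB : MeasurableSet B) :
    G.proj B = F.proj ((fun p : ℝ × ℝ => p.1 - p.2) ⁻¹' B) := by
  have hq : Measurable fun p : ℝ × ℝ => p.1 - p.2 := measurable_fst.sub measurable_snd
  refine F.proj_eq_of_dense_measure_eq G hq UniformSpace.Completion.denseRange_coe ?_ hB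
  rintro _ ⟨A, rfl⟩
  refine measure_eq_of_integral_exp_eq fun t => ?_
  rw [integral_map hq.aemeasurable (by fun_prop), ← h.liouvillian A t]
  -- `evolve H t` unfolds to the left evolution at `t` applied to the right evolution at `-t`, so
  -- the joint phase is `t (l - r)`.
  refine Eq.trans ?_ (h.joint A t (-t)).symm
  congr 1 with p
  push_cast
  ring_nf

variable [NeZero d]

/-- The existence hypothesis `hR` guarantees that the chosen resolution is a genuine one and not the
placeholder unit masses. Once the conductivity is the integral of `transitionDensity`, the factor `1
/ ν` cancels the `ν` and turns `ν / 2` into `1 / 2`. -/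
lemma FermiAssumption.bounds {E : ℝ} (h : FermiAssumption P U H E)
    (hR : ∃ R : PVM (ℝ × ℝ) (HK2 P U) × PVM ℝ (HK2 P U), IsLiouvilleResolution P U H R.1 R.2)
    {ν : ℝ} (hν : 0 < ν) :
    Real.pi / 2 * h.Psi.real
        (Set.Ioc (E + ν / 4) (E + ν / 2) ×ˢ Set.Ioc (E - ν / 2) (E - ν / 4)) ≤
      h.avgConductivity ν ∧
    h.avgConductivity ν ≤
      Real.pi * h.Psi.real (Set.Ioc E (E + ν) ×ˢ Set.Ioc (E - ν) E) := by
  have hres : IsLiouvilleResolution P U H (jointSpectral P U H) (liouvillianSpectral P U H) := by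
    rw [jointSpectral, liouvillianSpectral, liouvilleResolution, dif_pos hR]
    exact hR.choose_spec
  have hq : Measurable fun p : ℝ × ℝ => p.1 - p.2 := measurable_fst.sub measurable_snd
  have hS : h.conductivityMeasure (Set.Icc 0 ν) =
      Real.pi * ∫ p, transitionDensity E ν p ∂h.Psi := by
    have hc := @bddMeas_cutoff ν fun _ => Classical.propDecidable _
    rw [conductivityMeasure, apply_eq_boundedFn _ hc, fermiSuper,
      inner_boundedFn_comp_proj_sub hq (fun B hB => hres.proj_eq hB) hc
        (measurableSet_Iic.prod MeasurableSet.univ) (MeasurableSet.univ.prod measurableSet_Iic)]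
    congr 1
    -- The integrand is real-valued, so the real part in `conductivityMeasure` discards nothing.
    rw [← Complex.ofReal_re (∫ p, transitionDensity E ν p ∂h.Psi), ← integral_complex_ofReal]
    congr 2
    funext p
    exact @cutoff_mul_fermi E ν (fun _ => Classical.propDecidable _) p
  have : IsFiniteMeasure h.Psi := inferInstanceAs (IsFiniteMeasure (PVM.measure _ _))
  obtain ⟨h1, h2⟩ := integral_transitionDensity_bounds E ν h.Psi
  rw [avgConductivity, hS, ← mul_assoc, mul_comm (1 / ν), mul_assoc]
  constructor
  · rw [div_mul_eq_mul_div, mul_div_assoc]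
    refine mul_le_mul_of_nonneg_left ?_ Real.pi_pos.le
    rw [one_div, inv_mul_eq_div, le_div_iff₀ hν]
    linarith
  · refine mul_le_mul_of_nonneg_left ?_ Real.pi_pos.le
    rw [one_div, inv_mul_eq_div, div_le_iff₀ hν]
    linarith

end Conductivity

/-! ### From a family of sections to a measure on the product, by disintegration. -/

section Bimeasure

open Filter ProbabilityTheory

variable {T : Type*} [MeasurableSpace T]

/-- A family `q ↦ G q` of measures that behaves like a distribution function is the family of
sections `G q = μ (]-∞, q] × ·)` of a measure on the product. -/
lemma exists_measure_prod_of_distribution {ν : Measure T} [IsFiniteMeasure ν] {G : ℚ → Measure T}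
    (hmono : ∀ q r, q ≤ r → G q ≤ G r) (hle : ∀ q, G q ≤ ν)
    (htop : Tendsto (fun n : ℕ => (G n).real Set.univ) atTop (𝓝 (ν.real Set.univ)))
    (hbot : Tendsto (fun n : ℕ => (G (-n)).real Set.univ) atTop (𝓝 0))
    (hright : ∀ t : ℚ, Tendsto (fun n : ℕ => (G (t + 1 / (n + 1))).real Set.univ) atTop
      (𝓝 ((G t).real Set.univ))) :
    ∃ μ : Measure (ℝ × T), IsFiniteMeasure μ ∧
      ∀ (q : ℚ) (C : Set T), MeasurableSet C → μ (Set.Iic (q : ℝ) ×ˢ C) = G q C := by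
  have hfin : ∀ q, IsFiniteMeasure (G q) := fun q => isFiniteMeasure_of_le ν (hle q)
  have hac : ∀ q, G q ≪ ν := fun q => Measure.absolutelyContinuous_of_le (hle q)
  -- For almost every `y` the Radon-Nikodym densities `q ↦ dG_q/dν (y)` should be the distribution
  -- function of a conditional law on `ℝ`. The facts below verify this almost everywhere, with
  -- countably many exceptional sets because `q` is rational.
  set f : T → ℚ → ℝ := fun y q => ((G q).rnDeriv ν y).toReal with hf
  have hfm : Measurable f :=
    measurable_pi_lambda _ fun q => ((G q).measurable_rnDeriv ν).ennreal_toReal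
  have hint : ∀ q, Integrable (fun y => f y q) ν := fun q => Measure.integrable_toReal_rnDeriv
  have hI : ∀ q, ∫ y, f y q ∂ν = (G q).real Set.univ := fun q =>
    Measure.integral_toReal_rnDeriv (hac q)
  have hlt : ∀ᵐ y ∂ν, ∀ q, (G q).rnDeriv ν y < ∞ :=
    ae_all_iff.2 fun q => Measure.rnDeriv_lt_top _ _
  have hM : ∀ᵐ y ∂ν, Monotone (f y) := by
    have : ∀ᵐ y ∂ν, ∀ q r, q ≤ r → (G q).rnDeriv ν y ≤ (G r).rnDeriv ν y := by
      refine ae_all_iff.2 fun q => ae_all_iff.2 fun r => ?_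
      by_cases h : q ≤ r
      · refine (ae_le_of_forall_setLIntegral_le_of_sigmaFinite (Measure.measurable_rnDeriv _ _)
          fun s _ _ => ?_).mono fun y hy _ => hy
        rw [Measure.setLIntegral_rnDeriv (hac q), Measure.setLIntegral_rnDeriv (hac r)]
        exact hmono q r h s
      · exact Eventually.of_forall fun y h' => absurd h' h
    filter_upwards [this, hlt] with y hy hy' q r hqr
    exact ENNReal.toReal_mono (hy' r).ne (hy q r hqr)
  have h1 : ∀ᵐ y ∂ν, ∀ q, f y q ≤ 1 := by
    have : ∀ᵐ y ∂ν, ∀ q, (G q).rnDeriv ν y ≤ 1 :=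
      ae_all_iff.2 fun q => Measure.rnDeriv_le_one_of_le (hle q)
    filter_upwards [this] with y hy q
    exact ENNReal.toReal_le_of_le_ofReal zero_le_one (by simpa using hy q)
  -- Only the total masses are known to converge. Monotonicity of the sequence and the bound by its
  -- prospective limit upgrade convergence of integrals to convergence almost everywhere; the limits
  -- at `-∞` and from the right are obtained in the same way.
  have hT : ∀ᵐ y ∂ν, Tendsto (f y) atTop (𝓝 1) := by
    have := tendsto_of_integral_tendsto_of_monotone (μ := ν) (f := fun (n : ℕ) y => f y n)
      (F := fun _ => 1) (fun n => hint n) (integrable_const _) (by simpa [hI] using htop)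
      (by filter_upwards [hM] with y hy n m hnm; exact hy (by exact_mod_cast hnm))
      (by filter_upwards [h1] with y hy n; exact hy n)
    filter_upwards [this, hM] with y hy hy'
    exact (tendsto_iff_tendsto_subseq_of_monotone hy' tendsto_natCast_atTop_atTop).2 hy
  have hB : ∀ᵐ y ∂ν, Tendsto (f y) atBot (𝓝 0) := by
    have := tendsto_of_integral_tendsto_of_antitone (μ := ν) (f := fun (n : ℕ) y => f y (-n))
      (F := fun _ => 0) (fun n => hint _) (integrable_const _) (by simpa [hI] using hbot)
      (by
        filter_upwards [hM] with y hy n m hnm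
        exact hy (neg_le_neg (by exact_mod_cast hnm)))
      (by filter_upwards with y n; exact ENNReal.toReal_nonneg)
    filter_upwards [this, hM] with y hy hy'
    have h2 : Antitone fun q : ℚ => f y (-q) := fun q r hqr => hy' (neg_le_neg hqr)
    have h3 := (tendsto_iff_tendsto_subseq_of_antitone h2 tendsto_natCast_atTop_atTop).2 hy
    have h4 := h3.comp tendsto_neg_atBot_atTop
    simpa [Function.comp_def] using h4
  have hR : ∀ᵐ y ∂ν, ∀ t : ℚ, ⨅ r : Set.Ioi t, f y r = f y t := by
    have : ∀ᵐ y ∂ν, ∀ t : ℚ,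
        Tendsto (fun n : ℕ => f y (t + 1 / (n + 1))) atTop (𝓝 (f y t)) := by
      refine ae_all_iff.2 fun t => ?_
      refine tendsto_of_integral_tendsto_of_antitone (μ := ν) (fun n => hint _) (hint t)
        (by simpa [hI] using hright t) ?_ ?_
      · filter_upwards [hM] with y hy n m hnm
        refine hy ?_
        have : (n : ℚ) ≤ m := by exact_mod_cast hnm
        gcongr
      · filter_upwards [hM] with y hy n
        refine hy ?_
        have : (0 : ℚ) ≤ 1 / (n + 1) := by positivity
        linarith
    filter_upwards [this, hM] with y hy hy' t
    have hbdd : BddBelow (Set.range fun r : Set.Ioi t => f y r) :=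
      ⟨f y t, by rintro _ ⟨r, rfl⟩; exact hy' (le_of_lt r.2)⟩
    refine le_antisymm (ge_of_tendsto' (hy t) fun n => ?_)
      (le_ciInf fun r => hy' (le_of_lt r.2))
    have hn : t < t + 1 / ((n : ℚ) + 1) := by
      have : (0 : ℚ) < 1 / (n + 1) := by positivity
      linarith
    exact ciInf_le hbdd ⟨_, hn⟩
  have hS : ∀ᵐ y ∂ν, IsRatStieltjesPoint f y := by
    filter_upwards [hM, hT, hB, hR] with y a b c e using ⟨a, b, c, e⟩
  -- `stieltjesOfMeasurableRat` substitutes a default distribution function where `f y` is not one,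
  -- so `κ` is a Markov kernel at every point.
  let κ : Kernel T ℝ :=
    ⟨fun y => (stieltjesOfMeasurableRat f hfm y).measure,
      measurable_measure_stieltjesOfMeasurableRat hfm⟩
  have : IsMarkovKernel κ := ⟨fun y => ⟨measure_stieltjesOfMeasurableRat_univ hfm y⟩⟩
  -- The composition product lives on `T × ℝ`, hence the swap.
  refine ⟨(ν ⊗ₘ κ).map Prod.swap, inferInstance, fun q C hC => ?_⟩
  rw [Measure.map_apply measurable_swap (measurableSet_Iic.prod hC), Set.preimage_swap_prod,
    Measure.compProd_apply_prod hC measurableSet_Iic, ← Measure.setLIntegral_rnDeriv (hac q)]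
  refine lintegral_congr_ae (ae_restrict_of_ae ?_)
  filter_upwards [hS, hlt] with y hy hy'
  change (stieltjesOfMeasurableRat f hfm y).measure (Set.Iic (q : ℝ)) = _
  rw [measure_stieltjesOfMeasurableRat_Iic, stieltjesOfMeasurableRat_eq,
    toRatCDF_of_isRatStieltjesPoint hy, hf, ENNReal.ofReal_toReal (hy' q).ne]

end Bimeasure

/-! ### Joint projection-valued measure of a commuting pair. -/

namespace PVM

section Joint

variable {K : Type*} [NormedAddCommGroup K] [InnerProductSpace ℂ K]

lemma norm_proj_mono {S : Type*} [MeasurableSpace S] (E : PVM S K) {B C : Set S}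
    (hB : MeasurableSet B) (hC : MeasurableSet C) (h : B ⊆ C) (x : K) :
    ‖E.proj B x‖ ≤ ‖E.proj C x‖ := by
  rw [← Set.inter_eq_left.2 h, E.inter _ _ hB hC]
  exact E.norm_proj_le hB _

lemma tendsto_norm_proj_sq_iUnion {S : Type*} [MeasurableSpace S] (E : PVM S K) {B : ℕ → Set S}
    (hB : ∀ n, MeasurableSet (B n)) (hm : Monotone B) (x : K) :
    Filter.Tendsto (fun n => ‖E.proj (B n) x‖ ^ 2) Filter.atTop
      (𝓝 (‖E.proj (⋃ n, B n) x‖ ^ 2)) := by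
  simp only [← E.measure_real x (hB _), ← E.measure_real x (MeasurableSet.iUnion hB)]
  exact (ENNReal.continuousAt_toReal (measure_ne_top _ _)).tendsto.comp
    (tendsto_measure_iUnion_atTop hm)

lemma tendsto_norm_proj_sq_iInter {S : Type*} [MeasurableSpace S] (E : PVM S K) {B : ℕ → Set S}
    (hB : ∀ n, MeasurableSet (B n)) (hm : Antitone B) (x : K) :
    Filter.Tendsto (fun n => ‖E.proj (B n) x‖ ^ 2) Filter.atTop
      (𝓝 (‖E.proj (⋂ n, B n) x‖ ^ 2)) := by
  simp only [← E.measure_real x (hB _), ← E.measure_real x (MeasurableSet.iInter hB)]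
  exact (ENNReal.continuousAt_toReal (measure_ne_top _ _)).tendsto.comp
    (tendsto_measure_iInter_atTop (fun n => (hB n).nullMeasurableSet) hm ⟨0, measure_ne_top _ _⟩)

/-- For commuting projection-valued measures, `B × C ↦ ‖E(B) F(C) x‖²` extends to a measure. -/
lemma exists_joint_measure {T : Type*} [MeasurableSpace T] (E : PVM ℝ K) (F : PVM T K)
    (hcomm : ∀ B C, MeasurableSet B → MeasurableSet C →
      E.proj B * F.proj C = F.proj C * E.proj B) (x : K) :
    ∃ μ : Measure (ℝ × T), IsFiniteMeasure μ ∧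
      ∀ B C, MeasurableSet B → MeasurableSet C →
        μ.real (B ×ˢ C) = ‖E.proj B (F.proj C x)‖ ^ 2 := by
  have hc : ∀ {B : Set ℝ} {C : Set T}, MeasurableSet B → MeasurableSet C → ∀ x,
      E.proj B (F.proj C x) = F.proj C (E.proj B x) := fun hB hC x =>
    congrArg (fun T : K →L[ℂ] K => T x) (hcomm _ _ hB hC)
  -- Commutation moves `F(C)` inside, after which the value is visibly increasing in `q` and bounded
  -- by `F_x(C)`.
  have hG : ∀ (q : ℚ) {C : Set T}, MeasurableSet C →
      F.measure (E.proj (Set.Iic (q : ℝ)) x) C =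
        ENNReal.ofReal (‖E.proj (Set.Iic (q : ℝ)) (F.proj C x)‖ ^ 2) := fun q C hC => by
    rw [F.measure_apply _ hC, hc measurableSet_Iic hC]
  have hU : ∀ q : ℚ, (F.measure (E.proj (Set.Iic (q : ℝ)) x)).real Set.univ =
      ‖E.proj (Set.Iic (q : ℝ)) x‖ ^ 2 := fun q => F.measure_real_univ _
  obtain ⟨μ, hμ, h⟩ := exists_measure_prod_of_distribution (ν := F.measure x)
    (G := fun q : ℚ => F.measure (E.proj (Set.Iic (q : ℝ)) x))
    (fun q r hqr => Measure.le_iff.2 fun C hC => by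
      rw [hG q hC, hG r hC]
      gcongr
      exact E.norm_proj_mono measurableSet_Iic measurableSet_Iic
        (Set.Iic_subset_Iic.2 (by exact_mod_cast hqr)) _)
    (fun q => Measure.le_iff.2 fun C hC => by
      rw [hG q hC, F.measure_apply _ hC]
      gcongr
      exact E.norm_proj_le measurableSet_Iic _)
    (by
      have := E.tendsto_norm_proj_sq_iUnion (B := fun n : ℕ => Set.Iic (((n : ℚ) : ℝ)))
        (fun n => measurableSet_Iic)
        (fun n m h => Set.Iic_subset_Iic.2 (by exact_mod_cast h)) x
      have hu : ⋃ n : ℕ, Set.Iic (((n : ℚ) : ℝ)) = Set.univ := by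
        refine Set.eq_univ_of_forall fun y => ?_
        obtain ⟨n, hn⟩ := exists_nat_ge y
        exact Set.mem_iUnion.2 ⟨n, by simpa using hn⟩
      rw [hu, E.univ] at this
      simp only [hU, F.measure_real_univ]
      exact this)
    (by
      have := E.tendsto_norm_proj_sq_iInter (B := fun n : ℕ => Set.Iic (((-n : ℚ) : ℝ)))
        (fun n => measurableSet_Iic)
        (fun n m h => Set.Iic_subset_Iic.2 (by exact_mod_cast neg_le_neg (by exact_mod_cast h))) x
      have hu : ⋂ n : ℕ, Set.Iic (((-n : ℚ) : ℝ)) = ∅ := by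
        refine Set.eq_empty_of_forall_notMem fun y hy => ?_
        obtain ⟨n, hn⟩ := exists_nat_gt (-y)
        have := Set.mem_iInter.1 hy n
        simp only [Rat.cast_neg, Rat.cast_natCast, Set.mem_Iic] at this
        linarith
      rw [hu] at this
      simp only [hU]
      refine this.trans (by
        rw [← E.measure_real x MeasurableSet.empty, measureReal_empty]))
    (fun t => by
      have := E.tendsto_norm_proj_sq_iInter
        (B := fun n : ℕ => Set.Iic (((t + 1 / (n + 1) : ℚ) : ℝ)))
        (fun n => measurableSet_Iic)
        (fun n m h => Set.Iic_subset_Iic.2 (by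
          have : (n : ℚ) ≤ m := by exact_mod_cast h
          have : t + 1 / ((m : ℚ) + 1) ≤ t + 1 / ((n : ℚ) + 1) := by gcongr
          exact_mod_cast this)) x
      have hu : ⋂ n : ℕ, Set.Iic (((t + 1 / (n + 1) : ℚ) : ℝ)) = Set.Iic (t : ℝ) := by
        refine Set.Subset.antisymm (fun y hy => ?_) fun y hy => ?_
        · have h0 : Filter.Tendsto (fun n : ℕ => (t : ℝ) + 1 / ((n : ℝ) + 1)) Filter.atTop
              (𝓝 ((t : ℝ) + 0)) := tendsto_const_nhds.add tendsto_one_div_add_atTop_nhds_zero_nat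
          rw [add_zero] at h0
          refine ge_of_tendsto' h0 fun n => ?_
          have := Set.mem_iInter.1 hy n
          simpa using this
        · refine Set.mem_iInter.2 fun n => ?_
          have h1 : (0 : ℝ) ≤ 1 / ((n : ℝ) + 1) := by positivity
          have h2 : y ≤ t := hy
          have : y ≤ (t : ℝ) + 1 / ((n : ℝ) + 1) := by linarith
          simpa using this
      rw [hu] at this
      simp only [hU]
      exact this)
  refine ⟨μ, hμ, fun B C hB hC => ?_⟩
  have hfin : IsFiniteMeasure ((μ.restrict (Set.univ ×ˢ C)).map Prod.fst) := inferInstance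
  -- So far `μ` is controlled only on rational half-lines in the first variable. For fixed `C` both
  -- sides are finite measures in the first variable, and the rational half-lines are a generating
  -- π-system.
  have key : (μ.restrict (Set.univ ×ˢ C)).map Prod.fst = E.measure (F.proj C x) := by
    refine Measure.ext_of_generateFrom_of_iUnion _ (fun n : ℕ => Set.Iic (((n : ℚ) : ℝ)))
      ((BorelSpace.measurable_eq (α := ℝ)).trans Real.borel_eq_generateFrom_Iic_rat)
      Real.isPiSystem_Iic_rat ?_ (fun n => Set.mem_iUnion.2 ⟨n, rfl⟩)
      (fun n => measure_ne_top _ _) ?_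
    · refine Set.eq_univ_of_forall fun y => ?_
      obtain ⟨n, hn⟩ := exists_nat_ge y
      exact Set.mem_iUnion.2 ⟨n, by simpa using hn⟩
    · rintro _ hs
      obtain ⟨q, rfl⟩ := Set.mem_iUnion.1 hs
      rw [Measure.map_apply measurable_fst measurableSet_Iic,
        Measure.restrict_apply (measurable_fst measurableSet_Iic),
        show Prod.fst ⁻¹' Set.Iic (q : ℝ) ∩ Set.univ ×ˢ C = Set.Iic (q : ℝ) ×ˢ C by
          ext p; simp,
        h q C hC, hG q hC, E.measure_apply _ measurableSet_Iic]
  have := congrArg (fun m : Measure ℝ => m.real B) key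
  rw [E.measure_real _ hB, map_measureReal_apply measurable_fst hB,
    measureReal_restrict_apply (measurable_fst hB)] at this
  rw [← this]
  congr 1
  ext p
  simp

lemma hasSum_measureReal_iUnion {S : Type*} [MeasurableSpace S] (μ : Measure S)
    [IsFiniteMeasure μ] {f : ℕ → Set S} (hf : ∀ n, MeasurableSet (f n))
    (hd : Pairwise (Function.onFun Disjoint f)) :
    HasSum (fun n => μ.real (f n)) (μ.real (⋃ n, f n)) := by
  have h := measure_iUnion hd hf (μ := μ)
  have hfin : ∑' n, μ (f n) ≠ ∞ := by rw [← h]; exact measure_ne_top _ _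
  rw [Measure.real, h, ENNReal.tsum_toReal_eq fun n => measure_ne_top _ _]
  exact ENNReal.hasSum_toReal hfin

/-- `T` is the orthogonal projection that a spectral measure with scalar measures `μ x` assigns
to the set `B`. -/
structure IsSetProj {S : Type*} [MeasurableSpace S] (μ : K → Measure S) (B : Set S)
    (T : K →L[ℂ] K) : Prop where
  inner_self : ∀ x, ⟪x, T x⟫_ℂ = ((μ x).real B : ℂ)
  idem : ∀ x, T (T x) = T x

section SetProj

variable {S : Type*} [MeasurableSpace S] {μ : K → Measure S} {A B : Set S} {T T' : K →L[ℂ] K}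

/-- A complex operator with real quadratic form is symmetric. -/
lemma IsSetProj.symm (h : IsSetProj μ B T) (x y : K) : ⟪T x, y⟫_ℂ = ⟪x, T y⟫_ℂ := by
  refine (LinearMap.isSymmetric_iff_inner_map_self_real (T : K →ₗ[ℂ] K)).2 (fun v => ?_) x y
  change starRingEnd ℂ ⟪T v, v⟫_ℂ = ⟪T v, v⟫_ℂ
  rw [inner_conj_symm, ← inner_conj_symm (T v) v, h.inner_self v, Complex.conj_ofReal]

lemma IsSetProj.norm_sq (h : IsSetProj μ B T) (x : K) : ‖T x‖ ^ 2 = (μ x).real B := by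
  have h1 : ⟪T x, T x⟫_ℂ = ((μ x).real B : ℂ) := by
    rw [h.symm, h.idem, h.inner_self]
  rw [inner_self_eq_norm_sq_to_K] at h1
  apply Complex.ofReal_injective
  push_cast
  exact h1

lemma IsSetProj.unique (h : IsSetProj μ B T) (h' : IsSetProj μ B T') : T = T' :=
  ext_of_inner_self fun x => (h.inner_self x).trans (h'.inner_self x).symm

variable [hfin : ∀ x, IsFiniteMeasure (μ x)]

/-- Put `y = T' x`. Additivity of the scalar measure of `y` gives `‖T y‖² + ‖T' y‖² ≤ ‖y‖²`, while
`T' y = y` already exhausts the right side. -/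
lemma IsSetProj.mul_eq_zero (huniv : ∀ x, (μ x).real Set.univ = ‖x‖ ^ 2) (h : IsSetProj μ A T)
    (h' : IsSetProj μ B T') (hB : MeasurableSet B) (hd : Disjoint A B) (x : K) :
    T (T' x) = 0 := by
  have h1 : ‖T (T' x)‖ ^ 2 + ‖T' (T' x)‖ ^ 2 ≤ ‖T' x‖ ^ 2 := by
    rw [h.norm_sq, h'.norm_sq, ← measureReal_union hd hB, ← huniv]
    exact measureReal_mono (Set.subset_univ _)
  rw [h'.idem] at h1
  have h2 : ‖T (T' x)‖ ^ 2 ≤ 0 := by linarith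
  simpa using h2

lemma IsSetProj.union (huniv : ∀ x, (μ x).real Set.univ = ‖x‖ ^ 2) (h : IsSetProj μ A T)
    (h' : IsSetProj μ B T') (hA : MeasurableSet A) (hB : MeasurableSet B) (hd : Disjoint A B) :
    IsSetProj μ (A ∪ B) (T + T') where
  inner_self x := by
    rw [add_apply, inner_add_right, h.inner_self, h'.inner_self, measureReal_union hd hB]
    push_cast
    rfl
  idem x := by
    simp only [add_apply, map_add, h.idem, h'.idem, h.mul_eq_zero huniv h' hB hd,
      h'.mul_eq_zero huniv h hA hd.symm, add_zero, zero_add]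

lemma IsSetProj.compl (huniv : ∀ x, (μ x).real Set.univ = ‖x‖ ^ 2) (h : IsSetProj μ A T)
    (hA : MeasurableSet A) : IsSetProj μ Aᶜ (1 - T) where
  inner_self x := by
    rw [sub_apply, inner_sub_right, h.inner_self, measureReal_compl hA, huniv]
    rw [one_apply_eq_self, inner_self_eq_norm_sq_to_K, Complex.ofReal_sub, Complex.ofReal_pow]
    rfl
  idem x := by simp [h.idem]

/-- The projections have pairwise orthogonal ranges, and `∑ ‖T n x‖²` is the finite measure of the
union, so the series converges strongly. -/
lemma IsSetProj.iUnion [CompleteSpace K] (huniv : ∀ x, (μ x).real Set.univ = ‖x‖ ^ 2)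
    {f : ℕ → Set S} {T : ℕ → K →L[ℂ] K} (hf : ∀ n, MeasurableSet (f n))
    (hd : Pairwise (Function.onFun Disjoint f)) (h : ∀ n, IsSetProj μ (f n) (T n)) :
    ∃ T', IsSetProj μ (⋃ n, f n) T' := by
  -- The kernel of `1 - T n` is the range of the idempotent `T n`.
  let G : ℕ → Submodule ℂ K := fun n => LinearMap.ker ((1 - T n : K →L[ℂ] K) : K →ₗ[ℂ] K)
  have hG : ∀ n y, y ∈ G n ↔ T n y = y := fun n y => by
    rw [LinearMap.mem_ker, ContinuousLinearMap.coe_coe, sub_apply, one_apply_eq_self, sub_eq_zero,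
      eq_comm]
  have horth : OrthogonalFamily ℂ (fun n => G n) fun n => (G n).subtypeₗᵢ := by
    intro i j hij y z
    change ⟪(y : K), (z : K)⟫_ℂ = 0
    rw [← (hG i y).1 y.2, ← (hG j z).1 z.2, (h i).symm,
      (h i).mul_eq_zero huniv (h j) (hf j) (hd hij), inner_zero_right]
  have hsq : ∀ x, HasSum (fun n => ‖T n x‖ ^ 2) ((μ x).real (⋃ n, f n)) := fun x => by
    simp only [(h _).norm_sq]
    exact hasSum_measureReal_iUnion (μ x) hf hd
  have hsum : ∀ x, Summable fun n => T n x := fun x =>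
    (horth.summable_iff_norm_sq_summable fun n => ⟨T n x, (hG n _).2 ((h n).idem x)⟩).2
      (hsq x).summable
  -- Continuity of the pointwise limit of the partial sums comes from Banach-Steinhaus.
  let T' := continuousLinearMapOfTendsto (fun N => ∑ n ∈ Finset.range N, T n)
    (f := fun x => ∑' n, T n x) (l := Filter.atTop) (tendsto_pi_nhds.2 fun x => by
      simpa [sum_apply] using (hsum x).hasSum.tendsto_sum_nat)
  have hT' : ∀ x, HasSum (fun n => T n x) (T' x) := fun x => (hsum x).hasSum
  refine ⟨T', fun x => ?_, fun x => ?_⟩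
  · refine HasSum.unique ((hT' x).mapL (innerSL ℂ x)) ?_
    simp only [innerSL_apply_apply]
    have := (Complex.hasSum_ofReal.2 (hsq x))
    simpa only [(h _).inner_self, ← (h _).norm_sq] using this
  · refine HasSum.unique (hT' (T' x)) ?_
    convert hT' x using 2 with n
    refine HasSum.unique ((hT' x).mapL (T n)) ?_
    convert hasSum_single n fun m hm => ?_ using 1
    · exact ((h n).idem x).symm
    · exact (h n).mul_eq_zero huniv (h m) (hf m) (hd hm.symm) x

/-- A projection-valued measure from its scalar measures. -/
lemma exists_of_isSetProj (huniv : ∀ x, (μ x).real Set.univ = ‖x‖ ^ 2)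
    (h : ∀ B, MeasurableSet B → ∃ T, IsSetProj μ B T) :
    ∃ F : PVM S K, ∀ B, MeasurableSet B → IsSetProj μ B (F.proj B) := by
  classical
  choose! P hP using h
  refine ⟨⟨P, fun B hB => (hP B hB).symm, ?_, fun B C hB hC => ?_, fun B hB hd x y => ?_⟩, hP⟩
  · refine ext_of_inner_self fun x => ?_
    rw [(hP _ MeasurableSet.univ).inner_self, huniv, one_apply_eq_self,
      inner_self_eq_norm_sq_to_K]
    norm_cast
  -- Multiplicativity follows from additivity: split `B` and `C` along their intersection; every
  -- product of projections of disjoint pieces vanishes.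
  · have h1 : P B = P (B ∩ C) + P (B \ C) := by
      refine (hP B hB).unique ?_
      have := (hP _ (hB.inter hC)).union huniv (hP _ (hB.diff hC)) (hB.inter hC) (hB.diff hC)
        (Set.disjoint_sdiff_right.mono_left Set.inter_subset_right)
      rwa [Set.inter_union_sdiff] at this
    have h2 : P C = P (B ∩ C) + P (C \ B) := by
      refine (hP C hC).unique ?_
      have := (hP _ (hB.inter hC)).union huniv (hP _ (hC.diff hB)) (hB.inter hC) (hC.diff hB)
        (Set.disjoint_sdiff_right.mono_left Set.inter_subset_left)
      rwa [Set.inter_comm B C, Set.inter_union_sdiff, Set.inter_comm C B] at this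
    ext x
    rw [h1, h2, mul_apply_eq_comp]
    simp only [add_apply, map_add]
    rw [(hP _ (hB.inter hC)).idem,
      (hP _ (hB.inter hC)).mul_eq_zero huniv (hP _ (hC.diff hB)) (hC.diff hB)
        (Set.disjoint_sdiff_right.mono_left Set.inter_subset_left),
      (hP _ (hB.diff hC)).mul_eq_zero huniv (hP _ (hB.inter hC)) (hB.inter hC)
        (Set.disjoint_sdiff_left.mono_right Set.inter_subset_right),
      (hP _ (hB.diff hC)).mul_eq_zero huniv (hP _ (hC.diff hB)) (hC.diff hB)
        (Set.disjoint_sdiff_left.mono_right Set.sdiff_subset)]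
    simp
  · have hself : ∀ z, HasSum (fun n => ⟪P (B n) z, z⟫_ℂ) ⟪P (⋃ n, B n) z, z⟫_ℂ := fun z => by
      simp only [(hP _ (hB _)).symm, (hP _ (MeasurableSet.iUnion hB)).symm,
        (hP _ (hB _)).inner_self, (hP _ (MeasurableSet.iUnion hB)).inner_self]
      refine Complex.hasSum_ofReal.2 ?_
      exact hasSum_measureReal_iUnion (μ z) hB hd
    -- Countable additivity is known for the quadratic forms; polarization carries it to `⟪x, · y⟫`.
    have hpol : ∀ T : K →L[ℂ] K, ⟪T x, y⟫_ℂ = (⟪T (x + y), x + y⟫_ℂ - ⟪T (x - y), x - y⟫_ℂ -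
        Complex.I * ⟪T (x + Complex.I • y), x + Complex.I • y⟫_ℂ +
        Complex.I * ⟪T (x - Complex.I • y), x - Complex.I • y⟫_ℂ) / 4 := fun T =>
      inner_map_polarization' (T : K →ₗ[ℂ] K) x y
    simp only [← (hP _ (hB _)).symm, ← (hP _ (MeasurableSet.iUnion hB)).symm]
    simp only [hpol]
    exact ((((hself _).sub (hself _)).sub ((hself _).mul_left _)).add
      ((hself _).mul_left _)).div_const _

end SetProj

/-- Commuting projection-valued measures have a joint projection-valued measure. -/
lemma exists_joint {T : Type*} [MeasurableSpace T] [CompleteSpace K] (E : PVM ℝ K) (F : PVM T K)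
    (hcomm : ∀ B C, MeasurableSet B → MeasurableSet C →
      E.proj B * F.proj C = F.proj C * E.proj B) :
    ∃ J : PVM (ℝ × T) K, ∀ B C, MeasurableSet B → MeasurableSet C →
      J.proj (B ×ˢ C) = E.proj B * F.proj C := by
  choose μ hfin hμ using E.exists_joint_measure F hcomm
  have huniv : ∀ x, (μ x).real Set.univ = ‖x‖ ^ 2 := fun x => by
    rw [← Set.univ_prod_univ, hμ x _ _ MeasurableSet.univ MeasurableSet.univ, E.univ, F.univ]
    rfl
  have hrect : ∀ B C, MeasurableSet B → MeasurableSet C →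
      IsSetProj μ (B ×ˢ C) (E.proj B * F.proj C) := fun B C hB hC => by
    have hc : ∀ x, E.proj B (F.proj C x) = F.proj C (E.proj B x) := fun x =>
      congrArg (fun T : K →L[ℂ] K => T x) (hcomm _ _ hB hC)
    have hi : ∀ x, (E.proj B * F.proj C) ((E.proj B * F.proj C) x) =
        (E.proj B * F.proj C) x := fun x => by
      simp only [mul_apply_eq_comp]
      rw [← hc, F.proj_proj hC, E.proj_proj hB]
    refine ⟨fun x => ?_, hi⟩
    rw [← hi, hμ x B C hB hC]
    simp only [mul_apply_eq_comp]
    rw [← E.symm B hB, ← F.symm C hC, ← hc,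
      inner_self_eq_norm_sq_to_K]
    norm_cast
  -- The sets that carry a projection form a Dynkin class that contains the rectangles, which are a
  -- generating π-system.
  obtain ⟨J, hJ⟩ := exists_of_isSetProj huniv fun S hS => by
    induction S, hS using MeasurableSpace.induction_on_inter generateFrom_prod.symm
      isPiSystem_prod with
    | empty => exact ⟨0, fun x => by simp, fun x => by simp⟩
    | basic t ht =>
      obtain ⟨B, hB, C, hC, rfl⟩ := ht
      exact ⟨_, hrect B C hB hC⟩
    | compl t ht ih =>
      obtain ⟨T, hT⟩ := ih
      exact ⟨_, hT.compl huniv ht⟩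
    | iUnion f hd hf ih =>
      choose T hT using ih
      exact IsSetProj.iUnion huniv hf hd hT
  exact ⟨J, fun B C hB hC => (hJ _ (hB.prod hC)).unique (hrect B C hB hC)⟩

end Joint

end PVM

/-! ### Projection-valued measures on a pre-Hilbert space and their extension to the completion. -/

namespace PVM

section Completion

open UniformSpace

variable {V : Type*} [SeminormedAddCommGroup V] [InnerProductSpace ℂ V]

/-- In a seminormed space vectors at distance zero may differ, as random operators that agree almost
surely do. Testing against all vectors proves equality in the completion without choosing
representatives. -/
lemma completion_coe_eq_of_inner {x y : V} (h : ∀ z, ⟪x, z⟫_ℂ = ⟪y, z⟫_ℂ) :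
    (x : Completion V) = y := by
  rw [← sub_eq_zero, ← Completion.coe_sub, ← norm_eq_zero, Completion.norm_coe]
  have h1 : ⟪x - y, x - y⟫_ℂ = 0 := by rw [inner_sub_left, h, sub_self]
  rw [inner_self_eq_norm_sq_to_K] at h1
  simpa using h1

/-- A bounded map of a pre-Hilbert space that has an adjoint extends to the completion. -/
lemma exists_extend_completion {W W' : V → V} (hadj : ∀ x y, ⟪W x, y⟫_ℂ = ⟪x, W' y⟫_ℂ) {C : ℝ}
    (hC : ∀ x, ‖W x‖ ≤ C * ‖x‖) :
    ∃ T : Completion V →L[ℂ] Completion V, ∀ x : V, T x = W x := by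
  -- `W` is not assumed linear; linearity modulo null vectors follows from the adjoint relation,
  -- since the inner product is linear in the argument that `W` has vacated.
  let L : V →ₗ[ℂ] Completion V :=
    { toFun := fun x => W x
      map_add' := fun x y => by
        rw [← Completion.coe_add]
        exact completion_coe_eq_of_inner fun z => by simp only [hadj, inner_add_left]
      map_smul' := fun c x => by
        rw [RingHom.id_apply, ← Completion.coe_smul]
        exact completion_coe_eq_of_inner fun z => by simp only [hadj, inner_smul_left] }
  let L' : V →L[ℂ] Completion V := L.mkContinuous C fun x => by
    change ‖(W x : Completion V)‖ ≤ _
    rw [Completion.norm_coe]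
    exact hC x
  refine ⟨L'.extend Completion.toComplL, fun x => ?_⟩
  exact L'.extend_eq Completion.denseRange_coe (Completion.isUniformInducing_coe V) x

/-- A symmetric idempotent map does not increase norms. -/
lemma norm_le_of_symm_of_idem {W : V → V} (hs : ∀ x y, ⟪W x, y⟫_ℂ = ⟪x, W y⟫_ℂ)
    (hi : ∀ x y, ⟪W (W x), y⟫_ℂ = ⟪W x, y⟫_ℂ) (x : V) : ‖W x‖ ≤ ‖x‖ := by
  have h1 : ⟪W x, W x⟫_ℂ = ⟪W x, x⟫_ℂ := by rw [← hs, hi]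
  have h2 : ‖W x‖ ^ 2 ≤ ‖W x‖ * ‖x‖ := by
    have := norm_inner_le_norm (𝕜 := ℂ) (W x) x
    rw [← h1, inner_self_eq_norm_sq_to_K] at this
    simpa using this
  rcases (norm_nonneg (W x)).eq_or_lt with h | h
  · rw [← h]; exact norm_nonneg x
  · nlinarith

/-- A projection-valued measure on a pre-Hilbert space, where vectors at distance zero are not
distinguished. -/
structure Pre (S : Type*) [MeasurableSpace S] (V : Type*) [SeminormedAddCommGroup V]
    [InnerProductSpace ℂ V] where
  q : Set S → V → V
  symm : ∀ B, MeasurableSet B → ∀ x y, ⟪q B x, y⟫_ℂ = ⟪x, q B y⟫_ℂ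
  univ : ∀ x y, ⟪q Set.univ x, y⟫_ℂ = ⟪x, y⟫_ℂ
  inter : ∀ B C, MeasurableSet B → MeasurableSet C → ∀ x y,
    ⟪q B (q C x), y⟫_ℂ = ⟪q (B ∩ C) x, y⟫_ℂ
  iUnion : ∀ B : ℕ → Set S, (∀ n, MeasurableSet (B n)) →
    Pairwise (Function.onFun Disjoint B) →
    ∀ x, HasSum (fun n => ⟪x, q (B n) x⟫_ℂ) ⟪x, q (⋃ n, B n) x⟫_ℂ

variable {S : Type*} [MeasurableSpace S]

lemma Pre.norm_le (Q : Pre S V) {B : Set S} (hB : MeasurableSet B) (x : V) : ‖Q.q B x‖ ≤ ‖x‖ :=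
  norm_le_of_symm_of_idem (Q.symm B hB)
    (fun x y => by rw [Q.inter B B hB hB, Set.inter_self]) x

lemma Pre.exists_proj (Q : Pre S V) (B : Set S) : ∃ T : Completion V →L[ℂ] Completion V,
    MeasurableSet B → ∀ x : V, T x = Q.q B x := by
  by_cases hB : MeasurableSet B
  · obtain ⟨T, hT⟩ := exists_extend_completion (Q.symm B hB) (C := 1)
      (fun x => by rw [one_mul]; exact Q.norm_le hB x)
    exact ⟨T, fun _ => hT⟩
  · exact ⟨0, fun h => absurd h hB⟩

/-- The extension of `Q.q B` to the completion. -/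
def Pre.proj (Q : Pre S V) (B : Set S) : Completion V →L[ℂ] Completion V :=
  (Q.exists_proj B).choose

lemma Pre.proj_coe (Q : Pre S V) {B : Set S} (hB : MeasurableSet B) (x : V) :
    Q.proj B x = Q.q B x :=
  (Q.exists_proj B).choose_spec hB x

lemma Pre.proj_symm (Q : Pre S V) {B : Set S} (hB : MeasurableSet B) (x y : Completion V) :
    ⟪Q.proj B x, y⟫_ℂ = ⟪x, Q.proj B y⟫_ℂ := by
  induction x, y using Completion.induction_on₂ with
  | hp => exact isClosed_eq (by fun_prop) (by fun_prop)
  | ih x y => simp only [Q.proj_coe hB, Completion.inner_coe, Q.symm B hB]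

lemma Pre.proj_inter (Q : Pre S V) {B C : Set S} (hB : MeasurableSet B) (hC : MeasurableSet C) :
    Q.proj (B ∩ C) = Q.proj B * Q.proj C := by
  ext x
  induction x using Completion.induction_on with
  | hp => exact isClosed_eq (by fun_prop) (by fun_prop)
  | ih x =>
    rw [mul_apply_eq_comp, Q.proj_coe (hB.inter hC), Q.proj_coe hC, Q.proj_coe hB]
    exact (completion_coe_eq_of_inner fun z => Q.inter B C hB hC x z).symm

lemma Pre.proj_univ (Q : Pre S V) : Q.proj Set.univ = 1 := by
  ext x
  induction x using Completion.induction_on with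
  | hp => exact isClosed_eq (by fun_prop) (by fun_prop)
  | ih x =>
    rw [Q.proj_coe MeasurableSet.univ]
    exact completion_coe_eq_of_inner fun z => Q.univ x z

lemma Pre.proj_empty (Q : Pre S V) : Q.proj ∅ = 0 := by
  refine ext_of_dense_inner_self Completion.denseRange_coe ?_
  rintro _ ⟨x, rfl⟩
  rw [Q.proj_coe MeasurableSet.empty, Completion.inner_coe, zero_apply, inner_zero_right]
  have h := Q.iUnion (fun _ => ∅) (fun _ => MeasurableSet.empty)
    (fun i j _ => by simp [Function.onFun]) x
  exact tendsto_nhds_unique tendsto_const_nhds h.summable.tendsto_atTop_zero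

/-- The remainder `D F` after a finite partial sum is a symmetric idempotent, hence a contraction.
On `V` one has `‖D F v‖² = ⟪v, D F v⟫`, which tends to zero by additivity of the quadratic forms;
the uniform bound extends this to the completion. -/
lemma Pre.tendsto_sum_proj (Q : Pre S V) {B : ℕ → Set S} (hB : ∀ n, MeasurableSet (B n))
    (hd : Pairwise (Function.onFun Disjoint B)) (y : Completion V) :
    HasSum (fun n => Q.proj (B n) y) (Q.proj (⋃ n, B n) y) := by
  have hU := MeasurableSet.iUnion hB
  set D : Finset ℕ → Completion V →L[ℂ] Completion V := fun F =>
    Q.proj (⋃ n, B n) - ∑ n ∈ F, Q.proj (B n) with hD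
  have hs : ∀ F x y, ⟪D F x, y⟫_ℂ = ⟪x, D F y⟫_ℂ := fun F x y => by
    simp only [hD, sub_apply, sum_apply, inner_sub_left, inner_sub_right, sum_inner, inner_sum,
      Q.proj_symm hU, Q.proj_symm (hB _)]
  have hUB : ∀ n, Q.proj (⋃ n, B n) * Q.proj (B n) = Q.proj (B n) := fun n => by
    rw [← Q.proj_inter hU (hB n), Set.inter_eq_right.2 (Set.subset_iUnion B n)]
  have hBU : ∀ n, Q.proj (B n) * Q.proj (⋃ n, B n) = Q.proj (B n) := fun n => by
    rw [← Q.proj_inter (hB n) hU, Set.inter_eq_left.2 (Set.subset_iUnion B n)]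
  have hBB : ∀ n m, Q.proj (B n) * Q.proj (B m) = if n = m then Q.proj (B n) else 0 := by
    intro n m
    rw [← Q.proj_inter (hB n) (hB m)]
    split_ifs with h
    · rw [h, Set.inter_self]
    · rw [(hd h).inter_eq, Q.proj_empty]
  have hmul : ∀ F, D F * D F = D F := fun F => by
    simp only [hD, mul_sub, sub_mul, Finset.mul_sum, Finset.sum_mul, hUB, hBU, hBB,
      ← Q.proj_inter hU hU, Set.inter_self, Finset.sum_ite_eq']
    have h0 : ∑ n ∈ F, (Q.proj (B n) - if n ∈ F then Q.proj (B n) else 0) = 0 :=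
      Finset.sum_eq_zero fun n hn => by rw [if_pos hn, sub_self]
    rw [h0, sub_zero]
  have hle : ∀ F x, ‖D F x‖ ≤ ‖x‖ := fun F =>
    norm_le_of_symm_of_idem (hs F) fun x y => by
      rw [← mul_apply_eq_comp, hmul]
  have hdense : ∀ v : V, Filter.Tendsto (fun F => ‖D F v‖) Filter.atTop (𝓝 0) := fun v => by
    have h1 : ∀ F, ‖D F v‖ ^ 2 = (⟪v, Q.q (⋃ n, B n) v⟫_ℂ - ∑ n ∈ F, ⟪v, Q.q (B n) v⟫_ℂ).re :=
      fun F => by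
      have : ((‖D F v‖ : ℂ)) ^ 2 = ⟪(v : Completion V), D F v⟫_ℂ := by
        rw [← congrArg (fun T : Completion V →L[ℂ] Completion V => T v) (hmul F),
          mul_apply_eq_comp, ← hs, ← mul_apply_eq_comp, hmul]
        exact (inner_self_eq_norm_sq_to_K (𝕜 := ℂ) (D F v)).symm
      have h2 := congrArg Complex.re this
      rw [← Complex.ofReal_pow, Complex.ofReal_re] at h2
      rw [h2, hD]
      simp only [sub_apply, sum_apply, inner_sub_right, inner_sum, Q.proj_coe hU,
        Q.proj_coe (hB _), Completion.inner_coe]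
    have h3 : Filter.Tendsto (fun F => ‖D F v‖ ^ 2) Filter.atTop (𝓝 0) := by
      simp only [h1]
      have := (Complex.continuous_re.tendsto _).comp
        ((tendsto_const_nhds (x := ⟪v, Q.q (⋃ n, B n) v⟫_ℂ)).sub (Q.iUnion B hB hd v))
      simpa [Function.comp_def] using this
    have := (Real.continuous_sqrt.tendsto 0).comp h3
    simpa [Function.comp_def, Real.sqrt_sq] using this
  rw [HasSum, ← tendsto_sub_nhds_zero_iff]
  suffices h : Filter.Tendsto (fun F => D F y) Filter.atTop (𝓝 0) by
    have := h.neg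
    simpa [hD] using this
  rw [Metric.tendsto_nhds]
  intro ε hε
  obtain ⟨_, hv, ⟨v, rfl⟩⟩ := Metric.dense_iff.1 (Completion.denseRange_coe (α := V)) y (ε / 2)
    (half_pos hε)
  filter_upwards [(hdense v).eventually_lt_const (half_pos hε)] with F hF
  rw [dist_zero_right]
  have h1 : D F y = D F v + D F (y - v) := by rw [map_sub]; abel
  rw [Metric.mem_ball, dist_comm, dist_eq_norm] at hv
  rw [h1]
  linarith [norm_add_le (D F v) (D F (y - v)), hle F (y - v)]

/-- The extension of a projection-valued measure to the completion. -/
def Pre.toPVM (Q : Pre S V) : PVM S (Completion V) where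
  proj := Q.proj
  symm B hB x y := Q.proj_symm hB x y
  univ := Q.proj_univ
  inter B C hB hC := Q.proj_inter hB hC
  iUnion B hB hd x y := by
    simpa using (Q.tendsto_sum_proj hB hd y).mapL (innerSL ℂ x)

/-- A functional calculus on a pre-Hilbert space that has the correct values on indicators is the
functional calculus of the projection-valued measure. -/
lemma coe_eq_boundedFn {E : PVM S (Completion V)} {W : (S → ℂ) → V → V}
    (hind : ∀ B, MeasurableSet B → ∀ x : V,
      (W (B.indicator 1) x : Completion V) = E.proj B x)
    (hadd : ∀ f g, BddMeas f → BddMeas g → ∀ x : V,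
      (W (fun s => f s + g s) x : Completion V) = W f x + W g x)
    (hsmul : ∀ (c : ℂ) f, BddMeas f → ∀ x : V,
      (W (fun s => c * f s) x : Completion V) = c • (W f x : Completion V))
    (hle : ∀ f, BddMeas f → ∀ C : ℝ, 0 ≤ C → (∀ s, ‖f s‖ ≤ C) → ∀ x : V, ‖W f x‖ ≤ C * ‖x‖)
    {f : S → ℂ} (hf : BddMeas f) (x : V) : (W f x : Completion V) = E.boundedFn f x := by
  have hsimple : ∀ g : SimpleFunc S ℂ, (W g x : Completion V) = E.boundedFn g x := fun g => by
    induction g using SimpleFunc.induction with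
    | const c hs =>
      rw [simple_piecewise_eq, hsmul _ _ (.indicator hs), hind _ hs,
        E.boundedFn_const_mul _ (.indicator hs), boundedFn_indicator _ hs]
      rfl
    | @add f g _ h1 h2 =>
      have h3 := hadd f g (.simple _) (.simple _) x
      have h4 := E.boundedFn_add (.simple f) (.simple g)
      rw [h1, h2] at h3
      refine h3.trans ?_
      rw [← add_apply, ← h4]
      rfl
  obtain ⟨g, C, h1, h2, h3⟩ := exists_simple_seq hf
  have h4 := (E.exists_isIntegral h1 h2 h3).2
  have h5 : Filter.Tendsto (fun n => E.boundedFn (g n) x) Filter.atTop (𝓝 (E.boundedFn f x)) :=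
    ((ContinuousLinearMap.apply ℂ (Completion V) (x : Completion V)).continuous.tendsto _).comp h4
  refine tendsto_nhds_unique ?_ h5
  rw [tendsto_iff_norm_sub_tendsto_zero]
  have h6 : ∀ n : ℕ, ‖E.boundedFn (g n) x - (W f x : Completion V)‖ ≤ 1 / ((n : ℝ) + 1) * ‖x‖ :=
    fun n => by
    have h7 := hadd f (fun s => -1 * g n s) hf ((BddMeas.simple _).const_mul _) x
    rw [hsmul _ _ (.simple _), hsimple] at h7
    have h8 : (W f x : Completion V) - E.boundedFn (g n) x =
        W (fun s => f s + -1 * g n s) x := by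
      rw [h7]
      simp [sub_eq_add_neg]
    rw [norm_sub_rev, h8, Completion.norm_coe]
    refine hle _ (hf.add ((BddMeas.simple _).const_mul _)) _ (by positivity) (fun s => ?_) x
    have := h1 n s
    simpa [sub_eq_add_neg] using this
  refine squeeze_zero (fun _ => norm_nonneg _) h6 ?_
  simpa using tendsto_one_div_add_atTop_nhds_zero_nat.mul_const ‖x‖

end Completion

end PVM

/-! ### Uniqueness of the spectral measure of an unbounded operator. -/

section SpectralUniqueness

open PVM
open scoped BoundedContinuousFunction

variable {K : Type*} [NormedAddCommGroup K] [InnerProductSpace ℂ K]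

/-- The function `l ↦ 1 / (l - i)`. -/
def resolventFn (l : ℝ) : ℂ := ((l : ℂ) - Complex.I)⁻¹

lemma sub_I_ne_zero (l : ℝ) : (l : ℂ) - Complex.I ≠ 0 := fun h => by
  have := congrArg Complex.im h
  simp at this

lemma norm_sub_I_sq (l : ℝ) : ‖(l : ℂ) - Complex.I‖ ^ 2 = l ^ 2 + 1 := by
  rw [← Complex.normSq_eq_norm_sq, Complex.normSq_apply]
  simp
  ring

lemma norm_resolventFn_sq (l : ℝ) : ‖resolventFn l‖ ^ 2 = (l ^ 2 + 1)⁻¹ := by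
  rw [resolventFn, norm_inv, inv_pow, norm_sub_I_sq]

lemma continuous_resolventFn : Continuous resolventFn :=
  (Complex.continuous_ofReal.sub continuous_const).inv₀ sub_I_ne_zero

lemma norm_resolventFn_le (l : ℝ) : ‖resolventFn l‖ ≤ 1 := by
  refine (sq_le_sq₀ (norm_nonneg _) zero_le_one).1 ?_
  rw [norm_resolventFn_sq, one_pow]
  exact inv_le_one_of_one_le₀ (by nlinarith [sq_nonneg l])

lemma bddMeas_resolventFn : BddMeas resolventFn :=
  ⟨continuous_resolventFn.measurable, 1, norm_resolventFn_le⟩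

lemma resolventFn_injective : Function.Injective resolventFn := fun a b h => by
  have h1 := inv_injective h
  have h2 := congrArg Complex.re h1
  simpa using h2

lemma ofReal_mul_resolventFn (l : ℝ) :
    (l : ℂ) * resolventFn l = 1 + Complex.I * resolventFn l := by
  have h : ((l : ℂ) - Complex.I) * resolventFn l = 1 := mul_inv_cancel₀ (sub_I_ne_zero l)
  linear_combination h

lemma bddMeas_one {S : Type*} [MeasurableSpace S] : BddMeas fun _ : S => (1 : ℂ) :=
  ⟨measurable_const, 1, fun _ => by simp⟩

lemma PVM.boundedFn_one {S : Type*} [MeasurableSpace S] (E : PVM S K) :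
    E.boundedFn (fun _ => 1) = 1 := by
  rw [← E.univ, ← E.boundedFn_indicator MeasurableSet.univ, Set.indicator_univ]
  rfl

variable [CompleteSpace K]

/-- The spectral measure of `f(H) x`. -/
lemma PVM.measure_boundedFn {S : Type*} [MeasurableSpace S] (E : PVM S K) {f : S → ℂ}
    (hf : BddMeas f) (x : K) :
    E.measure (E.boundedFn f x) =
      (E.measure x).withDensity fun s => ENNReal.ofReal (‖f s‖ ^ 2) := by
  obtain ⟨C, hC⟩ := hf.bdd
  refine Measure.ext fun B hB => ?_
  rw [withDensity_apply _ hB, E.measure_apply _ hB, ← boundedFn_indicator E hB, ← mul_apply_eq_comp,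
    ← E.boundedFn_mul (.indicator hB) hf, E.norm_boundedFn_sq ((BddMeas.indicator hB).mul hf),
    ofReal_integral_eq_lintegral_ofReal, ← lintegral_indicator hB]
  · congr 1 with s
    by_cases h : s ∈ B <;> simp [h]
  · refine Integrable.of_bound (C := C ^ 2)
      (((BddMeas.indicator hB).mul hf).meas.norm.pow_const 2).aestronglyMeasurable
      (Filter.Eventually.of_forall fun s => ?_)
    by_cases h : s ∈ B
    · simpa [h] using pow_le_pow_left₀ (norm_nonneg _) (hC s) 2
    · simpa [h] using sq_nonneg C
  · exact Filter.Eventually.of_forall fun s => by positivity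

variable {T : K →ₗ.[ℂ] K} {E : PVM ℝ K}

/-- The vector `r(E) y` has spectral measure `|r|² dE_y`, and `l² |r(l)|² = l² / (l² + 1) ≤ 1`. -/
lemma IsSpectralMeasure.resolvent_mem (h : IsSpectralMeasure T E) (y : K) :
    E.boundedFn resolventFn y ∈ T.domain := by
  rw [h.1, E.measure_boundedFn bddMeas_resolventFn, lintegral_withDensity_eq_lintegral_mul _
    (bddMeas_resolventFn.meas.norm.pow_const 2).ennreal_ofReal (by fun_prop)]
  refine (lintegral_mono (g := fun _ => 1) fun l => ?_).trans_lt (by simp)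
  rw [Pi.mul_apply, ← ENNReal.ofReal_mul (by positivity), norm_resolventFn_sq]
  refine ENNReal.ofReal_le_one.2 ?_
  rw [inv_mul_le_one₀ (by positivity)]
  linarith

/-- The identity says that `R = r(E)` is a right inverse of `T - i`. Only the quadratic form of `T`
is prescribed, so let `D` be the defect `T R - (1 + i R)`. Evaluating the form at `R x` gives `⟪R x,
D x⟫ = 0` for all `x`, so `R* D` has zero quadratic form and vanishes by polarization. As `|r|² > 0`
everywhere, `R*` is injective, and `D = 0`. -/
lemma IsSpectralMeasure.apply_resolvent (h : IsSpectralMeasure T E) (y : K) :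
    T ⟨E.boundedFn resolventFn y, h.resolvent_mem y⟩ =
      y + Complex.I • E.boundedFn resolventFn y := by
  set R := E.boundedFn resolventFn with hR
  have hr := bddMeas_resolventFn
  have hs : BddMeas fun l => 1 + Complex.I * resolventFn l := bddMeas_one.add (hr.const_mul _)
  have hS : E.boundedFn (fun l => 1 + Complex.I * resolventFn l) = 1 + Complex.I • R := by
    rw [E.boundedFn_add bddMeas_one (hr.const_mul _), E.boundedFn_one, E.boundedFn_const_mul _ hr]
  let R' : K →ₗ[ℂ] T.domain := (R : K →ₗ[ℂ] K).codRestrict T.domain h.resolvent_mem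
  let D : K →ₗ[ℂ] K := T.toFun ∘ₗ R' - ((1 + Complex.I • R : K →L[ℂ] K) : K →ₗ[ℂ] K)
  have hD : ∀ x, ⟪R x, D x⟫_ℂ = 0 := fun x => by
    have h1 : ⟪R x, T (R' x)⟫_ℂ = ∫ l, (l : ℂ) ∂E.measure (R x) := h.2 (R' x)
    have h2 : ⟪R x, (1 + Complex.I • R) x⟫_ℂ = ∫ l, (l : ℂ) ∂E.measure (R x) := by
      rw [← hS, hR, ← ContinuousLinearMap.adjoint_inner_right, E.adjoint_boundedFn hr,
        ← mul_apply_eq_comp, ← E.boundedFn_mul hr.conj hs, E.isIntegral_boundedFn (hr.conj.mul hs),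
        E.measure_boundedFn hr, integral_withDensity_eq_integral_toReal_smul
          (hr.meas.norm.pow_const 2).ennreal_ofReal (by simp)]
      congr 1 with l
      beta_reduce
      rw [← ofReal_mul_resolventFn l, ENNReal.toReal_ofReal (by positivity),
        ← Complex.normSq_eq_norm_sq, Complex.real_smul, Complex.normSq_eq_conj_mul_self]
      ring
    have h3 : D x = T (R' x) - (1 + Complex.I • R) x := rfl
    rw [h3, inner_sub_right, h1, h2, sub_self]
  have hRD : (ContinuousLinearMap.adjoint R : K →ₗ[ℂ] K) ∘ₗ D = 0 := by
    refine (inner_map_self_eq_zero _).1 fun x => ?_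
    rw [← inner_conj_symm]
    change starRingEnd ℂ ⟪x, ContinuousLinearMap.adjoint R (D x)⟫_ℂ = 0
    rw [ContinuousLinearMap.adjoint_inner_right, hD, map_zero]
  have hinj : ∀ z, ContinuousLinearMap.adjoint R z = 0 → z = 0 := fun z hz => by
    rw [hR, E.adjoint_boundedFn hr] at hz
    have h1 := E.norm_boundedFn_sq hr.conj z
    rw [hz, norm_zero, zero_pow two_ne_zero] at h1
    simp only [RCLike.norm_conj, norm_resolventFn_sq] at h1
    have h2 := (integral_eq_zero_iff_of_nonneg (fun l => by positivity)
      (Integrable.of_bound (C := 1) (by fun_prop) (Filter.Eventually.of_forall fun l => by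
        rw [Real.norm_of_nonneg (by positivity)]
        exact inv_le_one_of_one_le₀ (by nlinarith [sq_nonneg l])))).1 h1.symm
    have h3 : ∀ᵐ _ ∂E.measure z, False := by
      filter_upwards [h2] with l hl
      have : (0 : ℝ) < (l ^ 2 + 1)⁻¹ := by positivity
      exact this.ne' hl
    have h4 : E.measure z = 0 := by
      rw [← Measure.measure_univ_eq_zero]
      simpa [ae_iff] using h3
    have h5 := E.measure_real_univ z
    rw [h4] at h5
    simpa using h5.symm
  have hD0 : D y = 0 := hinj _ (LinearMap.congr_fun hRD y)
  exact sub_eq_zero.1 hD0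

/-- The difference `v` of the two resolvents at `y` satisfies `T v = i v`. Since the quadratic form
of `T` is real, `‖v‖² = 0`. -/
lemma IsSpectralMeasure.resolvent_unique {E' : PVM ℝ K} (h : IsSpectralMeasure T E)
    (h' : IsSpectralMeasure T E') : E.boundedFn resolventFn = E'.boundedFn resolventFn := by
  ext y
  set v : T.domain := ⟨_, h.resolvent_mem y⟩ - ⟨_, h'.resolvent_mem y⟩ with hv
  have h1 : T v = Complex.I • (v : K) := by
    rw [hv, LinearPMap.map_sub, h.apply_resolvent, h'.apply_resolvent]
    simp only [Submodule.coe_sub, smul_sub]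
    abel
  have h2 := h.2 v
  have h3 : (∫ l : ℝ, (l : ℂ) ∂E.measure (v : K)) = ((∫ l : ℝ, l ∂E.measure (v : K) : ℝ) : ℂ) :=
    integral_complex_ofReal
  rw [h1, inner_smul_right, inner_self_eq_norm_sq_to_K, h3] at h2
  have h4 := congrArg Complex.im h2
  rw [Complex.ofReal_im] at h4
  have h5 : ‖(v : K)‖ = 0 := by
    simpa [← Complex.ofReal_pow] using h4
  exact sub_eq_zero.1 (norm_eq_zero.1 h5)

/-- The bounded continuous functions on which the two calculi agree form a star subalgebra. It
contains the resolvent function, which is injective and hence separates points, so the scalar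
spectral measures coincide. -/
lemma IsSpectralMeasure.proj_unique {E' : PVM ℝ K} (h : IsSpectralMeasure T E)
    (h' : IsSpectralMeasure T E') {B : Set ℝ} (hB : MeasurableSet B) : E.proj B = E'.proj B := by
  have hb : ∀ f : ℝ →ᵇ ℂ, BddMeas f := fun f =>
    ⟨f.continuous.measurable, ‖f‖, f.norm_coe_le_norm⟩
  let A : StarSubalgebra ℂ (ℝ →ᵇ ℂ) :=
    { carrier := {f | E.boundedFn f = E'.boundedFn f}
      mul_mem' := fun {f g} hf hg => by
        have h1 := E.boundedFn_mul (hb f) (hb g)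
        have h2 := E'.boundedFn_mul (hb f) (hb g)
        rw [Set.mem_ofPred_eq] at hf hg
        rw [hf, hg, ← h2] at h1
        exact h1
      add_mem' := fun {f g} hf hg => by
        have h1 := E.boundedFn_add (hb f) (hb g)
        have h2 := E'.boundedFn_add (hb f) (hb g)
        rw [Set.mem_ofPred_eq] at hf hg
        rw [hf, hg, ← h2] at h1
        exact h1
      algebraMap_mem' := fun c => by
        have h1 := E.boundedFn_const_mul c bddMeas_one
        have h2 := E'.boundedFn_const_mul c bddMeas_one
        rw [E.boundedFn_one, ← E'.boundedFn_one, ← h2] at h1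
        simp only [mul_one] at h1
        exact h1
      star_mem' := fun {f} hf => by
        have h1 := E.adjoint_boundedFn (hb f)
        have h2 := E'.adjoint_boundedFn (hb f)
        rw [Set.mem_ofPred_eq] at hf
        rw [hf, h2] at h1
        exact h1.symm }
  let r : ℝ →ᵇ ℂ := BoundedContinuousFunction.ofNormedAddCommGroup resolventFn
    continuous_resolventFn 1 norm_resolventFn_le
  have hr : r ∈ A := h.resolvent_unique h'
  refine ext_of_inner_self fun x => ?_
  rw [E.inner_proj_self x hB, E'.inner_proj_self x hB]
  congr 2
  refine ext_of_forall_mem_subalgebra_integral_eq_of_polish (𝕜 := ℂ) (A := A) ?_ fun g hg => ?_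
  · intro a b hab
    exact ⟨_, ⟨_, ⟨r, hr, rfl⟩, rfl⟩, fun he => hab (resolventFn_injective he)⟩
  · rw [← E.isIntegral_boundedFn (hb g) x, ← E'.isIntegral_boundedFn (hb g) x]
    exact congrArg (fun T : K →L[ℂ] K => ⟪x, T x⟫_ℂ) hg

end SpectralUniqueness

/-! ### Spectral measures of unitarily equivalent operators. -/

section Covariance

open PVM

variable {K : Type*} [NormedAddCommGroup K] [InnerProductSpace ℂ K]

/-- The image of a projection-valued measure under a unitary operator. -/
def PVM.conj {S : Type*} [MeasurableSpace S] (E : PVM S K) (u : K ≃ₗᵢ[ℂ] K) : PVM S K where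
  proj B := (u.toContinuousLinearEquiv : K →L[ℂ] K) ∘L E.proj B ∘L
    (u.symm.toContinuousLinearEquiv : K →L[ℂ] K)
  symm B hB x y := by
    have h1 : ∀ a b, ⟪u a, b⟫_ℂ = ⟪a, u.symm b⟫_ℂ := fun a b => by
      rw [← u.inner_map_map a (u.symm b), u.apply_symm_apply]
    have h2 : ∀ a b, ⟪u.symm a, b⟫_ℂ = ⟪a, u b⟫_ℂ := fun a b => by
      rw [← u.inner_map_map (u.symm a) b, u.apply_symm_apply]
    change ⟪u (E.proj B (u.symm x)), y⟫_ℂ = ⟪x, u (E.proj B (u.symm y))⟫_ℂ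
    rw [h1, E.symm B hB, h2]
  univ := by
    ext x
    change u (E.proj Set.univ (u.symm x)) = x
    rw [E.univ]
    exact u.apply_symm_apply x
  inter B C hB hC := by
    ext x
    change u (E.proj (B ∩ C) (u.symm x)) = u (E.proj B (u.symm (u (E.proj C (u.symm x)))))
    rw [E.inter B C hB hC, u.symm_apply_apply]
    rfl
  iUnion B hB hd x y := by
    have h1 : ∀ a b, ⟪a, u b⟫_ℂ = ⟪u.symm a, b⟫_ℂ := fun a b => by
      rw [← u.inner_map_map (u.symm a) b, u.apply_symm_apply]
    have := E.iUnion B hB hd (u.symm x) (u.symm y)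
    simp only [← h1] at this
    exact this

lemma PVM.measure_conj {S : Type*} [MeasurableSpace S] (E : PVM S K) (u : K ≃ₗᵢ[ℂ] K) (x : K) :
    (E.conj u).measure x = E.measure (u.symm x) := by
  refine Measure.ext fun B hB => ?_
  rw [measure_apply _ _ hB, measure_apply _ _ hB]
  congr 2
  exact u.norm_map _

variable {T T' : K →ₗ.[ℂ] K} {u : K ≃ₗᵢ[ℂ] K}

lemma IsSpectralMeasure.conj {E : PVM ℝ K} (h : IsSpectralMeasure T E)
    (hu : ∀ f g, (f, g) ∈ T.graph ↔ (u f, u g) ∈ T'.graph) :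
    IsSpectralMeasure T' (E.conj u) := by
  have hd : ∀ x, x ∈ T'.domain ↔ u.symm x ∈ T.domain := fun x => by
    rw [LinearPMap.mem_domain_iff, LinearPMap.mem_domain_iff]
    constructor
    · rintro ⟨y, hy⟩
      refine ⟨u.symm y, (hu _ _).2 ?_⟩
      rwa [u.apply_symm_apply, u.apply_symm_apply]
    · rintro ⟨y, hy⟩
      have := (hu _ _).1 hy
      rw [u.apply_symm_apply] at this
      exact ⟨_, this⟩
  refine ⟨fun x => ?_, fun x => ?_⟩
  · rw [hd, h.1, E.measure_conj]
  · have hx := (hd x).1 x.2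
    have h1 := (hu _ _).1 (T.mem_graph ⟨_, hx⟩)
    simp only [u.apply_symm_apply] at h1
    have h2 : T' x = u (T ⟨_, hx⟩) := LinearPMap.mem_graph_snd_inj _ (T'.mem_graph x) h1 rfl
    rw [E.measure_conj, ← h.2 ⟨_, hx⟩, h2, ← u.inner_map_map (u.symm x), u.apply_symm_apply]

variable [CompleteSpace K]

/-- `spectralMeasure` is a choice, so equivariance is uniqueness applied to the conjugated measure.
If one operator has no spectral measure, neither has the other, and the default values `0` and `1`
of the projections commute with `u`. -/
lemma spectralMeasure_conj (hu : ∀ f g, (f, g) ∈ T.graph ↔ (u f, u g) ∈ T'.graph) {B : Set ℝ}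
    (hB : MeasurableSet B) (x : K) :
    (spectralMeasure T').proj B (u x) = u ((spectralMeasure T).proj B x) := by
  by_cases h : ∃ E, IsSpectralMeasure T E
  · have h' : ∃ E, IsSpectralMeasure T' E := ⟨_, h.choose_spec.conj hu⟩
    have h1 : IsSpectralMeasure T (spectralMeasure T) := by
      rw [spectralMeasure, dif_pos h]
      exact h.choose_spec
    have h2 : IsSpectralMeasure T' (spectralMeasure T') := by
      rw [spectralMeasure, dif_pos h']
      exact h'.choose_spec
    rw [h2.proj_unique (h1.conj hu) hB]
    change u ((spectralMeasure T).proj B (u.symm (u x))) = _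
    rw [u.symm_apply_apply]
  · have h' : ¬∃ E, IsSpectralMeasure T' E := by
      rintro ⟨E, hE⟩
      refine h ⟨_, hE.conj (u := u.symm) fun f g => ?_⟩
      rw [hu, u.apply_symm_apply, u.apply_symm_apply]
    rw [spectralMeasure, spectralMeasure, dif_neg h, dif_neg h']
    by_cases h0 : (0 : ℝ) ∈ B <;> simp [PVM.dirac, h0]

end Covariance

/-! ### Decomposition of the one-particle space along unit cells. -/

section Cells

variable {d : ℕ} (X : Type) [TopologicalSpace X] [MeasurableSpace X] [PosSpace d X]

/-- The cells are disjoint, and a compact set meets only finitely many of them. -/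
class LocallyFiniteCells : Prop where
  disjoint : Pairwise (Function.onFun Disjoint (PosSpace.cell (X := X)))
  finite_cover : ∀ K : Set X, IsCompact K → ∃ s : Finset (Fin d → ℤ),
    K ⊆ ⋃ a ∈ s, PosSpace.cell (X := X) a

instance (d : ℕ) : LocallyFiniteCells (Fin d → ℤ) where
  disjoint a b hab := by simpa [Function.onFun, PosSpace.cell] using hab
  finite_cover K hK := by
    have hf : K.Finite := isCompact_iff_finite.1 hK
    refine ⟨hf.toFinset, fun x hx => ?_⟩
    exact Set.mem_iUnion₂.2 ⟨x, hf.mem_toFinset.2 hx, rfl⟩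

lemma eq_floor_of_mem_cell {d : ℕ} {a : Fin d → ℤ} {x : EuclideanSpace ℝ (Fin d)}
    (hx : x ∈ PosSpace.cell (X := EuclideanSpace ℝ (Fin d)) a) (j : Fin d) :
    a j = ⌊x j + 1 / 2⌋ := by
  have h : (a j : ℝ) - 1 / 2 ≤ x j ∧ x j < a j + 1 / 2 := hx j
  symm
  rw [Int.floor_eq_iff]
  constructor <;> linarith [h.1, h.2]

instance (d : ℕ) : LocallyFiniteCells (EuclideanSpace ℝ (Fin d)) where
  disjoint a b hab := by
    refine Set.disjoint_left.2 fun x hx hx' => hab (funext fun j => ?_)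
    rw [eq_floor_of_mem_cell hx j, eq_floor_of_mem_cell hx' j]
  finite_cover K hK := by
    obtain ⟨C, hC⟩ := hK.isBounded.exists_norm_le
    refine ⟨Fintype.piFinset fun _ => Finset.Icc ⌊-C + 1 / 2⌋ ⌊C + 1 / 2⌋, fun x hx => ?_⟩
    obtain ⟨a, ha⟩ := Set.mem_iUnion.1
      ((PosSpace.iUnion_cell (X := EuclideanSpace ℝ (Fin d))).symm ▸ Set.mem_univ x)
    refine Set.mem_iUnion₂.2 ⟨a, Fintype.mem_piFinset.2 fun j => ?_, ha⟩
    have h1 := (PiLp.norm_apply_le x j).trans (hC x hx)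
    rw [Real.norm_eq_abs, abs_le] at h1
    rw [eq_floor_of_mem_cell ha j, Finset.mem_Icc]
    exact ⟨Int.floor_mono (by linarith), Int.floor_mono (by linarith)⟩

variable {X}

lemma cut_coeFn (a : Fin d → ℤ) (f : Hilb X) :
    ((cut a f : Hc X) : Hilb X) =ᵐ[PosSpace.vol] (PosSpace.cell a).indicator f :=
  ((Lp.memLp f).indicator (PosSpace.measurableSet_cell (X := X) a)).coeFn_toLp

lemma inner_cut_right (a : Fin d → ℤ) (f g : Hilb X) :
    ⟪f, (cut a g : Hc X)⟫_ℂ = ∫ x in PosSpace.cell a, ⟪f x, g x⟫_ℂ ∂PosSpace.vol := by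
  rw [L2.inner_def, ← integral_indicator (PosSpace.measurableSet_cell a)]
  refine integral_congr_ae ?_
  filter_upwards [cut_coeFn a g] with x hx
  rw [hx]
  by_cases h : x ∈ PosSpace.cell a <;> simp [h]

lemma inner_cut_left (a : Fin d → ℤ) (f g : Hilb X) :
    ⟪((cut a f : Hc X) : Hilb X), g⟫_ℂ = ⟪f, (cut a g : Hc X)⟫_ℂ := by
  rw [← inner_conj_symm, inner_cut_right, inner_cut_right, ← integral_conj]
  simp only [inner_conj_symm]

lemma cut_cut (a : Fin d → ℤ) (f : Hilb X) : cut a (cut a f : Hc X) = cut a f := by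
  refine Subtype.ext (Lp.ext ?_)
  filter_upwards [cut_coeFn a (cut a f : Hc X), cut_coeFn a f] with x h1 h2
  rw [h1, h2]
  by_cases h : x ∈ PosSpace.cell a <;> simp [h, h2]

lemma cut_cut_of_ne [LocallyFiniteCells X] {a b : Fin d → ℤ} (hab : a ≠ b) (f : Hilb X) :
    (cut a ((cut b f : Hc X) : Hilb X) : Hc X) = 0 := by
  refine Subtype.ext (Lp.ext ?_)
  filter_upwards [cut_coeFn a (cut b f : Hc X), cut_coeFn b f,
    Lp.coeFn_zero ℂ 2 (PosSpace.vol (X := X))] with x h1 h2 h3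
  refine h1.trans (Eq.trans ?_ h3.symm)
  by_cases h : x ∈ PosSpace.cell a
  · have hb : x ∉ PosSpace.cell b :=
      Set.disjoint_left.1 (LocallyFiniteCells.disjoint (X := X) hab) h
    simp [h, h2, hb]
  · simp [h]

lemma hasSum_inner_cut [LocallyFiniteCells X] (f g : Hilb X) :
    HasSum (fun a => ⟪f, (cut a g : Hc X)⟫_ℂ) ⟪f, g⟫_ℂ := by
  simp only [inner_cut_right]
  rw [L2.inner_def, ← setIntegral_univ, ← PosSpace.iUnion_cell (X := X)]
  exact hasSum_integral_iUnion PosSpace.measurableSet_cell LocallyFiniteCells.disjoint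
    (L2.integrable_inner f g).integrableOn

lemma inner_cut_self (a : Fin d → ℤ) (f : Hilb X) :
    ⟪f, (cut a f : Hc X)⟫_ℂ = ((‖((cut a f : Hc X) : Hilb X)‖ ^ 2 : ℝ) : ℂ) := by
  rw [← cut_cut, ← inner_cut_left, cut_cut, inner_self_eq_norm_sq_to_K]
  norm_cast

lemma tsum_enorm_cut_sq [LocallyFiniteCells X] (f : Hilb X) :
    ∑' a, ‖((cut a f : Hc X) : Hilb X)‖ₑ ^ 2 = ‖f‖ₑ ^ 2 := by
  have h := hasSum_inner_cut f f
  simp only [inner_cut_self] at h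
  rw [inner_self_eq_norm_sq_to_K] at h
  have h1 : HasSum (fun a => ‖((cut a f : Hc X) : Hilb X)‖ ^ 2) (‖f‖ ^ 2) := by
    refine Complex.hasSum_ofReal.1 ?_
    convert h using 1
    norm_cast
  have h2 := ENNReal.ofReal_tsum_of_nonneg (fun a => by positivity) h1.summable
  rw [h1.tsum_eq] at h2
  simp only [ENNReal.ofReal_pow (norm_nonneg _), ofReal_norm] at h2
  exact h2.symm

lemma norm_cut_le (a : Fin d → ℤ) (f : Hilb X) : ‖((cut a f : Hc X) : Hilb X)‖ ≤ ‖f‖ :=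
  PVM.norm_le_of_symm_of_idem (W := fun f : Hilb X => ((cut a f : Hc X) : Hilb X))
    (inner_cut_left a) (fun f g => by simp only [cut_cut]) f

/-- Multiplication by the characteristic function of a cell as a bounded operator. -/
def chi (a : Fin d → ℤ) : Hilb X →L[ℂ] Hilb X :=
  ((Hc X).subtype ∘ₗ cut a).mkContinuous 1 fun f => by
    rw [one_mul]
    exact norm_cut_le a f

lemma chi_apply (a : Fin d → ℤ) (f : Hilb X) : chi a f = (cut a f : Hc X) := rfl

/-- The support is compact and so meets finitely many cells. This is what lets cellwise bounds
control a random operator on all of `Hc`. -/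
lemma Hc_eq_sum_cut [LocallyFiniteCells X] (φ : Hc X) :
    ∃ s : Finset (Fin d → ℤ), (φ = ∑ a ∈ s, cut a (φ : Hilb X)) ∧
      ∀ a ∉ s, cut a (φ : Hilb X) = 0 := by
  obtain ⟨K, hK, hφ⟩ := φ.2
  obtain ⟨s, hs⟩ := LocallyFiniteCells.finite_cover (d := d) (X := X) K hK
  have h0 : ∀ a ∉ s, cut a (φ : Hilb X) = 0 := fun a ha => by
    refine Subtype.ext (Lp.ext ?_)
    filter_upwards [hφ, cut_coeFn a (φ : Hilb X), Lp.coeFn_zero ℂ 2 (PosSpace.vol (X := X))]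
      with x h1 h2 h3
    refine h2.trans (Eq.trans ?_ h3.symm)
    by_cases h : x ∈ PosSpace.cell a
    · rw [Set.indicator_of_mem h, h1 fun hxK => ?_]
      · rfl
      obtain ⟨b, hb, hxb⟩ := Set.mem_iUnion₂.1 (hs hxK)
      have hab : a ≠ b := fun hab => ha (hab ▸ hb)
      exact Set.disjoint_left.1 (LocallyFiniteCells.disjoint (X := X) hab) h hxb
    · simp [h]
  refine ⟨s, Subtype.ext (ext_inner_left ℂ fun f => ?_), h0⟩
  refine (hasSum_inner_cut (d := d) f (φ : Hilb X)).unique ?_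
  rw [AddSubmonoidClass.coe_finsetSum, inner_sum]
  exact hasSum_sum_of_ne_finset_zero fun a ha => by rw [h0 a ha]; simp

lemma ext_of_inner_Hc {f g : Hilb X} (h : ∀ φ : Hc X, ⟪f, (φ : Hilb X)⟫_ℂ = ⟪g, (φ : Hilb X)⟫_ℂ) :
    f = g :=
  (dense_Hc X).eq_of_inner_left ℂ fun φ hφ => h ⟨φ, hφ⟩

end Cells

/-! ### Hilbert-Schmidt norms of blocks, and formal adjoints. -/

section HilbertSchmidt

variable {d : ℕ} {X : Type} [TopologicalSpace X] [MeasurableSpace X] [PosSpace d X]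

lemma tsum_enorm_inner_sq (v : Hilb X) :
    ∑' j, ‖⟪(basis X j : Hilb X), v⟫_ℂ‖ₑ ^ 2 = ‖v‖ₑ ^ 2 := by
  have h := (basis X).hasSum_inner_mul_inner v v
  have h1 : HasSum (fun j => ‖⟪(basis X j : Hilb X), v⟫_ℂ‖ ^ 2) (‖v‖ ^ 2) := by
    refine Complex.hasSum_ofReal.1 ?_
    rw [inner_self_eq_norm_sq_to_K] at h
    rw [Complex.ofReal_pow]
    refine h.congr_fun fun j => ?_
    rw [← inner_conj_symm v, ← Complex.normSq_eq_conj_mul_self, Complex.normSq_eq_norm_sq]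
  have h2 := ENNReal.ofReal_tsum_of_nonneg (fun a => by positivity) h1.summable
  rw [h1.tsum_eq] at h2
  simp only [ENNReal.ofReal_pow (norm_nonneg _), ofReal_norm] at h2
  exact h2.symm

/-- The Hilbert-Schmidt norms of an operator and of its adjoint agree. -/
lemma tsum_enorm_adjoint {S S' : Hilb X → Hilb X} (h : ∀ x y, ⟪S x, y⟫_ℂ = ⟪x, S' y⟫_ℂ) :
    ∑' i, ‖S (basis X i)‖ₑ ^ 2 = ∑' i, ‖S' (basis X i)‖ₑ ^ 2 := by
  simp only [← tsum_enorm_inner_sq (S _), ← tsum_enorm_inner_sq (S' _)]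
  rw [ENNReal.tsum_comm]
  refine tsum_congr fun j => tsum_congr fun i => ?_
  rw [← h, ← inner_conj_symm, RCLike.enorm_conj]

/-- The Hilbert-Schmidt norm does not depend on the orthonormal basis. -/
lemma tsum_enorm_unitary {S S' : Hilb X → Hilb X} (h : ∀ x y, ⟪S x, y⟫_ℂ = ⟪x, S' y⟫_ℂ)
    (u : Hilb X ≃ₗᵢ[ℂ] Hilb X) :
    ∑' i, ‖S (u (basis X i))‖ₑ ^ 2 = ∑' i, ‖S (basis X i)‖ₑ ^ 2 := by
  rw [tsum_enorm_adjoint h, tsum_enorm_adjoint (S := fun x => S (u x))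
    (S' := fun y => u.symm (S' y)) fun x y => by
      rw [h, ← u.inner_map_map x, u.apply_symm_apply]]
  refine tsum_congr fun i => ?_
  congr 1
  rw [← ofReal_norm, ← ofReal_norm, u.symm.norm_map]

/-- The operator norm is at most the Hilbert-Schmidt norm: expand `S f` in the basis, move `S` to
the adjoint and apply Cauchy-Schwarz to each coefficient. -/
lemma enorm_sq_le_tsum {S S' : Hilb X → Hilb X} (h : ∀ x y, ⟪S x, y⟫_ℂ = ⟪x, S' y⟫_ℂ)
    (f : Hilb X) : ‖S f‖ₑ ^ 2 ≤ (∑' i, ‖S (basis X i)‖ₑ ^ 2) * ‖f‖ₑ ^ 2 := by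
  rw [tsum_enorm_adjoint h, ← tsum_enorm_inner_sq (S f), ← ENNReal.tsum_mul_right]
  refine ENNReal.tsum_le_tsum fun j => ?_
  rw [← mul_pow, ← inner_conj_symm, RCLike.enorm_conj, h, ← inner_conj_symm, RCLike.enorm_conj]
  gcongr
  rw [← ofReal_norm, ← ofReal_norm, ← ofReal_norm, ← ENNReal.ofReal_mul (norm_nonneg _)]
  exact ENNReal.ofReal_le_ofReal (norm_inner_le_norm _ _)

/-- `T χ_b` is bounded for all `b`. -/
def RightBounded (T : Hc X →ₗ[ℂ] Hilb X) : Prop :=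
  ∀ b, ∃ C : ℝ, ∀ f : Hilb X, ‖T (cut b f)‖ ≤ C * ‖f‖

/-- `χ_a T` is bounded for all `a`. -/
def LeftBounded (T : Hc X →ₗ[ℂ] Hilb X) : Prop :=
  ∀ a : Fin d → ℤ, ∃ C : ℝ, ∀ φ : Hc X, ‖(cut a (T φ) : Hc X)‖ ≤ C * ‖φ‖

lemma RightBounded.exists_adjoint {T : Hc X →ₗ[ℂ] Hilb X} (h : RightBounded T)
    (b : Fin d → ℤ) : ∃ S' : Hilb X → Hilb X, ∀ x y, ⟪T (cut b x), y⟫_ℂ = ⟪x, S' y⟫_ℂ := by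
  obtain ⟨C, hC⟩ := h b
  refine ⟨ContinuousLinearMap.adjoint ((T ∘ₗ cut b).mkContinuous C hC), fun x y => ?_⟩
  rw [ContinuousLinearMap.adjoint_inner_right]
  rfl

lemma RightBounded.exists_adjoint_block {T : Hc X →ₗ[ℂ] Hilb X} (h : RightBounded T)
    (a b : Fin d → ℤ) : ∃ S' : Hilb X → Hilb X, ∀ x y,
      ⟪((cut a (T (cut b x)) : Hc X) : Hilb X), y⟫_ℂ = ⟪x, S' y⟫_ℂ := by
  obtain ⟨R, hR⟩ := h.exists_adjoint b
  exact ⟨fun y => R (cut a y : Hc X), fun x y => by rw [inner_cut_left, hR]⟩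

/-- The squared Hilbert-Schmidt norm of `χ_a T χ_b`. -/
def blockSq (T : Hc X →ₗ[ℂ] Hilb X) (a b : Fin d → ℤ) : ℝ≥0∞ :=
  ∑' i, ‖((cut a (T (cut b (basis X i))) : Hc X) : Hilb X)‖ₑ ^ 2

/-- The squared Hilbert-Schmidt norm of `T χ_b`. -/
def colSq (T : Hc X →ₗ[ℂ] Hilb X) (b : Fin d → ℤ) : ℝ≥0∞ :=
  ∑' i, ‖T (cut b (basis X i))‖ₑ ^ 2

lemma tsum_blockSq [LocallyFiniteCells X] (T : Hc X →ₗ[ℂ] Hilb X) (b : Fin d → ℤ) :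
    ∑' a, blockSq T a b = colSq T b := by
  simp only [blockSq, colSq]
  rw [ENNReal.tsum_comm]
  exact tsum_congr fun i => tsum_enorm_cut_sq _

/-- `T'` is a formal adjoint of `T` on the functions with compact support. -/
def IsFormalAdjoint (T' T : Hc X →ₗ[ℂ] Hilb X) : Prop :=
  ∀ φ ψ : Hc X, ⟪T' φ, (ψ : Hilb X)⟫_ℂ = ⟪(φ : Hilb X), T ψ⟫_ℂ

lemma IsFormalAdjoint.flip {T' T : Hc X →ₗ[ℂ] Hilb X} (h : IsFormalAdjoint T' T) :
    IsFormalAdjoint T T' := fun φ ψ => by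
  rw [← inner_conj_symm, ← h, inner_conj_symm]

lemma IsFormalAdjoint.blockSq_eq {T' T : Hc X →ₗ[ℂ] Hilb X} (h : IsFormalAdjoint T' T)
    (a b : Fin d → ℤ) : blockSq T' a b = blockSq T b a :=
  tsum_enorm_adjoint (S := fun x => ((cut a (T' (cut b x)) : Hc X) : Hilb X))
    (S' := fun y => ((cut b (T (cut a y)) : Hc X) : Hilb X)) fun x y => by
      rw [inner_cut_left, h, inner_cut_left]

/-- A formal adjoint on `Hc` witnesses that `Hc` lies in the domain of the adjoint, and density of
`Hc` forces the values. Hence `dag` can be computed by exhibiting a formal adjoint. -/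
lemma IsFormalAdjoint.dag_eq {T' T : Hc X →ₗ[ℂ] Hilb X} (h : IsFormalAdjoint T' T) :
    dag T = T' := by
  have hd : Hc X ≤ (toPMap T).adjoint.domain := fun φ hφ =>
    LinearPMap.mem_adjoint_domain_of_exists φ ⟨T' ⟨φ, hφ⟩, fun ψ => h ⟨φ, hφ⟩ ψ⟩
  rw [dag, dif_pos hd]
  ext1 φ
  exact LinearPMap.adjoint_apply_eq (T := toPMap T) (dense_Hc X) _ fun ψ => h φ ψ

/-- A vector `φ` of `Hc` lives on finitely many cells, so `ψ ↦ ⟪φ, T ψ⟫` sees only finitely many of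
the bounded operators `χ_a T` and is continuous. -/
lemma LeftBounded.isFormalAdjoint_dag [LocallyFiniteCells X] {T : Hc X →ₗ[ℂ] Hilb X}
    (h : LeftBounded T) : IsFormalAdjoint (dag T) T := by
  have hd : Hc X ≤ (toPMap T).adjoint.domain := fun φ hφ => by
    rw [LinearPMap.mem_adjoint_domain_iff]
    obtain ⟨s, hs, -⟩ := Hc_eq_sum_cut (X := X) ⟨φ, hφ⟩
    choose C hC using h
    refine ((innerₛₗ ℂ φ ∘ₗ T).mkContinuous (∑ a ∈ s, ‖φ‖ * C a) fun ψ => ?_).continuous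
    have h1 : ⟪φ, T ψ⟫_ℂ = ∑ a ∈ s, ⟪φ, (cut a (T ψ) : Hc X)⟫_ℂ := by
      have h2 : φ = ∑ a ∈ s, ((cut a φ : Hc X) : Hilb X) := by
        conv_lhs => rw [show φ = ((⟨φ, hφ⟩ : Hc X) : Hilb X) from rfl, hs]
        rw [AddSubmonoidClass.coe_finsetSum]
      conv_lhs => rw [h2, sum_inner]
      simp only [inner_cut_left]
    change ‖⟪φ, T ψ⟫_ℂ‖ ≤ _
    rw [h1, Finset.sum_mul]
    refine (norm_sum_le _ _).trans (Finset.sum_le_sum fun a _ => ?_)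
    refine (norm_inner_le_norm _ _).trans ?_
    rw [mul_assoc]
    exact mul_le_mul_of_nonneg_left (hC a ψ) (norm_nonneg _)
  intro φ ψ
  rw [dag, dif_pos hd]
  exact LinearPMap.adjoint_isFormalAdjoint (T := toPMap T) (dense_Hc X) ⟨φ, hd φ.2⟩ ψ

/-- `T' χ_b` is the adjoint of `χ_b T`, so it satisfies the same bound. -/
lemma IsFormalAdjoint.rightBounded {T' T : Hc X →ₗ[ℂ] Hilb X} (h : IsFormalAdjoint T' T)
    (hT : LeftBounded T) : RightBounded T' := fun b => by
  obtain ⟨C, hC⟩ := hT b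
  refine ⟨C, fun f => ?_⟩
  have h1 : ∀ ψ : Hc X, ‖⟪T' (cut b f), (ψ : Hilb X)⟫_ℂ‖ ≤ C * ‖f‖ * ‖(ψ : Hilb X)‖ := fun ψ => by
    rw [h, inner_cut_left]
    refine (norm_inner_le_norm _ _).trans ?_
    have := mul_le_mul_of_nonneg_left (hC ψ) (norm_nonneg f)
    calc _ ≤ ‖f‖ * (C * ‖ψ‖) := this
      _ = _ := by rw [mul_left_comm, mul_assoc]; rfl
  have h2 : ∀ g : Hilb X, ‖⟪T' (cut b f), g⟫_ℂ‖ ≤ C * ‖f‖ * ‖g‖ := fun g =>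
    (dense_Hc X).induction (fun g hg => h1 ⟨g, hg⟩)
      (isClosed_le (by fun_prop) (by fun_prop)) g
  have h3 := h2 (T' (cut b f))
  rw [inner_self_eq_norm_sq_to_K] at h3
  have h4 : ‖T' (cut b f)‖ * ‖T' (cut b f)‖ ≤ C * ‖f‖ * ‖T' (cut b f)‖ := by
    simpa [sq] using h3
  -- The constant `C` carries no sign assumption, so when `T' (cut b f) = 0` the inequality `0 ≤ C
  -- ‖f‖` has to be extracted from `h2` itself.
  rcases (norm_nonneg (T' (cut b f))).eq_or_lt with h5 | h5
  · rw [← h5]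
    rcases (norm_nonneg f).eq_or_lt with h6 | h6
    · rw [← h6, mul_zero]
    · have := (norm_nonneg _).trans (h2 f)
      exact nonneg_of_mul_nonneg_left this h6
  · exact le_of_mul_le_mul_right h4 h5

end HilbertSchmidt

/-! ### Row sums and translation of blocks. -/

section Blocks

variable {d : ℕ} {X : Type} [TopologicalSpace X] [MeasurableSpace X] [PosSpace d X]

/-- Split `χ_a T φ` into the vectors `χ_a T χ_b φ`, bound each block by its Hilbert-Schmidt norm and
apply Cauchy-Schwarz over `b`. -/
lemma RightBounded.leftBounded [LocallyFiniteCells X] {T : Hc X →ₗ[ℂ] Hilb X}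
    (h : RightBounded T) (hrow : ∀ a : Fin d → ℤ, ∑' b, blockSq T a b < ∞) : LeftBounded T := by
  intro a
  have hfin : ∀ b, blockSq T a b ≠ ∞ := fun b =>
    ((ENNReal.le_tsum b).trans_lt (hrow a)).ne
  refine ⟨√(∑' b, blockSq T a b).toReal, fun φ => ?_⟩
  obtain ⟨s, hs, -⟩ := Hc_eq_sum_cut φ
  have h1 : ∀ b, ‖((cut a (T (cut b (φ : Hilb X))) : Hc X) : Hilb X)‖ ≤
      √(blockSq T a b).toReal * ‖((cut b (φ : Hilb X) : Hc X) : Hilb X)‖ := fun b => by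
    obtain ⟨S', hS'⟩ := h.exists_adjoint_block a b
    have h2 := enorm_sq_le_tsum hS' ((cut b (φ : Hilb X) : Hc X) : Hilb X)
    rw [cut_cut] at h2
    have h3 := ENNReal.toReal_mono (ENNReal.mul_ne_top (hfin b) (by simp)) h2
    rw [ENNReal.toReal_mul, ENNReal.toReal_pow, ENNReal.toReal_pow, toReal_enorm,
      toReal_enorm] at h3
    refine (sq_le_sq₀ (norm_nonneg _) (by positivity)).1 ?_
    rw [mul_pow, Real.sq_sqrt ENNReal.toReal_nonneg]
    exact h3
  have h2 : ((cut a (T φ) : Hc X) : Hilb X) =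
      ∑ b ∈ s, ((cut a (T (cut b (φ : Hilb X))) : Hc X) : Hilb X) := by
    conv_lhs => rw [hs]
    simp only [map_sum, AddSubmonoidClass.coe_finsetSum]
  have h3 : ∑ b ∈ s, √(blockSq T a b).toReal ^ 2 ≤ (∑' b, blockSq T a b).toReal := by
    simp only [Real.sq_sqrt ENNReal.toReal_nonneg]
    rw [← ENNReal.toReal_sum fun b _ => hfin b]
    exact ENNReal.toReal_mono (hrow a).ne (ENNReal.sum_le_tsum s)
  have h4 : ∑ b ∈ s, ‖((cut b (φ : Hilb X) : Hc X) : Hilb X)‖ ^ 2 ≤ ‖(φ : Hilb X)‖ ^ 2 := by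
    have h5 : ∑ b ∈ s, ‖((cut b (φ : Hilb X) : Hc X) : Hilb X)‖ₑ ^ 2 ≤ ‖(φ : Hilb X)‖ₑ ^ 2 := by
      rw [← tsum_enorm_cut_sq (φ : Hilb X)]
      exact ENNReal.sum_le_tsum s
    have h6 := ENNReal.toReal_mono (by simp) h5
    rw [ENNReal.toReal_sum (by simp)] at h6
    simpa only [ENNReal.toReal_pow, toReal_enorm] using h6
  change ‖((cut a (T φ) : Hc X) : Hilb X)‖ ≤ _ * ‖(φ : Hilb X)‖
  rw [h2]
  refine (norm_sum_le _ _).trans ((Finset.sum_le_sum fun b _ => h1 b).trans ?_)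
  refine (Real.sum_mul_le_sqrt_mul_sqrt s _ _).trans ?_
  refine mul_le_mul (Real.sqrt_le_sqrt h3) ?_ (Real.sqrt_nonneg _) (Real.sqrt_nonneg _)
  exact (Real.sqrt_le_sqrt h4).trans_eq (Real.sqrt_sq (norm_nonneg _))

/-- Covariance of the blocks of an operator. -/
lemma blockSq_translate (U : TranslationRep X) {T T' : Hc X →ₗ[ℂ] Hilb X} {c : Fin d → ℤ}
    (hT : RightBounded T)
    (hcov : ∀ φ ψ : Hc X, (ψ : Hilb X) = U.U c φ → T' ψ = U.U c (T φ)) (a b : Fin d → ℤ) :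
    blockSq T' (a + c) (b + c) = blockSq T a b := by
  obtain ⟨S', hS'⟩ := hT.exists_adjoint_block a b
  rw [blockSq, blockSq, ← tsum_enorm_unitary hS' (U.U c).symm]
  refine tsum_congr fun i => ?_
  have h1 : (basis X i : Hilb X) = U.U c ((U.U c).symm (basis X i)) :=
    ((U.U c).apply_symm_apply _).symm
  conv_lhs => rw [h1, hcov _ _ (U.map_cell c b _).symm, ← U.map_cell c a]
  rw [← ofReal_norm, ← ofReal_norm, (U.U c).norm_map]

end Blocks

/-! ### Stationarity, mass transport and the norm of `𝒦₂`. -/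

section Random

variable {d : ℕ} {X : Type} [TopologicalSpace X] [MeasurableSpace X] [PosSpace d X]
  {Ω : Type*} [MeasurableSpace Ω]

lemma hsNormSq_eq_lintegral_colSq (P : Measure Ω) (A : RandOp X Ω) :
    hsNormSq P A = ∫⁻ ω, colSq (A ω) 0 ∂P := rfl

lemma IsCovariant.blockSq_vadd [AddAction (Fin d → ℤ) Ω] {P : Measure Ω} {U : TranslationRep X}
    {A : RandOp X Ω} (hA : IsCovariant P U A)
    (hb : ∀ᵐ ω ∂P, RightBounded (A ω)) :
    ∀ᵐ ω ∂P, ∀ a b c : Fin d → ℤ, blockSq (A (c +ᵥ ω)) (a + c) (b + c) = blockSq (A ω) a b := by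
  filter_upwards [hA, hb] with ω h1 h2 a b c
  exact blockSq_translate U h2 (h1 c) a b

section Stationary

variable [AddAction (Fin d → ℤ) Ω] {P : Measure Ω} {U : TranslationRep X}
  [MeasurableConstVAdd (Fin d → ℤ) Ω] [VAddInvariantMeasure (Fin d → ℤ) Ω P]

lemma ae_forall_vadd {p : Ω → Prop} (h : ∀ᵐ ω ∂P, p ω) :
    ∀ᵐ ω ∂P, ∀ c : Fin d → ℤ, p (c +ᵥ ω) :=
  ae_all_iff.2 fun c => (measurePreserving_vadd c P).quasiMeasurePreserving.ae h

/-- Covariance shifts the blocks along with `ω`, and the law of `ω` is invariant; so the mean weight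
of a block depends only on the difference of its indices. -/
lemma IsCovariant.lintegral_blockSq {A : RandOp X Ω} (hA : IsCovariant P U A)
    (hb : ∀ᵐ ω ∂P, RightBounded (A ω)) (a b c : Fin d → ℤ) :
    ∫⁻ ω, blockSq (A ω) (a + c) (b + c) ∂P = ∫⁻ ω, blockSq (A ω) a b ∂P := by
  rw [← (measurePreserving_vadd c P).lintegral_comp_emb (measurableEmbedding_const_vadd c)]
  refine lintegral_congr_ae ?_
  filter_upwards [hA.blockSq_vadd hb] with ω h using h a b c

end Stationary

variable [BorelSpace X] [SecondCountableTopology X]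

lemma IsMeasurable.aemeasurable_blockSq {P : Measure Ω} {A : RandOp X Ω} (hA : IsMeasurable P A)
    (a b : Fin d → ℤ) : AEMeasurable (fun ω => blockSq (A ω) a b) P := by
  have := countable_basisSet X
  refine AEMeasurable.tsum fun i => AEMeasurable.pow_const (AEStronglyMeasurable.enorm ?_) 2
  exact (chi a).continuous.comp_aestronglyMeasurable (hA.aestronglyMeasurable _)

lemma tsum_lintegral_col [LocallyFiniteCells X] {P : Measure Ω} {A : RandOp X Ω}
    (hm : IsMeasurable P A) : ∑' a, ∫⁻ ω, blockSq (A ω) a 0 ∂P = hsNormSq P A := by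
  rw [hsNormSq_eq_lintegral_colSq, ← lintegral_tsum fun a => hm.aemeasurable_blockSq a 0]
  simp only [tsum_blockSq]

variable [AddAction (Fin d → ℤ) Ω] {P : Measure Ω} {U : TranslationRep X}

lemma K2.ae_rightBounded (A : K2 P U) : ∀ᵐ ω ∂P, RightBounded (A.1 ω) := by
  filter_upwards [A.2.2.2.1] with ω h a using (h a).1

lemma K2.ae_leftBounded (A : K2 P U) : ∀ᵐ ω ∂P, LeftBounded (A.1 ω) := by
  filter_upwards [A.2.2.2.1] with ω h a using (h a).2

lemma K2.norm_sq (A : K2 P U) : ‖A‖ ^ 2 = (hsNormSq P A.1).toReal := by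
  have h1 : ⟪A, A⟫_ℂ = ((∫ ω, ∑' i, ‖A.1 ω (cut 0 (basis X i))‖ ^ 2 ∂P : ℝ) : ℂ) := by
    change hsInner P A.1 A.1 = _
    simp only [hsInner, inner_self_eq_norm_sq_to_K]
    rw [← integral_complex_ofReal]
    push_cast
    rfl
  rw [inner_self_eq_norm_sq_to_K] at h1
  have h2 : ‖A‖ ^ 2 = ∫ ω, ∑' i, ‖A.1 ω (cut 0 (basis X i))‖ ^ 2 ∂P := by
    apply Complex.ofReal_injective
    rw [← h1]
    push_cast
    rfl
  have := countable_basisSet X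
  rw [h2, hsNormSq, ← integral_toReal (AEMeasurable.tsum fun i =>
    ((A.2.1.aestronglyMeasurable _).enorm.pow_const 2)) (ae_summable A.2.1 A.2.2.2.2)]
  refine integral_congr_ae (Filter.Eventually.of_forall fun ω => ?_)
  beta_reduce
  rw [ENNReal.tsum_toReal_eq fun i => by simp]
  simp only [ENNReal.toReal_pow, toReal_enorm]

lemma K2.norm_le_of_hsNormSq_le {A B : K2 P U} {C : ℝ} (hC : 0 ≤ C)
    (h : hsNormSq P A.1 ≤ ENNReal.ofReal (C ^ 2) * hsNormSq P B.1) : ‖A‖ ≤ C * ‖B‖ := by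
  refine (sq_le_sq₀ (norm_nonneg _) (by positivity)).1 ?_
  rw [mul_pow, K2.norm_sq, K2.norm_sq]
  have h1 := ENNReal.toReal_mono (ENNReal.mul_ne_top ENNReal.ofReal_ne_top B.2.2.2.2.ne) h
  rwa [ENNReal.toReal_mul, ENNReal.toReal_ofReal (by positivity)] at h1

lemma K2.coe_eq_of_ae_eq {A B : K2 P U} (h : ∀ᵐ ω ∂P, A.1 ω = B.1 ω) : (A : HK2 P U) = B :=
  PVM.completion_coe_eq_of_inner fun Z => by
    change hsInner P A.1 Z.1 = hsInner P B.1 Z.1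
    refine integral_congr_ae ?_
    filter_upwards [h] with ω hω
    rw [hω]

variable [MeasurableConstVAdd (Fin d → ℤ) Ω] [VAddInvariantMeasure (Fin d → ℤ) Ω P]

variable [LocallyFiniteCells X]

/-- Mass transport: the rows and the columns of a covariant operator have the same weight. -/
lemma tsum_lintegral_row {A : RandOp X Ω} (hm : IsMeasurable P A) (hA : IsCovariant P U A)
    (hb : ∀ᵐ ω ∂P, RightBounded (A ω)) (a : Fin d → ℤ) :
    ∑' b, ∫⁻ ω, blockSq (A ω) a b ∂P = hsNormSq P A := by
  -- Block `(a, b)` has the same mean as block `(a - b, 0)`, and `b ↦ a - b` permutes the lattice.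
  rw [← tsum_lintegral_col hm, ← (Equiv.subLeft a).tsum_eq fun a => ∫⁻ ω, blockSq (A ω) a 0 ∂P]
  refine tsum_congr fun b => ?_
  rw [← hA.lintegral_blockSq hb (Equiv.subLeft a b) 0 b, Equiv.subLeft_apply, sub_add_cancel,
    zero_add]

/-- By mass transport each row has finite mean weight, so almost surely every row sum is finite and
the row criterion applies. -/
lemma ae_leftBounded {A : RandOp X Ω} (hm : IsMeasurable P A) (hA : IsCovariant P U A)
    (hb : ∀ᵐ ω ∂P, RightBounded (A ω)) (hfin : hsNormSq P A < ∞) :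
    ∀ᵐ ω ∂P, LeftBounded (A ω) := by
  have h1 : ∀ᵐ ω ∂P, ∀ a, ∑' b, blockSq (A ω) a b < ∞ := by
    refine ae_all_iff.2 fun a => ?_
    refine ae_lt_top' (AEMeasurable.tsum fun b => hm.aemeasurable_blockSq a b) ?_
    rw [lintegral_tsum fun b => hm.aemeasurable_blockSq a b, tsum_lintegral_row hm hA hb]
    exact hfin.ne
  filter_upwards [h1, hb] with ω h2 h3 using h3.leftBounded h2

/-- The bound on `χ_a A` is automatic, so membership of every operator constructed later only needs
the bound on `A χ_b`, which is the easy half. -/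
lemma mem_K2_of_rightBounded {A : RandOp X Ω} (hm : IsMeasurable P A) (hA : IsCovariant P U A)
    (hb : ∀ᵐ ω ∂P, RightBounded (A ω)) (hfin : hsNormSq P A < ∞) : A ∈ K2 P U := by
  refine ⟨hm, hA, ?_, hfin⟩
  filter_upwards [hb, ae_leftBounded hm hA hb hfin] with ω h1 h2 a using ⟨h1 a, h2 a⟩

end Random

/-! ### The conjugation `A ↦ A‡` as an antiunitary involution. -/

section Translation

variable {d : ℕ} {X : Type} [TopologicalSpace X] [MeasurableSpace X] [PosSpace d X]

lemma IsFormalAdjoint.add_smul {T' T S' S : Hc X →ₗ[ℂ] Hilb X} (hT : IsFormalAdjoint T' T)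
    (hS : IsFormalAdjoint S' S) (c : ℂ) :
    IsFormalAdjoint (T' + c • S') (T + starRingEnd ℂ c • S) := fun φ ψ => by
  simp only [LinearMap.add_apply, LinearMap.smul_apply, inner_add_left, inner_add_right,
    inner_smul_left, inner_smul_right, hT φ ψ, hS φ ψ]

variable [LocallyFiniteCells X]

lemma TranslationRep.exists_preimage (U : TranslationRep X) (c : Fin d → ℤ) (χ : Hc X) :
    ∃ χ' : Hc X, (χ : Hilb X) = U.U c χ' := by
  obtain ⟨s, hs, -⟩ := Hc_eq_sum_cut χ
  refine ⟨∑ a ∈ s, cut (a - c) ((U.U c).symm χ), ?_⟩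
  conv_lhs => rw [hs]
  simp only [AddSubmonoidClass.coe_finsetSum, map_sum, U.map_cell,
    LinearIsometryEquiv.apply_symm_apply, sub_add_cancel]

/-- Formal adjoints of covariant operators are covariant. -/
lemma IsFormalAdjoint.translate (U : TranslationRep X) {c : Fin d → ℤ}
    {T' T S' S : Hc X →ₗ[ℂ] Hilb X} (hT : IsFormalAdjoint T' T) (hS : IsFormalAdjoint S' S)
    (hcov : ∀ φ ψ : Hc X, (ψ : Hilb X) = U.U c φ → S ψ = U.U c (T φ)) (φ ψ : Hc X)
    (h : (ψ : Hilb X) = U.U c φ) : S' ψ = U.U c (T' φ) := by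
  refine ext_of_inner_Hc fun χ => ?_
  obtain ⟨χ', hχ⟩ := U.exists_preimage c χ
  rw [hS, hcov χ' χ hχ, h, hχ, LinearIsometryEquiv.inner_map_map,
    LinearIsometryEquiv.inner_map_map, hT]

end Translation

namespace K2

variable {d : ℕ} {X : Type} [TopologicalSpace X] [MeasurableSpace X] [PosSpace d X]
  {Ω : Type*} [MeasurableSpace Ω] [BorelSpace X] [SecondCountableTopology X]
  [AddAction (Fin d → ℤ) Ω] {P : Measure Ω} {U : TranslationRep X}

lemma inner_congr_coe {A A' B B' : K2 P U} (hA : (A : HK2 P U) = A') (hB : (B : HK2 P U) = B') :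
    ⟪A, B⟫_ℂ = ⟪A', B'⟫_ℂ := by
  rw [← UniformSpace.Completion.inner_coe, hA, hB, UniformSpace.Completion.inner_coe]

variable [LocallyFiniteCells X]

lemma ae_isFormalAdjoint (A : K2 P U) : ∀ᵐ ω ∂P, IsFormalAdjoint (dag (A.1 ω)) (A.1 ω) := by
  filter_upwards [(ae_leftBounded A)] with ω h using h.isFormalAdjoint_dag

lemma dag_isMeasurable (A : K2 P U) : IsMeasurable P fun ω => dag (A.1 ω) := fun φ ψ => by
  refine ((Complex.continuous_conj.measurable.comp_aemeasurable (A.2.1 ψ φ))).congr ?_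
  filter_upwards [(ae_isFormalAdjoint A)] with ω h
  rw [Function.comp_apply, ← h, inner_conj_symm]

lemma dag_rightBounded (A : K2 P U) : ∀ᵐ ω ∂P, RightBounded (dag (A.1 ω)) := by
  filter_upwards [(ae_isFormalAdjoint A), (ae_leftBounded A)] with ω h1 h2 using h1.rightBounded h2

variable [MeasurableConstVAdd (Fin d → ℤ) Ω] [VAddInvariantMeasure (Fin d → ℤ) Ω P]

section Dagger

lemma dag_isCovariant (A : K2 P U) : IsCovariant P U fun ω => dag (A.1 ω) := by
  filter_upwards [A.2.2.1, (ae_isFormalAdjoint A), ae_forall_vadd (d := d) (ae_isFormalAdjoint A)]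
    with ω h1 h2 h3 a
  exact h2.translate U (h3 a) (h1 a)

/-- The zeroth column of `A‡` is blockwise the zeroth row of `A`, which by mass transport weighs as
much as the zeroth column of `A`. -/
lemma hsNormSq_dag (A : K2 P U) : hsNormSq P (fun ω => dag (A.1 ω)) = hsNormSq P A.1 := by
  rw [← tsum_lintegral_col (dag_isMeasurable A),
    ← tsum_lintegral_row A.2.1 A.2.2.1 (ae_rightBounded A) 0]
  refine tsum_congr fun b => lintegral_congr_ae ?_
  filter_upwards [(ae_isFormalAdjoint A)] with ω h using h.blockSq_eq b 0

/-- The conjugation `A ↦ A‡` of `𝒦₂`. -/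
def dagger (A : K2 P U) : K2 P U :=
  ⟨fun ω => dag (A.1 ω), mem_K2_of_rightBounded (dag_isMeasurable A) (dag_isCovariant A)
    (dag_rightBounded A) ((hsNormSq_dag A).trans_lt A.2.2.2.2)⟩

lemma norm_dagger (A : K2 P U) : ‖(dagger A)‖ = ‖A‖ := by
  have h : ‖(dagger A)‖ ^ 2 = ‖A‖ ^ 2 := by
    rw [K2.norm_sq, K2.norm_sq, ← (hsNormSq_dag A)]
    rfl
  exact (sq_eq_sq₀ (norm_nonneg _) (norm_nonneg _)).1 h

lemma ae_dagger_dagger (A : K2 P U) : ∀ᵐ ω ∂P, (dagger (dagger A)).1 ω = A.1 ω := by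
  filter_upwards [(ae_isFormalAdjoint A)] with ω h using h.flip.dag_eq

lemma coe_dagger_dagger (A : K2 P U) : ((dagger (dagger A)) : HK2 P U) = A :=
  coe_eq_of_ae_eq (ae_dagger_dagger A)

lemma norm_dagger_add_smul (A B : K2 P U) (c : ℂ) :
    ‖(dagger A) + c • (dagger B)‖ = ‖A + starRingEnd ℂ c • B‖ := by
  rw [← norm_dagger (A + starRingEnd ℂ c • B), ← UniformSpace.Completion.norm_coe,
    ← UniformSpace.Completion.norm_coe (dagger _)]
  congr 1
  refine coe_eq_of_ae_eq ?_
  filter_upwards [(ae_isFormalAdjoint A), (ae_isFormalAdjoint B)] with ω h1 h2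
  exact (h1.add_smul h2 c).dag_eq.symm

/-- Polarization: the norms of `A‡ + c B‡` and `A + c̄ B` agree, and `c = 1`, `c = i` recover the
real and imaginary parts. -/
lemma inner_dagger_dagger (A B : K2 P U) : ⟪(dagger A), (dagger B)⟫_ℂ = ⟪B, A⟫_ℂ := by
  have h : ∀ c : ℂ, (⟪dagger A, c • dagger B⟫_ℂ).re = (⟪A, starRingEnd ℂ c • B⟫_ℂ).re :=
      fun c => by
    have h1 := congrArg (· ^ 2) (norm_dagger_add_smul A B c)
    have h2 := @norm_add_sq ℂ _ _ _ _ (dagger A) (c • (dagger B))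
    have h3 := @norm_add_sq ℂ _ _ _ _ A (starRingEnd ℂ c • B)
    simp only [norm_smul, norm_dagger, RCLike.norm_conj] at h1 h2 h3
    change _ = _ + 2 * (⟪(dagger A), c • (dagger B)⟫_ℂ).re + _ at h2
    change _ = _ + 2 * (⟪A, starRingEnd ℂ c • B⟫_ℂ).re + _ at h3
    linarith
  have h1 := h 1
  have h2 := h Complex.I
  simp only [one_smul, map_one, inner_smul_right, Complex.conj_I, Complex.mul_re, Complex.I_re,
    Complex.I_im, Complex.neg_re, Complex.neg_im] at h1 h2
  rw [← inner_conj_symm B A]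
  apply Complex.ext
  · rw [Complex.conj_re, h1]
  · rw [Complex.conj_im]
    linarith

lemma inner_dagger_left (A B : K2 P U) : ⟪(dagger A), B⟫_ℂ = ⟪(dagger B), A⟫_ℂ := by
  rw [← inner_dagger_dagger A (dagger B)]
  exact inner_congr_coe rfl (coe_dagger_dagger B).symm

end Dagger

end K2

/-! ### Left multiplication by bounded covariant families. -/

section LeftMul

variable {d : ℕ} {X : Type} [TopologicalSpace X] [MeasurableSpace X] [PosSpace d X]
  {Ω : Type*} [MeasurableSpace Ω] {P : Measure Ω} {U : TranslationRep X}

lemma hsNormSq_leftMul_le {B : Ω → Hilb X →L[ℂ] Hilb X} (A : RandOp X Ω) {C : ℝ} (hC : 0 ≤ C)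
    (hB : ∀ ω f, ‖B ω f‖ ≤ C * ‖f‖) :
    hsNormSq P (leftMul B A) ≤ ENNReal.ofReal (C ^ 2) * hsNormSq P A := by
  rw [hsNormSq, hsNormSq, ← lintegral_const_mul' _ _ ENNReal.ofReal_ne_top]
  refine lintegral_mono fun ω => ?_
  rw [← ENNReal.tsum_mul_left]
  refine ENNReal.tsum_le_tsum fun i => ?_
  rw [ENNReal.ofReal_pow hC, ← mul_pow, ← ofReal_norm, ← ofReal_norm, ← ENNReal.ofReal_mul hC]
  gcongr
  exact hB ω _

variable [BorelSpace X] [SecondCountableTopology X] [AddAction (Fin d → ℤ) Ω]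

/-- Measurable covariant families of operators with a uniform bound. -/
structure IsBddCov (P : Measure Ω) (U : TranslationRep X) (B : Ω → Hilb X →L[ℂ] Hilb X) :
    Prop where
  meas : ∀ f g, AEMeasurable (fun ω => ⟪f, B ω g⟫_ℂ) P
  cov : ∀ᵐ ω ∂P, ∀ (a : Fin d → ℤ) f, B (a +ᵥ ω) (U.U a f) = U.U a (B ω f)
  bdd : ∃ C : ℝ, 0 ≤ C ∧ ∀ ω f, ‖B ω f‖ ≤ C * ‖f‖

/-- Only weak measurability is available, and a product of two random operators is not a pairing
with a fixed vector. Writing `⟪φ, B A ψ⟫ = ⟪B* φ, A ψ⟫` makes it an inner product of two strongly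
measurable vectors. -/
lemma IsBddCov.isMeasurable_leftMul {B : Ω → Hilb X →L[ℂ] Hilb X} (hB : IsBddCov P U B)
    {A : RandOp X Ω} (hA : IsMeasurable P A) : IsMeasurable P (leftMul B A) := fun φ ψ => by
  have h1 : IsMeasurable P fun ω =>
      (ContinuousLinearMap.adjoint (B ω)).toLinearMap ∘ₗ (Hc X).subtype := fun φ ψ => by
    refine (Complex.continuous_conj.measurable.comp_aemeasurable (hB.meas ψ φ)).congr ?_
    refine Filter.Eventually.of_forall fun ω => ?_
    change starRingEnd ℂ _ = ⟪(φ : Hilb X), ContinuousLinearMap.adjoint (B ω) (ψ : Hilb X)⟫_ℂ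
    rw [ContinuousLinearMap.adjoint_inner_right, inner_conj_symm]
  refine ((h1.aestronglyMeasurable φ).inner (hA.aestronglyMeasurable ψ)).aemeasurable.congr ?_
  refine Filter.Eventually.of_forall fun ω => ?_
  change ⟪ContinuousLinearMap.adjoint (B ω) (φ : Hilb X), A ω ψ⟫_ℂ = _
  rw [ContinuousLinearMap.adjoint_inner_left]
  rfl

variable [MeasurableConstVAdd (Fin d → ℤ) Ω] [VAddInvariantMeasure (Fin d → ℤ) Ω P]
  [LocallyFiniteCells X]

lemma IsBddCov.leftMul_mem {B : Ω → Hilb X →L[ℂ] Hilb X} (hB : IsBddCov P U B) (A : K2 P U) :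
    leftMul B A.1 ∈ K2 P U := by
  obtain ⟨C, hC0, hC⟩ := hB.bdd
  refine mem_K2_of_rightBounded (hB.isMeasurable_leftMul A.2.1) ?_ ?_ ?_
  · filter_upwards [A.2.2.1, hB.cov] with ω h1 h2 a φ ψ h
    change B (a +ᵥ ω) (A.1 (a +ᵥ ω) ψ) = U.U a (B ω (A.1 ω φ))
    rw [h1 a φ ψ h, h2]
  · filter_upwards [K2.ae_rightBounded A] with ω h b
    obtain ⟨D, hD⟩ := h b
    refine ⟨C * D, fun f => (hC ω _).trans ?_⟩
    rw [mul_assoc]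
    exact mul_le_mul_of_nonneg_left (hD f) hC0
  · exact (hsNormSq_leftMul_le A.1 hC0 hC).trans_lt
      (ENNReal.mul_lt_top ENNReal.ofReal_lt_top A.2.2.2.2)

end LeftMul

/-! ### Measurability and covariance of the functions `f(H_ω)`. -/

section Families

variable {d : ℕ} {X : Type} [TopologicalSpace X] [MeasurableSpace X] [PosSpace d X]
  {Ω : Type*} [MeasurableSpace Ω]
  {P : Measure Ω} {U : TranslationRep X} {H : Ω → Hilb X →ₗ.[ℂ] Hilb X}

open PVM

lemma PVM.boundedFn_conj {S K : Type*} [MeasurableSpace S] [NormedAddCommGroup K]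
    [InnerProductSpace ℂ K] [CompleteSpace K] {E F : PVM S K} {u : K ≃ₗᵢ[ℂ] K}
    (h : ∀ B, MeasurableSet B → ∀ x, F.proj B (u x) = u (E.proj B x)) {f : S → ℂ}
    (hf : BddMeas f) (x : K) : F.boundedFn f (u x) = u (E.boundedFn f x) := by
  have hm : ∀ x, F.measure (u x) = E.measure x := fun x => by
    refine Measure.ext fun B hB => ?_
    rw [measure_apply _ _ hB, measure_apply _ _ hB, h B hB, u.norm_map]
  have h1 : E.IsIntegral f ((u.symm.toContinuousLinearEquiv : K →L[ℂ] K) ∘L F.boundedFn f ∘L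
      (u.toContinuousLinearEquiv : K →L[ℂ] K)) := fun x => by
    change ⟪x, u.symm (F.boundedFn f (u x))⟫_ℂ = _
    rw [← u.inner_map_map, u.apply_symm_apply, F.isIntegral_boundedFn hf, hm]
  rw [h1.boundedFn_eq]
  exact (u.apply_symm_apply _).symm

/-- The functions `f(H_ω)` of an ergodic family. -/
def fnFamily (H : Ω → Hilb X →ₗ.[ℂ] Hilb X) (f : ℝ → ℂ) (ω : Ω) : Hilb X →L[ℂ] Hilb X :=
  (spectralMeasure (H ω)).boundedFn f

variable [AddAction (Fin d → ℤ) Ω]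

/-- The spectral projections are measurable by assumption; simple functions and then norm limits
inherit this. One approximating sequence of `f` serves all `ω`. -/
lemma IsErgodicFamily.measurable_fnFamily (hE : IsErgodicFamily P U H) {f : ℝ → ℂ}
    (hf : BddMeas f) (x y : Hilb X) : AEMeasurable (fun ω => ⟪x, fnFamily H f ω y⟫_ℂ) P := by
  have hs : ∀ g : SimpleFunc ℝ ℂ, AEMeasurable (fun ω => ⟪x, fnFamily H g ω y⟫_ℂ) P := fun g => by
    induction g using SimpleFunc.induction with
    | const c hs =>
      simp only [fnFamily, simple_piecewise_eq, boundedFn_const_mul _ _ (.indicator hs),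
        boundedFn_indicator _ hs, smul_apply, inner_smul_right]
      exact (hE.measurable _ hs x y).const_mul c
    | @add f g _ h1 h2 =>
      have h3 : ∀ ω, fnFamily H (f + g : SimpleFunc ℝ ℂ) ω = fnFamily H f ω + fnFamily H g ω :=
        fun ω => boundedFn_add _ (.simple f) (.simple g)
      simp only [h3, add_apply, inner_add_right]
      exact h1.add h2
  obtain ⟨g, C, h1, h2, h3⟩ := exists_simple_seq hf
  refine aemeasurable_of_tendsto_metrizable_ae Filter.atTop (fun n => hs (g n))
    (Filter.Eventually.of_forall fun ω => ?_)
  exact Filter.Tendsto.inner tendsto_const_nhds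
    (((ContinuousLinearMap.apply ℂ (Hilb X) y).continuous.tendsto _).comp
      ((spectralMeasure (H ω)).exists_isIntegral h1 h2 h3).2)

lemma IsErgodicFamily.isBddCov (hE : IsErgodicFamily P U H) {f : ℝ → ℂ} (hf : BddMeas f) :
    IsBddCov P U (fnFamily H f) where
  meas := hE.measurable_fnFamily hf
  cov := by
    filter_upwards [hE.covariant] with ω h a x
    exact boundedFn_conj (fun B hB => spectralMeasure_conj (h a) hB) hf x
  bdd := by
    obtain ⟨C, hC⟩ := hf.bdd
    have hC0 : 0 ≤ C := (norm_nonneg _).trans (hC 0)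
    exact ⟨C, hC0, fun ω x => norm_boundedFn_apply_le _ hf hC0 hC x⟩

lemma conj_indicator (B : Set ℝ) :
    (fun l => starRingEnd ℂ (B.indicator (1 : ℝ → ℂ) l)) = B.indicator 1 := by
  funext l
  by_cases h : l ∈ B <;> simp [h]

lemma indicator_mul_indicator (B C : Set ℝ) :
    (fun l => B.indicator (1 : ℝ → ℂ) l * C.indicator 1 l) = (B ∩ C).indicator 1 := by
  funext l
  by_cases h : l ∈ B <;> by_cases h' : l ∈ C <;> simp [h, h']

end Families

/-! ### The functional calculi of `ℋ_L` and `ℋ_R` on `𝒦₂`. -/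

namespace K2

open PVM

variable {d : ℕ} {X : Type} [TopologicalSpace X] [MeasurableSpace X] [PosSpace d X]
  {Ω : Type*} [MeasurableSpace Ω] [BorelSpace X] [SecondCountableTopology X]
  [AddAction (Fin d → ℤ) Ω] {P : Measure Ω} {U : TranslationRep X}
  {H : Ω → Hilb X →ₗ.[ℂ] Hilb X}

open scoped Classical in
/-- `f(ℋ_L) A = f(H) ⊙_L A` on `𝒦₂`. -/
def fnL (U : TranslationRep X) (P : Measure Ω) (H : Ω → Hilb X →ₗ.[ℂ] Hilb X) (f : ℝ → ℂ)
    (A : K2 P U) : K2 P U :=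
  if h : leftMul (fnFamily H f) A.1 ∈ K2 P U then ⟨_, h⟩ else 0

variable [MeasurableConstVAdd (Fin d → ℤ) Ω] [VAddInvariantMeasure (Fin d → ℤ) Ω P]
  [LocallyFiniteCells X]

section Left

lemma fnL_val (hE : IsErgodicFamily P U H) {f : ℝ → ℂ} (hf : BddMeas f) (A : K2 P U) :
    (fnL U P H f A).1 = leftMul (fnFamily H f) A.1 := by
  rw [fnL, dif_pos ((hE.isBddCov hf).leftMul_mem A)]

lemma fnL_add (hE : IsErgodicFamily P U H) {f g : ℝ → ℂ} (hf : BddMeas f) (hg : BddMeas g)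
    (A : K2 P U) :
    fnL U P H (fun l => f l + g l) A = fnL U P H f A + fnL U P H g A := by
  refine Subtype.ext (funext fun ω => LinearMap.ext fun φ => ?_)
  rw [fnL_val hE (hf.add hg), Submodule.coe_add, Pi.add_apply, LinearMap.add_apply,
    fnL_val hE hf, fnL_val hE hg]
  change (spectralMeasure (H ω)).boundedFn _ _ = _
  rw [boundedFn_add _ hf hg]
  rfl

lemma fnL_const_mul (hE : IsErgodicFamily P U H) (c : ℂ) {f : ℝ → ℂ} (hf : BddMeas f) (A : K2 P U) :
    fnL U P H (fun l => c * f l) A = c • fnL U P H f A := by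
  refine Subtype.ext (funext fun ω => LinearMap.ext fun φ => ?_)
  rw [fnL_val hE (hf.const_mul c), Submodule.coe_smul, Pi.smul_apply, LinearMap.smul_apply,
    fnL_val hE hf]
  change (spectralMeasure (H ω)).boundedFn _ _ = _
  rw [boundedFn_const_mul _ c hf]
  rfl

lemma fnL_fnL (hE : IsErgodicFamily P U H) {f g : ℝ → ℂ} (hf : BddMeas f) (hg : BddMeas g)
    (A : K2 P U) :
    fnL U P H f (fnL U P H g A) = fnL U P H (fun l => f l * g l) A := by
  refine Subtype.ext (funext fun ω => LinearMap.ext fun φ => ?_)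
  rw [fnL_val hE hf, fnL_val hE hg, fnL_val hE (hf.mul hg)]
  change _ = (spectralMeasure (H ω)).boundedFn _ _
  rw [boundedFn_mul _ hf hg]
  rfl

lemma fnL_one (hE : IsErgodicFamily P U H) (A : K2 P U) : fnL U P H (fun _ => 1) A = A := by
  refine Subtype.ext (funext fun ω => LinearMap.ext fun φ => ?_)
  rw [fnL_val hE bddMeas_one]
  change (spectralMeasure (H ω)).boundedFn _ _ = _
  rw [boundedFn_one]
  rfl

lemma inner_fnL (hE : IsErgodicFamily P U H) {f : ℝ → ℂ} (hf : BddMeas f) (A B : K2 P U) :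
    ⟪fnL U P H f A, B⟫_ℂ = ⟪A, fnL U P H (fun l => starRingEnd ℂ (f l)) B⟫_ℂ := by
  change hsInner P _ _ = hsInner P _ _
  rw [fnL_val hE hf, fnL_val hE hf.conj]
  refine integral_congr_ae (Filter.Eventually.of_forall fun ω => tsum_congr fun i => ?_)
  change ⟪(spectralMeasure (H ω)).boundedFn f _, _⟫_ℂ = ⟪_, (spectralMeasure (H ω)).boundedFn _ _⟫_ℂ
  rw [← adjoint_boundedFn _ hf, ContinuousLinearMap.adjoint_inner_right]

lemma norm_fnL_le (hE : IsErgodicFamily P U H) {f : ℝ → ℂ} (hf : BddMeas f) {C : ℝ}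
    (hC0 : 0 ≤ C) (hC : ∀ l, ‖f l‖ ≤ C)
    (A : K2 P U) : ‖fnL U P H f A‖ ≤ C * ‖A‖ := by
  refine norm_le_of_hsNormSq_le hC0 ?_
  rw [fnL_val hE hf]
  exact hsNormSq_leftMul_le A.1 hC0 fun ω x => norm_boundedFn_apply_le _ hf hC0 hC x

lemma inner_fnL_indicator (hE : IsErgodicFamily P U H) {B : Set ℝ} (hB : MeasurableSet B)
    (A : K2 P U) :
    ⟪A, fnL U P H (B.indicator 1) A⟫_ℂ =
      ((hsNormSq P (fnL U P H (B.indicator 1) A).1).toReal : ℂ) := by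
  have h1 : fnL U P H (B.indicator 1) A =
      fnL U P H (B.indicator 1) (fnL U P H (B.indicator 1) A) := by
    rw [fnL_fnL hE (.indicator hB) (.indicator hB), indicator_mul_indicator, Set.inter_self]
  have h3 := inner_fnL hE (.indicator hB) A (fnL U P H (B.indicator 1) A)
  rw [conj_indicator, ← h1] at h3
  rw [← h3, inner_self_eq_norm_sq_to_K, ← norm_sq]
  norm_cast

lemma hsNormSq_fnL_indicator (hE : IsErgodicFamily P U H) {B : Set ℝ} (hB : MeasurableSet B)
    (A : K2 P U) :
    hsNormSq P (fnL U P H (B.indicator 1) A).1 =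
      ∫⁻ ω, ∑' i, (spectralMeasure (H ω)).measure (A.1 ω (cut 0 (basis X i))) B ∂P := by
  rw [fnL_val hE (.indicator hB)]
  refine lintegral_congr fun ω => tsum_congr fun i => ?_
  change ‖(spectralMeasure (H ω)).boundedFn _ _‖ₑ ^ 2 = _
  rw [boundedFn_indicator _ hB, measure_apply _ _ hB, ENNReal.ofReal_pow (norm_nonneg _),
    ofReal_norm]

/-- The form `⟪A, χ_B(H) A⟫` is the mean, summed over the basis, of the spectral measures of the
vectors `A_ω χ₀ e_i`. All terms are nonnegative, so countable additivity passes through sum and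
expectation by Tonelli. -/
lemma hasSum_inner_fnL (hE : IsErgodicFamily P U H) {B : ℕ → Set ℝ} (hB : ∀ n, MeasurableSet (B n))
    (hd : Pairwise (Function.onFun Disjoint B)) (A : K2 P U) :
    HasSum (fun n => ⟪A, fnL U P H ((B n).indicator 1) A⟫_ℂ)
      ⟪A, fnL U P H ((⋃ n, B n).indicator 1) A⟫_ℂ := by
  have := countable_basisSet X
  have hm : ∀ n, AEMeasurable (fun ω =>
      ∑' i, (spectralMeasure (H ω)).measure (A.1 ω (cut 0 (basis X i))) (B n)) P := fun n => by
    have h1 : AEMeasurable (fun ω => ∑' i,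
        ‖(fnL U P H ((B n).indicator 1) A).1 ω (cut 0 (basis X i))‖ₑ ^ 2) P :=
      AEMeasurable.tsum fun i => (IsMeasurable.aestronglyMeasurable
        (fnL U P H ((B n).indicator 1) A).2.1 _).enorm.pow_const 2
    refine h1.congr (Filter.Eventually.of_forall fun ω => tsum_congr fun i => ?_)
    rw [fnL_val hE (.indicator (hB n))]
    change ‖(spectralMeasure (H ω)).boundedFn _ _‖ₑ ^ 2 = _
    rw [boundedFn_indicator _ (hB n), measure_apply _ _ (hB n),
      ENNReal.ofReal_pow (norm_nonneg _), ofReal_norm]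
  have h1 : hsNormSq P (fnL U P H ((⋃ n, B n).indicator 1) A).1 =
      ∑' n, hsNormSq P (fnL U P H ((B n).indicator 1) A).1 := by
    simp only [hsNormSq_fnL_indicator hE (hB _),
      hsNormSq_fnL_indicator hE (MeasurableSet.iUnion hB)]
    rw [← lintegral_tsum hm]
    refine lintegral_congr fun ω => ?_
    rw [ENNReal.tsum_comm]
    exact tsum_congr fun i => measure_iUnion hd hB
  simp only [inner_fnL_indicator hE (hB _), inner_fnL_indicator hE (MeasurableSet.iUnion hB)]
  refine Complex.hasSum_ofReal.2 ?_
  rw [h1, ENNReal.tsum_toReal_eq fun n => (Subtype.prop _ : _ ∈ K2 P U).2.2.2.ne]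
  refine (ENNReal.summable_toReal ?_).hasSum
  rw [← h1]
  exact (fnL U P H ((⋃ n, B n).indicator 1) A).2.2.2.2.ne

end Left

/-- `f(ℋ_R) A = A ⊙_R f(H)` on `𝒦₂`. -/
def fnR (U : TranslationRep X) (P : Measure Ω) [VAddInvariantMeasure (Fin d → ℤ) Ω P]
    (H : Ω → Hilb X →ₗ.[ℂ] Hilb X) (f : ℝ → ℂ) (A : K2 P U) : K2 P U :=
  dagger (fnL U P H (fun l => starRingEnd ℂ (f l)) (dagger A))

section Right

lemma inner_fnR_left (f : ℝ → ℂ) (A B : K2 P U) : ⟪fnR U P H f A, B⟫_ℂ =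
    ⟪dagger B, fnL U P H (fun l => starRingEnd ℂ (f l)) (dagger A)⟫_ℂ :=
  inner_dagger_left _ _

/-- The conjugation acts on representatives and is an involution only almost surely; this and
`fnL_congr` let identities for `fnR` be derived in the completion. -/
lemma dagger_congr {A B : K2 P U} (h : (A : HK2 P U) = B) : (dagger A : HK2 P U) = dagger B :=
  completion_coe_eq_of_inner fun Z =>
    (inner_dagger_left A Z).trans ((inner_congr_coe rfl h).trans (inner_dagger_left B Z).symm)

lemma fnL_congr (hE : IsErgodicFamily P U H) {f : ℝ → ℂ} (hf : BddMeas f) {A B : K2 P U}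
    (h : (A : HK2 P U) = B) :
    (fnL U P H f A : HK2 P U) = fnL U P H f B :=
  completion_coe_eq_of_inner fun Z => by
    rw [inner_fnL hE hf, inner_fnL hE hf]
    exact inner_congr_coe h rfl

lemma inner_fnR (hE : IsErgodicFamily P U H) {f : ℝ → ℂ} (hf : BddMeas f) (A B : K2 P U) :
    ⟪fnR U P H f A, B⟫_ℂ = ⟪A, fnR U P H (fun l => starRingEnd ℂ (f l)) B⟫_ℂ := by
  simp only [fnR, Complex.conj_conj]
  rw [inner_dagger_left, ← inner_fnL hE hf, ← inner_conj_symm, inner_dagger_left A,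
    inner_conj_symm]

lemma coe_fnR_fnR (hE : IsErgodicFamily P U H) {f g : ℝ → ℂ} (hf : BddMeas f) (hg : BddMeas g)
    (A : K2 P U) :
    (fnR U P H f (fnR U P H g A) : HK2 P U) = fnR U P H (fun l => f l * g l) A := by
  refine dagger_congr ?_
  refine (fnL_congr hE hf.conj (coe_dagger_dagger _)).trans ?_
  rw [fnL_fnL hE hf.conj hg.conj]
  simp only [map_mul]

lemma coe_fnR_one (hE : IsErgodicFamily P U H) (A : K2 P U) :
    (fnR U P H (fun _ => 1) A : HK2 P U) = A := by
  rw [fnR]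
  simp only [map_one]
  rw [fnL_one hE, coe_dagger_dagger]

/-- Transfers the quadratic forms of `ℋ_R` at `A` to those of `ℋ_L` at `A‡`, so countable additivity
on the right needs no separate argument. -/
lemma inner_fnR_self (hE : IsErgodicFamily P U H) {f : ℝ → ℂ} (hf : BddMeas f) (A : K2 P U) :
    ⟪A, fnR U P H f A⟫_ℂ = ⟪dagger A, fnL U P H f (dagger A)⟫_ℂ := by
  have h := inner_fnL hE hf.conj (dagger A) (dagger A)
  simp only [Complex.conj_conj] at h
  rw [← h, ← inner_conj_symm, fnR, inner_dagger_left, inner_conj_symm]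

lemma coe_fnR_add (hE : IsErgodicFamily P U H) {f g : ℝ → ℂ} (hf : BddMeas f) (hg : BddMeas g)
    (A : K2 P U) :
    (fnR U P H (fun l => f l + g l) A : HK2 P U) = fnR U P H f A + fnR U P H g A := by
  rw [← UniformSpace.Completion.coe_add]
  refine completion_coe_eq_of_inner fun Z => ?_
  simp only [inner_add_left, inner_fnR_left, map_add]
  rw [fnL_add hE hf.conj hg.conj, inner_add_right]

lemma coe_fnR_const_mul (hE : IsErgodicFamily P U H) (c : ℂ) {f : ℝ → ℂ} (hf : BddMeas f)
    (A : K2 P U) :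
    (fnR U P H (fun l => c * f l) A : HK2 P U) = c • (fnR U P H f A : HK2 P U) := by
  rw [← UniformSpace.Completion.coe_smul]
  refine completion_coe_eq_of_inner fun Z => ?_
  simp only [inner_smul_left, inner_fnR_left, map_mul]
  rw [fnL_const_mul hE _ hf.conj, inner_smul_right]

lemma norm_fnR_le (hE : IsErgodicFamily P U H) {f : ℝ → ℂ} (hf : BddMeas f) {C : ℝ}
    (hC0 : 0 ≤ C) (hC : ∀ l, ‖f l‖ ≤ C)
    (A : K2 P U) : ‖fnR U P H f A‖ ≤ C * ‖A‖ := by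
  rw [fnR, norm_dagger, ← norm_dagger A]
  exact norm_fnL_le hE hf.conj hC0 (fun l => by rw [RCLike.norm_conj]; exact hC l) _

end Right

/-- The spectral measure of `ℋ_L` on `𝒦₂`. -/
def preL (hE : IsErgodicFamily P U H) : Pre ℝ (K2 P U) where
  q B := fnL U P H (B.indicator 1)
  symm B hB x y := by rw [inner_fnL hE (.indicator hB), conj_indicator]
  univ x y := by rw [Set.indicator_univ]; exact congrArg (⟪·, y⟫_ℂ) (fnL_one hE x)
  inter B C hB hC x y := by
    rw [fnL_fnL hE (.indicator hB) (.indicator hC), indicator_mul_indicator]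
  iUnion B hB hd x := hasSum_inner_fnL hE hB hd x

/-- The spectral measure of `ℋ_R` on `𝒦₂`. -/
def preR (hE : IsErgodicFamily P U H) : Pre ℝ (K2 P U) where
  q B := fnR U P H (B.indicator 1)
  symm B hB x y := by rw [inner_fnR hE (.indicator hB), conj_indicator]
  univ x y := by rw [Set.indicator_univ]; exact inner_congr_coe (coe_fnR_one hE x) rfl
  inter B C hB hC x y := by
    rw [← indicator_mul_indicator]
    exact inner_congr_coe (coe_fnR_fnR hE (.indicator hB) (.indicator hC) x) rfl
  iUnion B hB hd x := by
    simp only [inner_fnR_self hE (.indicator (hB _)),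
      inner_fnR_self hE (.indicator (MeasurableSet.iUnion hB))]
    exact hasSum_inner_fnL hE hB hd _

lemma coe_fnL (hE : IsErgodicFamily P U H) {f : ℝ → ℂ} (hf : BddMeas f) (A : K2 P U) :
    (fnL U P H f A : HK2 P U) = (preL hE).toPVM.boundedFn f A :=
  coe_eq_boundedFn (E := (preL hE).toPVM) (W := fnL U P H)
    (fun _ hB x => ((preL hE).proj_coe hB x).symm)
    (fun _ _ hf hg x => by rw [fnL_add hE hf hg, UniformSpace.Completion.coe_add])
    (fun c _ hf x => by rw [fnL_const_mul hE c hf, UniformSpace.Completion.coe_smul])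
    (fun _ hf _ hC0 hC x => norm_fnL_le hE hf hC0 hC x) hf A

lemma coe_fnR (hE : IsErgodicFamily P U H) {f : ℝ → ℂ} (hf : BddMeas f) (A : K2 P U) :
    (fnR U P H f A : HK2 P U) = (preR hE).toPVM.boundedFn f A :=
  coe_eq_boundedFn (E := (preR hE).toPVM) (W := fnR U P H)
    (fun _ hB x => ((preR hE).proj_coe hB x).symm)
    (fun _ _ hf hg x => coe_fnR_add hE hf hg x)
    (fun c _ hf x => coe_fnR_const_mul hE c hf x)
    (fun _ hf _ hC0 hC x => norm_fnR_le hE hf hC0 hC x) hf A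

end K2

/-! ### Identification with `⊙_R`, and commutation on bounded operators. -/

namespace K2

open PVM

variable {d : ℕ} {X : Type} [TopologicalSpace X] [MeasurableSpace X] [PosSpace d X]
  {Ω : Type*} [MeasurableSpace Ω] [BorelSpace X] [SecondCountableTopology X]
  [AddAction (Fin d → ℤ) Ω] {P : Measure Ω} {U : TranslationRep X}
  {H : Ω → Hilb X →ₗ.[ℂ] Hilb X}
  [MeasurableConstVAdd (Fin d → ℤ) Ω] [VAddInvariantMeasure (Fin d → ℤ) Ω P]
  [LocallyFiniteCells X]

section RightMul

lemma ae_inner_fnR (hE : IsErgodicFamily P U H) {f : ℝ → ℂ} (hf : BddMeas f) (A : K2 P U) :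
    ∀ᵐ ω ∂P, ∀ φ ψ : Hc X,
    ⟪(fnR U P H f A).1 ω φ, (ψ : Hilb X)⟫_ℂ = ⟪fnFamily H f ω φ, dag (A.1 ω) ψ⟫_ℂ := by
  filter_upwards [ae_isFormalAdjoint (fnL U P H (fun l => starRingEnd ℂ (f l)) (dagger A))]
    with ω h φ ψ
  rw [show (fnR U P H f A).1 ω =
    dag ((fnL U P H (fun l => starRingEnd ℂ (f l)) (dagger A)).1 ω) from rfl, h,
    fnL_val hE hf.conj]
  change ⟪_, (spectralMeasure (H ω)).boundedFn _ _⟫_ℂ = _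
  rw [← adjoint_boundedFn _ hf, ContinuousLinearMap.adjoint_inner_right]
  rfl

/-- The pairing formula for `fnR` shows at once that `f(H) φ` lies in the domain of `(A‡)*` and what
the value there is; the conditional definition of `rightMul` thus takes its genuine branch almost
surely. -/
lemma ae_rightMul (hE : IsErgodicFamily P U H) {f : ℝ → ℂ} (hf : BddMeas f) (A : K2 P U) :
    ∀ᵐ ω ∂P, rightMul A.1 (fnFamily H f) ω = (fnR U P H f A).1 ω := by
  filter_upwards [ae_inner_fnR hE hf A] with ω h
  have h1 : ∀ φ : Hc X, ((fnFamily H f ω).toLinearMap ∘ₗ (Hc X).subtype) φ ∈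
      (toPMap (dag (A.1 ω))).adjoint.domain := fun φ =>
    LinearPMap.mem_adjoint_domain_of_exists _ ⟨(fnR U P H f A).1 ω φ, fun ψ => h φ ψ⟩
  rw [rightMul, dif_pos h1]
  ext1 φ
  exact LinearPMap.adjoint_apply_eq (T := toPMap (dag (A.1 ω))) (dense_Hc X) _ fun ψ => h φ ψ

/-- For a bounded `T` extending `A_ω` the operator `(A_ω‡)*` is just `T`, so right multiplication
becomes ordinary composition. -/
lemma ae_fnR_apply_of_extends (hE : IsErgodicFamily P U H) {f : ℝ → ℂ} (hf : BddMeas f)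
    (A : K2 P U) :
    ∀ᵐ ω ∂P, ∀ T : Hilb X →L[ℂ] Hilb X, (∀ φ : Hc X, T φ = A.1 ω φ) →
      ∀ φ : Hc X, (fnR U P H f A).1 ω φ = T (fnFamily H f ω φ) := by
  filter_upwards [ae_inner_fnR hE hf A] with ω h T hT φ
  have h1 : IsFormalAdjoint ((ContinuousLinearMap.adjoint T).toLinearMap ∘ₗ (Hc X).subtype)
      (A.1 ω) := fun φ ψ => by
    change ⟪ContinuousLinearMap.adjoint T (φ : Hilb X), _⟫_ℂ = _
    rw [ContinuousLinearMap.adjoint_inner_left, hT]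
  refine ext_of_inner_Hc fun ψ => ?_
  rw [h, h1.dag_eq]
  change ⟪_, ContinuousLinearMap.adjoint T (ψ : Hilb X)⟫_ℂ = _
  rw [ContinuousLinearMap.adjoint_inner_right]

/-- Left and right multiplication commute on the bounded operators. -/
lemma coe_fnL_fnR_of_bounded (hE : IsErgodicFamily P U H) {f g : ℝ → ℂ} (hf : BddMeas f)
    (hg : BddMeas g) {A : K2 P U}
    (hA : ∀ᵐ ω ∂P, ∃ T : Hilb X →L[ℂ] Hilb X, ∀ φ : Hc X, T φ = A.1 ω φ) :
    (fnL U P H f (fnR U P H g A) : HK2 P U) = fnR U P H g (fnL U P H f A) := by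
  refine coe_eq_of_ae_eq ?_
  filter_upwards [hA, ae_fnR_apply_of_extends hE hg A,
    ae_fnR_apply_of_extends hE hg (fnL U P H f A)] with ω ⟨T, hT⟩ h1 h2
  ext1 φ
  rw [h2 (fnFamily H f ω ∘L T) (fun φ => by rw [fnL_val hE hf]; exact congrArg _ (hT φ)) φ,
    fnL_val hE hf]
  exact congrArg _ (h1 T hT φ)

end RightMul

end K2

/-! ### Truncated diagonals of the block matrix of an operator. -/

section Diagonal

variable {d : ℕ} {X : Type} [TopologicalSpace X] [MeasurableSpace X] [PosSpace d X]

open scoped Classical in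
/-- The block `χ_{b+c} T χ_b` applied to `φ`, if its squared norm is at most `M`. -/
def truncBlock (c : Fin d → ℤ) (M : ℝ≥0∞) (T : Hc X →ₗ[ℂ] Hilb X) (b : Fin d → ℤ) :
    Hc X →ₗ[ℂ] Hilb X :=
  if blockSq T (b + c) b ≤ M then (Hc X).subtype ∘ₗ cut (b + c) ∘ₗ T ∘ₗ cut b ∘ₗ (Hc X).subtype
  else 0

lemma enorm_truncBlock_sq_le (c : Fin d → ℤ) {M : ℝ≥0∞} {T : Hc X →ₗ[ℂ] Hilb X}
    (hT : RightBounded T) (φ : Hc X) (b : Fin d → ℤ) :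
    ‖truncBlock c M T b φ‖ₑ ^ 2 ≤ M * ‖((cut b (φ : Hilb X) : Hc X) : Hilb X)‖ₑ ^ 2 := by
  rw [truncBlock]
  split_ifs with h
  · obtain ⟨S', hS'⟩ := hT.exists_adjoint_block (b + c) b
    have h2 := enorm_sq_le_tsum hS' ((cut b (φ : Hilb X) : Hc X) : Hilb X)
    rw [cut_cut] at h2
    exact h2.trans (mul_le_mul_left h _)
  · simp

variable [LocallyFiniteCells X]

lemma finite_support_cut (φ : Hc X) :
    (Function.support fun b : Fin d → ℤ => (cut b (φ : Hilb X) : Hc X)).Finite := by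
  obtain ⟨s, -, hs⟩ := Hc_eq_sum_cut φ
  refine s.finite_toSet.subset fun b hb => ?_
  by_contra h
  exact hb (hs b h)

lemma finite_support_truncBlock (c : Fin d → ℤ) (M : ℝ≥0∞) (T : Hc X →ₗ[ℂ] Hilb X) (φ : Hc X) :
    (Function.support fun b => truncBlock c M T b φ).Finite := by
  refine (finite_support_cut φ).subset fun b hb h => hb ?_
  simp only [truncBlock]
  split_ifs
  · simp only [LinearMap.comp_apply, Submodule.subtype_apply, h, map_zero]
  · rfl

/-- The `c`-th diagonal of `T`, restricted to the blocks with squared norm at most `M`. -/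
def diag (c : Fin d → ℤ) (M : ℝ≥0∞) (T : Hc X →ₗ[ℂ] Hilb X) : Hc X →ₗ[ℂ] Hilb X where
  toFun φ := ∑ᶠ b, truncBlock c M T b φ
  map_add' φ ψ := by
    rw [← finsum_add_distrib (finite_support_truncBlock c M T φ)
      (finite_support_truncBlock c M T ψ)]
    simp only [map_add]
  map_smul' r φ := by
    rw [RingHom.id_apply, smul_finsum]
    simp only [map_smul]

lemma diag_apply (c : Fin d → ℤ) (M : ℝ≥0∞) (T : Hc X →ₗ[ℂ] Hilb X) (φ : Hc X) :
    diag c M T φ = ∑ᶠ b, truncBlock c M T b φ := rfl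

open scoped Classical in
lemma cut_truncBlock (c : Fin d → ℤ) (M : ℝ≥0∞) (T : Hc X →ₗ[ℂ] Hilb X) (φ : Hc X)
    (b a : Fin d → ℤ) :
    ((cut a (truncBlock c M T b φ) : Hc X) : Hilb X) =
      if a = b + c then truncBlock c M T b φ else 0 := by
  simp only [truncBlock]
  split_ifs with h1 h2 h2
  · rw [h2]
    exact congrArg _ (cut_cut _ _)
  · exact congrArg _ (cut_cut_of_ne h2 _)
  all_goals simp

/-- Different blocks of one diagonal land in different cells, so the cell `b + c` isolates the
single block issuing from `b`. -/
lemma cut_diag (c : Fin d → ℤ) (M : ℝ≥0∞) (T : Hc X →ₗ[ℂ] Hilb X) (φ : Hc X) (b : Fin d → ℤ) :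
    ((cut (b + c) (diag c M T φ) : Hc X) : Hilb X) = truncBlock c M T b φ := by
  rw [← chi_apply, diag_apply, map_finsum _ (finite_support_truncBlock c M T φ),
    finsum_eq_single _ b fun b' hb => ?_, chi_apply, cut_truncBlock, if_pos rfl]
  rw [chi_apply, cut_truncBlock, if_neg]
  exact fun h => hb (add_right_cancel h).symm

/-- Blocks on one diagonal map distinct cells to distinct cells, hence act orthogonally; their
common bound is a bound for the whole diagonal. -/
lemma enorm_diag_sq_le (c : Fin d → ℤ) {M : ℝ≥0∞} {T : Hc X →ₗ[ℂ] Hilb X}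
    (hT : RightBounded T) (φ : Hc X) : ‖diag c M T φ‖ₑ ^ 2 ≤ M * ‖(φ : Hilb X)‖ₑ ^ 2 := by
  rw [← tsum_enorm_cut_sq (diag c M T φ), ← tsum_enorm_cut_sq (φ : Hilb X),
    ← ENNReal.tsum_mul_left, ← (Equiv.addRight c).tsum_eq]
  refine ENNReal.tsum_le_tsum fun b => ?_
  rw [Equiv.coe_addRight, cut_diag]
  exact enorm_truncBlock_sq_le c hT φ b

lemma norm_diag_le (c : Fin d → ℤ) {M : ℝ} (hM : 0 ≤ M) {T : Hc X →ₗ[ℂ] Hilb X}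
    (hT : RightBounded T) (φ : Hc X) :
    ‖diag c (ENNReal.ofReal (M ^ 2)) T φ‖ ≤ M * ‖(φ : Hilb X)‖ := by
  have h : ‖diag c (ENNReal.ofReal (M ^ 2)) T φ‖ₑ ^ 2 ≤ ENNReal.ofReal (M * ‖(φ : Hilb X)‖) ^ 2 :=
    (enorm_diag_sq_le c hT φ).trans_eq (by
      rw [ENNReal.ofReal_mul hM, mul_pow, ENNReal.ofReal_pow hM, ofReal_norm])
  rw [← ofReal_norm, ← ENNReal.ofReal_pow (norm_nonneg _),
    ← ENNReal.ofReal_pow (mul_nonneg hM (norm_nonneg (φ : Hilb X))),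
    ENNReal.ofReal_le_ofReal_iff (by positivity)] at h
  exact (sq_le_sq₀ (norm_nonneg _) (by positivity)).1 h

/-- Truncated diagonals of covariant operators are covariant. -/
lemma diag_translate (U : TranslationRep X) (c : Fin d → ℤ) (M : ℝ≥0∞) {e : Fin d → ℤ}
    {T S : Hc X →ₗ[ℂ] Hilb X}
    (hcov : ∀ φ ψ : Hc X, (ψ : Hilb X) = U.U e φ → S ψ = U.U e (T φ))
    (hblock : ∀ a b, blockSq S (a + e) (b + e) = blockSq T a b) (φ ψ : Hc X)
    (h : (ψ : Hilb X) = U.U e φ) : diag c M S ψ = U.U e (diag c M T φ) := by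
  rw [diag_apply, diag_apply, map_finsum (U.U e) (finite_support_truncBlock c M T φ)]
  refine finsum_eq_of_bijective (fun b => b - e) (Equiv.subRight e).bijective fun b => ?_
  obtain ⟨b, rfl⟩ : ∃ b', b = b' + e := ⟨b - e, (sub_add_cancel b e).symm⟩
  rw [add_sub_cancel_right]
  have h1 : b + e + c = b + c + e := by abel
  -- The truncation criterion is the block norm, which moves along with the translation, so the same
  -- blocks are kept on both sides.
  simp only [truncBlock, h1, hblock]
  split_ifs
  · simp only [LinearMap.comp_apply, Submodule.subtype_apply, h]
    rw [hcov _ _ (U.map_cell e b φ).symm, U.map_cell]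
  · simp

end Diagonal

/-! ### Effect of diagonal truncation on the column that carries the norm. -/

section Extension

variable {d : ℕ} {X : Type} [TopologicalSpace X] [MeasurableSpace X] [PosSpace d X]

lemma exists_extension_of_bound {T : Hc X →ₗ[ℂ] Hilb X} {C : ℝ}
    (h : ∀ φ : Hc X, ‖T φ‖ ≤ C * ‖(φ : Hilb X)‖) :
    ∃ S : Hilb X →L[ℂ] Hilb X, ∀ φ : Hc X, S φ = T φ := by
  refine ⟨(T.mkContinuous C h).extend (Hc X).subtypeL, fun φ => ?_⟩
  exact (T.mkContinuous C h).extend_eq (e := (Hc X).subtypeL)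
    (by simpa [DenseRange] using dense_Hc X) (isUniformInducing_val _) φ

variable [LocallyFiniteCells X]

open scoped Classical in
lemma cut_diag_cut_zero (c a : Fin d → ℤ) (M : ℝ≥0∞) (T : Hc X →ₗ[ℂ] Hilb X) (f : Hilb X) :
    ((cut a (diag c M T (cut 0 f)) : Hc X) : Hilb X) =
      if a = c ∧ blockSq T a 0 ≤ M then ((cut a (T (cut 0 f)) : Hc X) : Hilb X) else 0 := by
  obtain ⟨b, rfl⟩ : ∃ b, a = b + c := ⟨a - c, (sub_add_cancel a c).symm⟩
  rw [cut_diag]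
  by_cases hb : b = 0
  · subst hb
    simp only [truncBlock, zero_add, true_and]
    split_ifs
    · simp only [LinearMap.comp_apply, Submodule.subtype_apply, cut_cut]
    · rfl
  · rw [if_neg fun h => hb (by simpa using h.1), truncBlock]
    split_ifs
    · simp only [LinearMap.comp_apply, Submodule.subtype_apply, cut_cut_of_ne hb, map_zero]
    · rfl

lemma blockSq_diag_zero_le (c a : Fin d → ℤ) (M : ℝ≥0∞) (T : Hc X →ₗ[ℂ] Hilb X) :
    blockSq (diag c M T) a 0 ≤ blockSq T a 0 := by
  refine ENNReal.tsum_le_tsum fun i => ?_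
  rw [cut_diag_cut_zero]
  split_ifs <;> simp

-- After subtraction each block of the zeroth column is either removed entirely or left untouched,
-- which makes the remainder of the approximation explicit.
open scoped Classical in
lemma blockSq_sub_sum_diag (F : Finset (Fin d → ℤ)) (M : ℝ≥0∞) (T : Hc X →ₗ[ℂ] Hilb X)
    (a : Fin d → ℤ) : blockSq (T - ∑ c ∈ F, diag c M T) a 0 =
      if a ∈ F ∧ blockSq T a 0 ≤ M then 0 else blockSq T a 0 := by
  have h : ∀ f : Hilb X,
      ((cut a ((T - ∑ c ∈ F, diag c M T) (cut 0 f)) : Hc X) : Hilb X) =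
      if a ∈ F ∧ blockSq T a 0 ≤ M then 0 else ((cut a (T (cut 0 f)) : Hc X) : Hilb X) :=
      fun f => by
    rw [LinearMap.sub_apply, LinearMap.sum_apply, map_sub, map_sum, AddSubgroupClass.coe_sub,
      AddSubmonoidClass.coe_finsetSum]
    simp only [cut_diag_cut_zero]
    by_cases hM : blockSq T a 0 ≤ M <;> by_cases ha : a ∈ F <;> simp [hM, ha]
  conv_lhs => rw [blockSq]
  simp only [h]
  split_ifs
  · simp
  · rfl

end Extension

/-! ### Density of the almost surely bounded operators in `𝒦₂`. -/

namespace K2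

variable {d : ℕ} {X : Type} [TopologicalSpace X] [MeasurableSpace X] [PosSpace d X]
  {Ω : Type*} [MeasurableSpace Ω] [BorelSpace X] [SecondCountableTopology X]
  [AddAction (Fin d → ℤ) Ω] {P : Measure Ω} {U : TranslationRep X}
  [LocallyFiniteCells X]

lemma isMeasurable_diag (A : K2 P U) (c : Fin d → ℤ) (M : ℝ≥0∞) :
    IsMeasurable P fun ω => ACConductivity.diag c M (A.1 ω) := fun φ ψ => by
  classical
  obtain ⟨s, -, hs⟩ := Hc_eq_sum_cut ψ
  have h1 : ∀ ω, ACConductivity.diag c M (A.1 ω) ψ =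
      ∑ b ∈ s, truncBlock c M (A.1 ω) b ψ := fun ω => by
    rw [diag_apply]
    refine finsum_eq_sum_of_support_subset _ fun b hb => ?_
    by_contra h
    refine hb ?_
    simp only [truncBlock]
    split_ifs
    · simp only [LinearMap.comp_apply, Submodule.subtype_apply, hs b h, map_zero]
    · rfl
  simp only [h1, inner_sum]
  refine Finset.aemeasurable_fun_sum s fun b _ => ?_
  -- The truncation is an indicator of the random variable `blockSq`, so measurability reduces to
  -- that of a product.
  have h2 : ∀ ω, ⟪(φ : Hilb X), truncBlock c M (A.1 ω) b ψ⟫_ℂ =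
      (Set.Iic M).indicator 1 (blockSq (A.1 ω) (b + c) b) *
        ⟪((cut (b + c) (φ : Hilb X) : Hc X) : Hilb X), A.1 ω (cut b (ψ : Hilb X))⟫_ℂ := fun ω => by
    rw [truncBlock, inner_cut_left]
    by_cases h : blockSq (A.1 ω) (b + c) b ≤ M
    · rw [if_pos h, Set.indicator_of_mem (Set.mem_Iic.2 h), Pi.one_apply, one_mul]
      rfl
    · rw [if_neg h, Set.indicator_of_notMem fun h' => h (Set.mem_Iic.1 h'), zero_mul]
      simp
  simp only [h2]
  exact ((measurable_one.indicator measurableSet_Iic).comp_aemeasurable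
    (A.2.1.aemeasurable_blockSq _ _)).mul (A.2.1 _ _)

variable [MeasurableConstVAdd (Fin d → ℤ) Ω] [VAddInvariantMeasure (Fin d → ℤ) Ω P]

/-- The truncated diagonals of an element of `𝒦₂`. -/
def diag (c : Fin d → ℤ) (M : ℝ) (hM : 0 ≤ M) (A : K2 P U) : K2 P U :=
  ⟨fun ω => ACConductivity.diag c (ENNReal.ofReal (M ^ 2)) (A.1 ω), by
    refine mem_K2_of_rightBounded (isMeasurable_diag A c _) ?_ ?_ ?_
    · filter_upwards [A.2.2.1, IsCovariant.blockSq_vadd A.2.2.1 (ae_rightBounded A)] with ω h1 h2 e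
      exact diag_translate U c _ (h1 e) fun a b => h2 a b e
    · filter_upwards [ae_rightBounded A] with ω h b
      refine ⟨M, fun f => (norm_diag_le c hM h _).trans ?_⟩
      exact mul_le_mul_of_nonneg_left (norm_cut_le b f) hM
    · refine lt_of_le_of_lt ?_ A.2.2.2.2
      rw [hsNormSq_eq_lintegral_colSq, hsNormSq_eq_lintegral_colSq]
      refine lintegral_mono fun ω => ?_
      rw [← tsum_blockSq, ← tsum_blockSq]
      exact ENNReal.tsum_le_tsum fun a => blockSq_diag_zero_le c a _ _⟩

lemma coe_sum_diag (F : Finset (Fin d → ℤ)) {M : ℝ} (hM : 0 ≤ M) (A : K2 P U) (ω : Ω) :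
    (∑ c ∈ F, diag c M hM A : K2 P U).1 ω =
      ∑ c ∈ F, ACConductivity.diag c (ENNReal.ofReal (M ^ 2)) (A.1 ω) := by
  rw [AddSubmonoidClass.coe_finsetSum, Finset.sum_apply]
  rfl

lemma ae_bounded_sum_diag (F : Finset (Fin d → ℤ)) {M : ℝ} (hM : 0 ≤ M) (A : K2 P U) :
    ∀ᵐ ω ∂P, ∃ T : Hilb X →L[ℂ] Hilb X,
      ∀ φ : Hc X, T φ = (∑ c ∈ F, diag c M hM A : K2 P U).1 ω φ := by
  filter_upwards [ae_rightBounded A] with ω h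
  refine exists_extension_of_bound (C := ∑ c ∈ F, M) fun φ => ?_
  rw [coe_sum_diag, LinearMap.sum_apply, Finset.sum_mul]
  exact (norm_sum_le _ _).trans (Finset.sum_le_sum fun c _ => norm_diag_le c hM h φ)

open scoped Classical in
lemma hsNormSq_sub_sum_diag (F : Finset (Fin d → ℤ)) {M : ℝ} (hM : 0 ≤ M) (A : K2 P U) :
    hsNormSq P (A - ∑ c ∈ F, diag c M hM A : K2 P U).1 = ∑' a, ∫⁻ ω,
      (if a ∈ F ∧ blockSq (A.1 ω) a 0 ≤ ENNReal.ofReal (M ^ 2) then 0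
        else blockSq (A.1 ω) a 0) ∂P := by
  rw [← tsum_lintegral_col (A - ∑ c ∈ F, diag c M hM A : K2 P U).2.1]
  refine tsum_congr fun a => lintegral_congr fun ω => ?_
  rw [← blockSq_sub_sum_diag, ← coe_sum_diag F hM]
  rfl

/-- Dominated convergence twice, first in `ω` for a single block and then over the blocks of the
zeroth column, with the block weights of `A` as majorant. Their total is the finite norm of `A`. -/
lemma tendsto_hsNormSq_sub_sum_diag (A : K2 P U) {F : ℕ → Finset (Fin d → ℤ)}
    (hF : ∀ a, ∀ᶠ n in Filter.atTop, a ∈ F n) :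
    Filter.Tendsto (fun n : ℕ => hsNormSq P (A - ∑ c ∈ F n, diag c n n.cast_nonneg A : K2 P U).1)
      Filter.atTop (𝓝 0) := by
  classical
  simp only [hsNormSq_sub_sum_diag]
  have hfin : ∀ a, ∫⁻ ω, blockSq (A.1 ω) a 0 ∂P ≠ ∞ := fun a => by
    refine ne_top_of_le_ne_top A.2.2.2.2.ne ?_
    rw [← tsum_lintegral_col A.2.1]
    exact ENNReal.le_tsum (f := fun a => ∫⁻ ω, blockSq (A.1 ω) a 0 ∂P) a
  have h1 : ∀ a, Filter.Tendsto (fun n : ℕ => ∫⁻ ω,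
      (if a ∈ F n ∧ blockSq (A.1 ω) a 0 ≤ ENNReal.ofReal ((n : ℝ) ^ 2) then 0
        else blockSq (A.1 ω) a 0) ∂P) Filter.atTop (𝓝 0) := fun a => by
    have := tendsto_lintegral_of_dominated_convergence' (μ := P) (f := fun _ => 0)
      (F := fun (n : ℕ) ω => if a ∈ F n ∧ blockSq (A.1 ω) a 0 ≤ ENNReal.ofReal ((n : ℝ) ^ 2) then 0
        else blockSq (A.1 ω) a 0) (fun ω => blockSq (A.1 ω) a 0) (fun n => ?_)
      (fun n => Filter.Eventually.of_forall fun ω => by beta_reduce; split_ifs <;> simp) (hfin a) ?_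
    · simpa using this
    · have hm : Measurable fun x : ℝ≥0∞ =>
          if a ∈ F n ∧ x ≤ ENNReal.ofReal ((n : ℝ) ^ 2) then 0 else x := by
        by_cases ha : a ∈ F n
        · simp only [ha, true_and]
          exact Measurable.ite measurableSet_Iic measurable_const measurable_id
        · simp only [ha, false_and, if_false]
          exact measurable_id
      exact hm.comp_aemeasurable (A.2.1.aemeasurable_blockSq a 0)
    · filter_upwards [ae_lt_top' (A.2.1.aemeasurable_blockSq a 0) (hfin a)] with ω hω
      refine tendsto_const_nhds.congr' ?_
      obtain ⟨N, hN⟩ := exists_nat_ge (blockSq (A.1 ω) a 0).toReal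
      -- The threshold for the block weight is `n²`; from `n ≥ 1` and `n ≥ N` one gets `N ≤ n²`.
      filter_upwards [hF a, Filter.eventually_ge_atTop (max N 1)] with n h2 h3
      have h4 : (N : ℝ) ≤ n := by exact_mod_cast (le_max_left _ _).trans h3
      have h5 : (1 : ℝ) ≤ n := by exact_mod_cast (le_max_right _ _).trans h3
      have h6 : blockSq (A.1 ω) a 0 ≤ ENNReal.ofReal ((n : ℝ) ^ 2) :=
        (ENNReal.le_ofReal_iff_toReal_le hω.ne (by positivity)).2 (hN.trans (by nlinarith))
      exact (if_pos ⟨h2, h6⟩).symm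
  -- The sum over cells is an integral against counting measure, which brings it into the form for
  -- the second dominated convergence.
  simp only [← lintegral_count]
  have := tendsto_lintegral_of_dominated_convergence (μ := Measure.count) (f := fun _ => 0)
    (F := fun (n : ℕ) a => ∫⁻ ω,
      (if a ∈ F n ∧ blockSq (A.1 ω) a 0 ≤ ENNReal.ofReal ((n : ℝ) ^ 2) then 0
        else blockSq (A.1 ω) a 0) ∂P) (fun a => ∫⁻ ω, blockSq (A.1 ω) a 0 ∂P)
    (fun n => measurable_of_countable _) (fun n => Filter.Eventually.of_forall fun a =>
      lintegral_mono fun ω => by split_ifs <;> simp) ?_ (Filter.Eventually.of_forall h1)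
  · simpa using this
  · rw [lintegral_count, tsum_lintegral_col A.2.1]
    exact A.2.2.2.2.ne

/-- The bounded operators are dense in `𝒦₂`. -/
lemma dense_bounded : Dense {x : HK2 P U | ∃ A : K2 P U, (A : HK2 P U) = x ∧
    ∀ᵐ ω ∂P, ∃ T : Hilb X →L[ℂ] Hilb X, ∀ φ : Hc X, T φ = A.1 ω φ} := by
  refine fun x => (isClosed_closure.closure_subset_iff.2 ?_)
    (UniformSpace.Completion.denseRange_coe x)
  rintro _ ⟨A, rfl⟩
  -- Boxes that exhaust the lattice; a point `a` lies in all of them from `∑ |a j|` on.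
  let F : ℕ → Finset (Fin d → ℤ) := fun n => Fintype.piFinset fun _ => Finset.Icc (-n : ℤ) n
  have hF : ∀ a, ∀ᶠ n in Filter.atTop, a ∈ F n := fun a => by
    filter_upwards [Filter.eventually_ge_atTop (∑ j, (a j).natAbs)] with n hn
    refine Fintype.mem_piFinset.2 fun j => ?_
    have h := (Finset.single_le_sum (f := fun j => (a j).natAbs) (fun _ _ => Nat.zero_le _)
      (Finset.mem_univ j)).trans hn
    rw [Finset.mem_Icc]
    omega
  refine mem_closure_of_tendsto (f := fun n : ℕ =>
    ((∑ c ∈ F n, diag c n n.cast_nonneg A : K2 P U) : HK2 P U)) (b := Filter.atTop) ?_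
    (Filter.Eventually.of_forall fun n => ⟨_, rfl, ae_bounded_sum_diag _ _ A⟩)
  rw [tendsto_iff_norm_sub_tendsto_zero]
  have h1 : ∀ n : ℕ, ‖((∑ c ∈ F n, diag c n n.cast_nonneg A : K2 P U) : HK2 P U) - A‖ =
      √(hsNormSq P (A - ∑ c ∈ F n, diag c n n.cast_nonneg A : K2 P U).1).toReal := fun n => by
    rw [← norm_sq, Real.sqrt_sq (norm_nonneg _), norm_sub_rev, ← UniformSpace.Completion.coe_sub,
      UniformSpace.Completion.norm_coe]
  simp only [h1]
  have h2 := (ENNReal.tendsto_toReal ENNReal.zero_ne_top).comp (tendsto_hsNormSq_sub_sum_diag A hF)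
  simpa [Function.comp_def] using (Real.continuous_sqrt.tendsto _).comp h2

end K2

/-- The image of a projection-valued measure under a measurable map. -/
def PVM.map {S S' K : Type*} [MeasurableSpace S] [MeasurableSpace S'] [NormedAddCommGroup K]
    [InnerProductSpace ℂ K] (E : PVM S K) {q : S → S'} (hq : Measurable q) : PVM S' K where
  proj B := E.proj (q ⁻¹' B)
  symm B hB := E.symm _ (hq hB)
  univ := E.univ
  inter B C hB hC := E.inter _ _ (hq hB) (hq hC)
  iUnion B hB hd x y := by
    rw [Set.preimage_iUnion]
    exact E.iUnion _ (fun n => hq (hB n)) (fun i j hij => (hd hij).preimage q) x y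

/-! ### Existence of the joint spectral resolution. -/

section Existence

open PVM

variable {d : ℕ} {X : Type} [TopologicalSpace X] [MeasurableSpace X] [PosSpace d X]
  {Ω : Type*} [MeasurableSpace Ω] [BorelSpace X] [SecondCountableTopology X]
  [AddAction (Fin d → ℤ) Ω] {P : Measure Ω} {U : TranslationRep X}
  {H : Ω → Hilb X →ₗ.[ℂ] Hilb X}
  [MeasurableConstVAdd (Fin d → ℤ) Ω] [VAddInvariantMeasure (Fin d → ℤ) Ω P]
  [LocallyFiniteCells X]

/-- Both products are continuous, so they may be compared on the dense set of bounded operators,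
where commutation is associativity. For unbounded `A_ω` the definition of `⊙_R` through adjoints
makes a direct comparison delicate. -/
lemma K2.preL_preR_comm (hE : IsErgodicFamily P U H) {B C : Set ℝ} (hB : MeasurableSet B)
    (hC : MeasurableSet C) :
    (preL hE).toPVM.proj B * (preR hE).toPVM.proj C =
      (preR hE).toPVM.proj C * (preL hE).toPVM.proj B := by
  refine ContinuousLinearMap.ext fun x => congrFun
    (Continuous.ext_on (dense_bounded (P := P) (U := U))
    (ContinuousLinearMap.continuous _) (ContinuousLinearMap.continuous _) ?_) x
  rintro _ ⟨A, rfl, hA⟩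
  rw [← boundedFn_indicator _ hB, ← boundedFn_indicator _ hC, mul_apply_eq_comp, mul_apply_eq_comp,
    ← coe_fnL hE (.indicator hB), ← coe_fnR hE (.indicator hC), ← coe_fnL hE (.indicator hB),
    ← coe_fnR hE (.indicator hC)]
  exact coe_fnL_fnR_of_bounded hE (.indicator hB) (.indicator hC) hA

lemma bddMeas_exp (t : ℝ) : BddMeas fun l : ℝ => Complex.exp (-(Complex.I * t * l)) :=
  ⟨by fun_prop, 1, fun l => by rw [Complex.norm_exp]; simp⟩

lemma hsInner_evolve (hE : IsErgodicFamily P U H) (A : K2 P U) (s t : ℝ) :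
    hsInner P A.1 (evolveL H s (evolveR H t A.1)) =
      ⟪A, K2.fnL U P H (fun l => Complex.exp (-(Complex.I * s * l)))
        (K2.fnR U P H (fun l => Complex.exp (-(Complex.I * t * l))) A)⟫_ℂ := by
  change _ = hsInner P _ _
  rw [K2.fnL_val hE (bddMeas_exp s)]
  refine integral_congr_ae ?_
  filter_upwards [K2.ae_rightMul hE (bddMeas_exp t) A] with ω h
  rw [← K2.fnL_val hE (bddMeas_exp s), K2.fnL_val hE (bddMeas_exp s)]
  change ∑' i, ⟪_, evolution H s ω (rightMul A.1 (evolution H t) ω _)⟫_ℂ = _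
  rw [show rightMul A.1 (evolution H t) ω = _ from h]
  rfl

/-- The commuting self-adjoint operators `ℋ_L`, `ℋ_R`, `ℒ` have a joint spectral resolution. -/
lemma IsErgodicFamily.exists_isLiouvilleResolution (hE : IsErgodicFamily P U H) :
    ∃ R : PVM (ℝ × ℝ) (HK2 P U) × PVM ℝ (HK2 P U), IsLiouvilleResolution P U H R.1 R.2 := by
  obtain ⟨F, hF⟩ := exists_joint (K2.preL hE).toPVM (K2.preR hE).toPVM
    fun B C hB hC => K2.preL_preR_comm hE hB hC
  -- The spectral measures of `ℋ_L` and `ℋ_R` are the marginals of `F`, so functions of either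
  -- operator are functions of one coordinate.
  have hL : ∀ B, MeasurableSet B → (K2.preL hE).toPVM.proj B = F.proj (Prod.fst ⁻¹' B) :=
    fun B hB => by
      rw [← Set.prod_univ, hF B _ hB MeasurableSet.univ, (K2.preR hE).toPVM.univ, mul_one]
  have hR : ∀ B, MeasurableSet B → (K2.preR hE).toPVM.proj B = F.proj (Prod.snd ⁻¹' B) :=
    fun B hB => by
      rw [← Set.univ_prod, hF _ B MeasurableSet.univ hB, (K2.preL hE).toPVM.univ, one_mul]
  have hjoint : ∀ (A : K2 P U) (s t : ℝ), hsInner P A.1 (evolveL H s (evolveR H t A.1)) =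
      ∫ p : ℝ × ℝ, Complex.exp (-(Complex.I * (s * p.1 + t * p.2))) ∂F.measure (A : HK2 P U) := by
    intro A s t
    have hb1 := (bddMeas_exp s).comp measurable_fst (S' := ℝ × ℝ)
    have hb2 := (bddMeas_exp t).comp measurable_snd (S' := ℝ × ℝ)
    rw [hsInner_evolve hE, ← UniformSpace.Completion.inner_coe, K2.coe_fnL hE (bddMeas_exp s),
      K2.coe_fnR hE (bddMeas_exp t), boundedFn_eq_of_proj_eq measurable_fst hL (bddMeas_exp s),
      boundedFn_eq_of_proj_eq measurable_snd hR (bddMeas_exp t), ← mul_apply_eq_comp,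
      ← F.boundedFn_mul hb1 hb2, F.isIntegral_boundedFn (hb1.mul hb2)]
    congr 1 with p
    beta_reduce
    rw [← Complex.exp_add]
    ring_nf
  have hq : Measurable fun p : ℝ × ℝ => p.1 - p.2 := measurable_fst.sub measurable_snd
  -- With the spectral measure of `ℒ` defined as the image of `F` under the difference map, its
  -- defining identity is the joint one at times `(t, -t)`.
  refine ⟨(F, F.map hq), hjoint, fun A t => ?_⟩
  have hm : (F.map hq).measure (A : HK2 P U) = (F.measure (A : HK2 P U)).map
      fun p => p.1 - p.2 := by
    refine Measure.ext fun B hB => ?_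
    rw [measure_apply _ _ hB, Measure.map_apply hq hB, measure_apply _ _ (hq hB)]
    rfl
  change _ = ∫ l : ℝ, Complex.exp (-(Complex.I * t * l)) ∂(F.map hq).measure (A : HK2 P U)
  rw [hm, integral_map hq.aemeasurable (by fun_prop)]
  refine (hjoint A t (-t)).trans ?_
  congr 1 with p
  push_cast
  ring_nf

end Existence

end

end ACConductivity

theorem mainTheorem6 {d : ℕ} [NeZero d] {Ω : Type*} [MeasurableSpace Ω]
    [AddAction (Fin d → ℤ) Ω] [MeasurableConstVAdd (Fin d → ℤ) Ω]
    (P : Measure Ω) [IsProbabilityMeasure P] [ErgodicVAdd (Fin d → ℤ) Ω P] :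
    (∀ (M : ACConductivity.LatticeModel d P)
        (U : ACConductivity.TranslationRep (Fin d → ℤ)),
      ACConductivity.IsErgodicFamily P U M.H →
      ∀ (E : ℝ) (h : ACConductivity.FermiAssumption P U M.H E) (ν : ℝ), 0 < ν →
        Real.pi / 2 * h.Psi.real
            (Set.Ioc (E + ν / 4) (E + ν / 2) ×ˢ Set.Ioc (E - ν / 2) (E - ν / 4)) ≤
          h.avgConductivity ν ∧
        h.avgConductivity ν ≤
          Real.pi * h.Psi.real (Set.Ioc E (E + ν) ×ˢ Set.Ioc (E - ν) E)) ∧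
    (∀ (M : ACConductivity.ContinuumModel d P)
        (U : ACConductivity.TranslationRep (EuclideanSpace ℝ (Fin d))),
      ACConductivity.IsErgodicFamily P U M.H →
      ∀ (E : ℝ) (h : ACConductivity.FermiAssumption P U M.H E) (ν : ℝ), 0 < ν →
        Real.pi / 2 * h.Psi.real
            (Set.Ioc (E + ν / 4) (E + ν / 2) ×ˢ Set.Ioc (E - ν / 2) (E - ν / 4)) ≤
          h.avgConductivity ν ∧
        h.avgConductivity ν ≤
          Real.pi * h.Psi.real (Set.Ioc E (E + ν) ×ˢ Set.Ioc (E - ν) E)) := by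
  exact ⟨fun M U hE E h ν hν => h.bounds hE.exists_isLiouvilleResolution hν,
    fun M U hE E h ν hν => h.bounds hE.exists_isLiouvilleResolution hν⟩
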